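/- **Definitions.** For $f:\mathbb N\to\mathbb N$ and $g:\mathbb N\to\mathbb R$, let $NDTIME(f(n),g(n))$ be the class of languages over $\{0,1\}$ solvable in $O(g(n))$ time by a multi-tape Turing machine using an $f(n)$-bit non-deterministic oracle: on every input $x$ of length $n$ the machine may ask the oracle for bits one after another, at most $f(n)$ of them; whatever the bits are, it halts within $O(g(n))$ steps; and $x$ belongs to the language if and only if some sequence of oracle bits makes it accept. Let $DTIME(g(n))=NDTIME(0,g(n))$. For an integer $\ell\ge 3$, the (decision version of the) problem of detecting a minimum weight $\ell$-clique is: given an undirected graph on $N$ vertices with integer edge weights and an integer threshold $d$, decide whether the graph contains an $\ell$-clique of total edge weight smaller than $d$. An instance has weights in a set $Q$ if all its edge weights and $d$ lie in $Q$. An algorithm for this problem is a program for a random access machine under the logarithmic cost criterion, which receives $N$, $d$ and the weighted adjacency matrix written in binary; its running time is measured as a function of $N$. **Theorem.** Let $k\ge 0$ be real, let $h:\mathbb N\to\mathbb R$ satisfy $h(N)\to 0$, and let $Q=Q_N=\{-2^{N^{k+h(N)}},\dots,2^{N^{k+h(N)}}\}$ be the set of integers of absolute value at most $2^{N^{k+h(N)}}$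 (that is, $Q=\{-2^{N^{k+o(1)}},\dots,2^{N^{k+o(1)}}\}$). Let $\ell\ge 3$ be an integer. Suppose that for every $\varepsilon>0$ the problem of detecting a minimum weight $\ell$-clique in a graph on $N$ vertices with weights in $Q$ does not admit an $O(N^{\ell-\varepsilon+k+o(1)})$-time algorithm. Then for every $\varepsilon'>0$, $$NDTIME\Big((\ell-2)\Big\lceil \tfrac{1}{2+k}\log_2 n\Big\rceil,\ n\Big)\not\subseteq DTIME\Big(n^{1+\frac{\ell-2}{2+k}-\varepsilon'}\Big).$$ (For $n=0$, where $\log_2 n$ is undefined, no oracle bits are allowed.) -/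

import Mathlib

open Filter Topology Asymptotics

noncomputable section

/-! ## Multi-tape Turing machines with a non-deterministic bit oracle -/

/-- What a machine does to its `m` tapes and its state in one step: the new state, the symbol
written on each tape, and the direction in which each head moves (`none` = stay). -/
structure TMAction (m : ℕ) (Γ Λ : Type) where
  next : Λ
  write : Fin m → Γ
  move : Fin m → Option Turing.Dir

/-- The entry of the transition table for a state and the scanned symbols: halt and accept or
reject, perform an action, or ask the oracle for its next bit and act according to it. -/
inductive TMMove (m : ℕ) (Γ Λ : Type) where
  | halt (answer : Bool) : TMMove m Γ Λ
  | det (a : TMAction m Γ Λ) : TMMove m Γ Λ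
  | guess (a : Bool → TMAction m Γ Λ) : TMMove m Γ Λ

/-- A multi-tape Turing machine with a finite alphabet and finitely many states, and with
`workTapes + 1` two-way infinite tapes; tape `0` holds the binary input. The default symbol is the
blank. -/
structure OracleTM where
  workTapes : ℕ
  Γ : Type
  Λ : Type
  [finΓ : Finite Γ]
  [finΛ : Finite Λ]
  [blank : Inhabited Γ]
  sym : Bool → Γ
  sym_injective : Function.Injective sym
  sym_ne_blank : ∀ b, sym b ≠ default
  start : Λ
  trans : Λ → (Fin (workTapes + 1) → Γ) → TMMove (workTapes + 1) Γ Λ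

namespace OracleTM

attribute [instance] OracleTM.finΓ OracleTM.finΛ OracleTM.blank

/-- A configuration: the state and the tapes with their head positions. -/
structure Cfg (M : OracleTM) where
  state : M.Λ
  tape : Fin (M.workTapes + 1) → Turing.Tape M.Γ

variable {M : OracleTM}

/-- The table entry that applies in a configuration. -/
def Cfg.current (c : Cfg M) : TMMove (M.workTapes + 1) M.Γ M.Λ :=
  M.trans c.state fun i => (c.tape i).head

/-- The configuration after an action (write, then move). -/
def Cfg.act (c : Cfg M) (a : TMAction (M.workTapes + 1) M.Γ M.Λ) : Cfg M where
  state := a.next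
  tape := fun i =>
    match a.move i with
    | none => (c.tape i).write (a.write i)
    | some d => ((c.tape i).write (a.write i)).move d

/-- The initial configuration: the input on tape `0` with the head on its first symbol, the
other tapes blank. -/
def init (M : OracleTM) (x : List Bool) : Cfg M where
  state := M.start
  tape := fun i => if i = 0 then Turing.Tape.mk₁ (x.map M.sym) else Turing.Tape.mk₁ []

/-- `Run c bs t b`: from configuration `c` the machine, receiving from the oracle exactly the
bits `bs` in this order, halts after `t` steps with answer `b`. -/
inductive Run : Cfg M → List Bool → ℕ → Bool → Prop where
  | halt {c : Cfg M} {b : Bool} (hc : c.current = .halt b) : Run c [] 0 b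
  | det {c : Cfg M} {a} {bs : List Bool} {t : ℕ} {b : Bool} (hc : c.current = .det a)
      (h : Run (c.act a) bs t b) : Run c bs (t + 1) b
  | guess {c : Cfg M} {a} (y : Bool) {bs : List Bool} {t : ℕ} {b : Bool}
      (hc : c.current = .guess a) (h : Run (c.act (a y)) bs t b) : Run c (y :: bs) (t + 1) b

end OracleTM

/-- `NDTIME f g`: the languages over `{0,1}` solvable in `O(g(n))` time by a multi-tape Turing
machine using an `f(n)`-bit non-deterministic oracle. On an input `x` of length `n`, whatever the
`f(n)` oracle bits are, the machine halts in `O(g(n))` steps without asking for further bits;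
and `x` is in the language iff some oracle bits make it accept. -/
def NDTIME (f : ℕ → ℕ) (g : ℕ → ℝ) : Set (Set (List Bool)) :=
  {L | ∃ (M : OracleTM) (T : ℕ → ℕ), (fun n => (T n : ℝ)) =O[atTop] g ∧
    ∀ x : List Bool,
      (∀ ys : List Bool, ys.length = f x.length →
        ∃ bs, bs <+: ys ∧ ∃ t, t ≤ T x.length ∧ ∃ b, OracleTM.Run (M.init x) bs t b) ∧
      (x ∈ L ↔ ∃ bs t, OracleTM.Run (M.init x) bs t true)}

/-- `DTIME g = NDTIME 0 g`. -/
def DTIME (g : ℕ → ℝ) : Set (Set (List Bool)) :=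
  NDTIME (fun _ => 0) g

/-! ## Random access machines under the logarithmic cost criterion

Registers `0, 1, 2, …` hold integers, register `0` is the accumulator, and the input is read
symbol by symbol from a one-way tape. -/

namespace RAM

/-- Memory operands: register `i`, or the register whose index is the content of register `i`. -/
inductive Addr where
  | dir (i : ℕ) : Addr
  | ind (i : ℕ) : Addr

/-- Operands: an integer constant or the content of a register. -/
inductive Operand where
  | lit (z : ℤ) : Operand
  | mem (a : Addr) : Operand

/-- Instructions; jump targets are positions in the program. -/
inductive Instr where
  | load (a : Operand) : Instr
  | store (a : Addr) : Instr
  | add (a : Operand) : Instr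
  | sub (a : Operand) : Instr
  | mult (a : Operand) : Instr
  | div (a : Operand) : Instr
  | read (a : Addr) : Instr
  | jump (p : ℕ) : Instr
  | jgtz (p : ℕ) : Instr
  | jzero (p : ℕ) : Instr
  | halt : Instr

/-- A configuration: program counter, registers, unread input. -/
structure Cfg where
  pc : ℕ
  reg : ℕ → ℤ
  input : List ℤ

/-- The length of an integer in binary: `⌊log₂ |z|⌋ + 1`, and `1` for `z = 0`. -/
def len (z : ℤ) : ℕ := Nat.log 2 z.natAbs + 1

/-- The register denoted by a memory operand; undefined for a negative indirect address. -/
def Addr.loc (r : ℕ → ℤ) : Addr → Option ℕ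
  | .dir i => some i
  | .ind i => if 0 ≤ r i then some (r i).toNat else none

def Addr.cost (r : ℕ → ℤ) : Addr → ℕ
  | .dir i => len i
  | .ind i => len i + len (r i)

def Operand.val (r : ℕ → ℤ) : Operand → Option ℤ
  | .lit z => some z
  | .mem a => (a.loc r).map r

def Operand.cost (r : ℕ → ℤ) : Operand → ℕ
  | .lit z => len z
  | .mem a => a.cost r + ((a.loc r).map fun i => len (r i)).getD 0

/-- The symbol under the input head; `0` marks the end of the input. -/
def Cfg.scanned (c : Cfg) : ℤ := c.input.headD 0

/-- Put `z` into register `i` and go on to the next instruction. -/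
def Cfg.put (c : Cfg) (i : ℕ) (z : ℤ) : Cfg :=
  { c with pc := c.pc + 1, reg := Function.update c.reg i z }

/-- Effect of an instruction; `none` means that the machine halts. It does so at `halt` and
where the instruction is undefined (negative indirect address, division by zero). -/
def Instr.exec (c : Cfg) : Instr → Option Cfg
  | .load a => (a.val c.reg).map fun v => c.put 0 v
  | .store a => (a.loc c.reg).map fun i => c.put i (c.reg 0)
  | .add a => (a.val c.reg).map fun v => c.put 0 (c.reg 0 + v)
  | .sub a => (a.val c.reg).map fun v => c.put 0 (c.reg 0 - v)
  | .mult a => (a.val c.reg).map fun v => c.put 0 (c.reg 0 * v)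
  | .div a => (a.val c.reg).bind fun v =>
      if v = 0 then none else some (c.put 0 (Int.fdiv (c.reg 0) v))
  | .read a => (a.loc c.reg).map fun i => { c.put i c.scanned with input := c.input.tail }
  | .jump p => some { c with pc := p }
  | .jgtz p => some { c with pc := if 0 < c.reg 0 then p else c.pc + 1 }
  | .jzero p => some { c with pc := if c.reg 0 = 0 then p else c.pc + 1 }
  | .halt => none

/-- Logarithmic cost of an instruction. -/
def Instr.cost (c : Cfg) : Instr → ℕ
  | .load a => a.cost c.reg
  | .store a => len (c.reg 0) + a.cost c.reg
  | .add a => len (c.reg 0) + a.cost c.reg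
  | .sub a => len (c.reg 0) + a.cost c.reg
  | .mult a => len (c.reg 0) + a.cost c.reg
  | .div a => len (c.reg 0) + a.cost c.reg
  | .read a => len c.scanned + a.cost c.reg
  | .jump _ => 1
  | .jgtz _ => len (c.reg 0)
  | .jzero _ => len (c.reg 0)
  | .halt => 1

/-- The instruction about to be executed; beyond the end of the program it is `halt`. -/
def Cfg.current (P : List Instr) (c : Cfg) : Instr := P.getD c.pc .halt

/-- `Run P c t c'`: the program `P`, started in configuration `c`, halts in configuration `c'`
after instructions of total logarithmic cost `t`. -/
inductive Run (P : List Instr) : Cfg → ℕ → Cfg → Prop where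
  | halt {c : Cfg} (hc : (c.current P).exec c = none) : Run P c ((c.current P).cost c) c
  | step {c c' c'' : Cfg} {t : ℕ} (hc : (c.current P).exec c = some c') (h : Run P c' t c'') :
      Run P c ((c.current P).cost c + t) c''

/-- The initial configuration for a binary input: all registers `0`, the bits `0` and `1` coded
on the input tape by the integers `1` and `2`. -/
def init (x : List Bool) : Cfg where
  pc := 0
  reg := fun _ => 0
  input := x.map fun b => if b then 2 else 1

/-- The program `P` decides within logarithmic cost `t`, on input `x`, whether `p` holds: it
halts, with a non-zero accumulator iff `p` holds. -/
def DecidesWithin (P : List Instr) (x : List Bool) (t : ℕ) (p : Prop) : Prop :=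
  ∃ s, s ≤ t ∧ ∃ c, Run P (init x) s c ∧ (c.reg 0 ≠ 0 ↔ p)

end RAM

/-! ## Minimum weight cliques -/

/-- An instance of the decision version of the minimum weight clique problem: a graph on `N`
vertices, integer edge weights (values off the edge set are ignored), and a threshold. -/
structure CliqueInstance (N : ℕ) where
  graph : SimpleGraph (Fin N)
  weight : Sym2 (Fin N) → ℤ
  bound : ℤ

namespace CliqueInstance

variable {N : ℕ}

/-- Total edge weight of the pairs of distinct vertices in `s`. -/
def totalWeight (I : CliqueInstance N) (s : Finset (Fin N)) : ℤ :=
  ∑ p ∈ (s ×ˢ s).filter (fun p => p.1 < p.2), I.weight s(p.1, p.2)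

/-- There is an `ℓ`-clique of total weight smaller than the threshold. -/
def IsYes (ℓ : ℕ) (I : CliqueInstance N) : Prop :=
  ∃ s : Finset (Fin N), I.graph.IsNClique ℓ s ∧ I.totalWeight s < I.bound

/-- The edge weights and the threshold are integers of absolute value at most `B`. -/
def InRange (B : ℝ) (I : CliqueInstance N) : Prop :=
  (∀ e ∈ I.graph.edgeSet, |(I.weight e : ℝ)| ≤ B) ∧ |(I.bound : ℝ)| ≤ B

/-- Self-delimiting code of a natural number: its binary digits, each preceded by a `1`, and a
final `0`. -/
def encodeNat (n : ℕ) : List Bool := n.bits.flatMap (fun b => [true, b]) ++ [false]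

/-- Code of an integer: a sign bit and the code of its absolute value. -/
def encodeInt (z : ℤ) : List Bool := decide (z < 0) :: encodeNat z.natAbs

open Classical in
/-- Code of an instance: `N`, the threshold, and the weighted adjacency matrix row by row. -/
def encode (I : CliqueInstance N) : List Bool :=
  encodeNat N ++ encodeInt I.bound ++
    (List.finRange N).flatMap fun i => (List.finRange N).flatMap fun j =>
      if I.graph.Adj i j then true :: encodeInt (I.weight s(i, j)) else [false]

end CliqueInstance

/-- The (decision version of the) minimum weight `ℓ`-clique problem, for graphs on `N` vertices
with edge weights of absolute value at most `B N`, admits an `O(τ(N))`-time algorithm on a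
random access machine with logarithmic cost. -/
def MinWeightCliqueSolvable (ℓ : ℕ) (B : ℕ → ℝ) (τ : ℕ → ℝ) : Prop :=
  ∃ (P : List RAM.Instr) (T : ℕ → ℕ), (fun N => (T N : ℝ)) =O[atTop] τ ∧
    ∀ (N : ℕ) (I : CliqueInstance N), I.InRange (B N) →
      RAM.DecidesWithin P I.encode (T N) (I.IsYes ℓ)

end

/-! The proof is by contraposition. Put L = ℓ - 2 and suppose that linear time with L⌈log₂ n/(2+k)⌉
oracle bits can be simulated deterministically in time n^(1 + L/(2+k) - ε'). A graph on N vertices,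
whose weights have about N^k bits, is rewritten as a string of length n ≈ N^(2+k). Then log₂ n/(2+k)
≈ log₂ N, so the oracle bits suffice to name L vertices, and the deterministic machine needs about
N^((2+k)(1 + L/(2+k) - ε')) = N^(ℓ + k - (2+k)ε') steps. This contradicts the hardness assumption as
soon as a single linear-time oracle machine can read off from the string whether a light clique
exists.

A tape head cannot jump to the row of a guessed vertex, so the string is a stream of commands which
a fixed machine, `Interp.machine`, executes as they arrive. The stream runs through the weight
matrix repeatedly, digit by digit. In each of L phases the oracle writes a vertex number u into a
binary counter, which is decremented at every row; the row where it underflows is row u, and only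
there are the data tapes changed (`execs_dec`, `execs_phaseCmds`). The first data tape collects, for
every vertex w, the weight between w and the guessed vertices. The second collects, for every w, the
same sum plus the weight inside the guessed set minus the threshold. A final pass tries all pairs
(v, w): the total for the clique is entry (v, w) plus block v of the first tape plus block w of the
second. Hence the last two vertices need no guess. Numbers are vectors of signed digits, added
without carries modulo a fixed Q; the sign of a total is the sign of its last carry
(`carry_neg_iff`). A missing edge has the digit K in all places, which makes it too heavy to be used
(`isYes_iff`).

The machine must respect the bound on oracle bits on every input, without time to compute a
logarithm. It earns tokens by reading leading zeros: having j > 0 tokens requires at least R^j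
symbols, R = 2^s, and a token is worth L p bits, where s/p is a rational number slightly above 2 + k
(`padTime`, `guesses_le`). For a graph with N ≤ 2^(pm) the stream starts with 3·2^(sm) zeros, which
is of order N^(s/p) and yields m tokens.

On the side of the random access machine, programs are written in a small while language with a
charge for each run; compilation costs a logarithmic factor (`Stmt.compiled`). In this language the
instance is parsed (`readGraph_ev`), the stream is generated in time linear in its length
(`generable_streamGen`), and the deterministic machine is simulated on it with constant overhead per
step (`exists_simulator`). `exists_program` combines these. The logarithms and the excess of s/p
over 2 + k only change the exponent by an arbitrarily small amount. -/

noncomputable section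

/-! ## Configurations with tapes presented as functions on the integers -/

namespace OracleTM

/-- The displacement of a head. -/
def shift : Option Turing.Dir → ℤ
  | none => 0
  | some .left => -1
  | some .right => 1

/-- A configuration whose tapes are functions on `ℤ` together with absolute head positions. -/
@[ext] structure FCfg (M : OracleTM) where
  state : M.Λ
  pos : Fin (M.workTapes + 1) → ℤ
  cont : Fin (M.workTapes + 1) → ℤ → M.Γ

variable {M : OracleTM}

def FCfg.current (c : FCfg M) : TMMove (M.workTapes + 1) M.Γ M.Λ :=
  M.trans c.state fun i => c.cont i (c.pos i)

def FCfg.act (c : FCfg M) (a : TMAction (M.workTapes + 1) M.Γ M.Λ) : FCfg M where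
  state := a.next
  pos := fun i => c.pos i + shift (a.move i)
  cont := fun i => Function.update (c.cont i) (c.pos i) (a.write i)

/-- The function configuration `f` describes the configuration `c`. -/
def Describes (c : Cfg M) (f : FCfg M) : Prop :=
  c.state = f.state ∧ ∀ i z, (c.tape i).nth z = f.cont i (f.pos i + z)

theorem Describes.current_eq {c : Cfg M} {f : FCfg M} (h : Describes c f) :
    c.current = f.current := by
  unfold Cfg.current FCfg.current
  rw [h.1]
  congr 1
  funext i
  have := h.2 i 0
  simpa using this

theorem Describes.act {c : Cfg M} {f : FCfg M} (h : Describes c f)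
    (a : TMAction (M.workTapes + 1) M.Γ M.Λ) : Describes (c.act a) (f.act a) := by
  refine ⟨rfl, fun i z => ?_⟩
  have key : ∀ z, ((c.tape i).write (a.write i)).nth z
      = Function.update (f.cont i) (f.pos i) (a.write i) (f.pos i + z) := by
    intro z
    rw [Turing.Tape.write_nth, h.2, Function.update_apply]
    simp
  simp only [Cfg.act, FCfg.act]
  cases hm : a.move i with
  | none => simpa [shift] using key z
  | some d =>
    cases d with
    | left =>
      simp only [Turing.Tape.move_left_nth, key, shift]
      congr 1; ring
    | right =>
      simp only [Turing.Tape.move_right_nth, key, shift]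
      congr 1; ring

/-- `Run` for function configurations. -/
inductive FRun : FCfg M → List Bool → ℕ → Bool → Prop where
  | halt {c : FCfg M} {b : Bool} (hc : c.current = .halt b) : FRun c [] 0 b
  | det {c : FCfg M} {a} {bs : List Bool} {t : ℕ} {b : Bool} (hc : c.current = .det a)
      (h : FRun (c.act a) bs t b) : FRun c bs (t + 1) b
  | guess {c : FCfg M} {a} (y : Bool) {bs : List Bool} {t : ℕ} {b : Bool}
      (hc : c.current = .guess a) (h : FRun (c.act (a y)) bs t b) : FRun c (y :: bs) (t + 1) b

theorem Run.toFRun {c : Cfg M} {bs : List Bool} {t : ℕ} {b : Bool} (h : Run c bs t b) :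
    ∀ f : FCfg M, Describes c f → FRun f bs t b := by
  induction h with
  | halt hc => exact fun f hf => .halt (hf.current_eq ▸ hc)
  | det hc _ ih => exact fun f hf => .det (hf.current_eq ▸ hc) (ih _ (hf.act _))
  | guess y hc _ ih => exact fun f hf => .guess y (hf.current_eq ▸ hc) (ih _ (hf.act _))

theorem FRun.toRun {f : FCfg M} {bs : List Bool} {t : ℕ} {b : Bool} (h : FRun f bs t b) :
    ∀ c : Cfg M, Describes c f → Run c bs t b := by
  induction h with
  | halt hc => exact fun c hf => .halt (hf.current_eq.trans hc)
  | det hc _ ih => exact fun c hf => .det (hf.current_eq.trans hc) (ih _ (hf.act _))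
  | guess y hc _ ih => exact fun c hf => .guess y (hf.current_eq.trans hc) (ih _ (hf.act _))

/-- The content of a tape that holds the word `l` from cell `0` on. -/
def wordTape (M : OracleTM) (l : List Bool) (z : ℤ) : M.Γ :=
  if 0 ≤ z then ((l[z.toNat]?).map M.sym).getD default else default

/-- The initial configuration, with tapes as functions. -/
def finit (M : OracleTM) (x : List Bool) : FCfg M where
  state := M.start
  pos := 0
  cont := fun i => if i = 0 then wordTape M x else fun _ => default

theorem nth_mk₁ {Γ : Type*} [Inhabited Γ] (l : List Γ) (z : ℤ) :
    (Turing.Tape.mk₁ l).nth z = if 0 ≤ z then (l[z.toNat]?).getD default else default := by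
  rcases z with n | n
  · have := Turing.Tape.mk'_nth_nat (Turing.ListBlank.mk ([] : List Γ)) (Turing.ListBlank.mk l) n
    rw [Turing.Tape.mk₁, Turing.Tape.mk₂]
    erw [this]
    simp [Turing.ListBlank.nth_mk, List.getI_eq_getElem?_getD]
  · have : ∀ (h : Γ) (R : Turing.ListBlank Γ),
        (Turing.Tape.mk h (Turing.ListBlank.mk ([] : List Γ)) R).nth (Int.negSucc n) = default := by
      intro h R
      change (Turing.ListBlank.mk ([] : List Γ)).nth n = default
      simp [Turing.ListBlank.nth_mk]
    rw [if_neg (by omega)]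
    exact this _ _

theorem describes_init (x : List Bool) : Describes (M.init x) (finit M x) := by
  refine ⟨rfl, fun i z => ?_⟩
  by_cases hi : i = 0
  · simp [init, finit, hi, nth_mk₁, wordTape, List.getElem?_map]
  · simp [init, finit, hi, nth_mk₁]

theorem run_init_iff {x : List Bool} {bs : List Bool} {t : ℕ} {b : Bool} :
    Run (M.init x) bs t b ↔ FRun (finit M x) bs t b :=
  ⟨fun h => h.toFRun _ (describes_init x), fun h => h.toRun _ (describes_init x)⟩

/-- Runs on oracle strings that are prefixes of a common string agree. -/
theorem FRun.unique {c : FCfg M} {bs bs' ys : List Bool} {t t' : ℕ} {b b' : Bool}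
    (h : FRun c bs t b) (h' : FRun c bs' t' b') (hp : bs <+: ys) (hp' : bs' <+: ys) : b = b' := by
  induction h generalizing bs' ys t' with
  | halt hc =>
    cases h' with
    | halt hc' => rw [hc] at hc'; injection hc'
    | det hc' => rw [hc] at hc'; cases hc'
    | guess y hc' => rw [hc] at hc'; cases hc'
  | det hc _ ih =>
    cases h' with
    | halt hc' => rw [hc] at hc'; cases hc'
    | det hc' h' =>
      rw [hc] at hc'; injection hc' with e; subst e
      exact ih h' hp hp'
    | guess y hc' => rw [hc] at hc'; cases hc'
  | guess y hc _ ih =>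
    cases h' with
    | halt hc' => rw [hc] at hc'; cases hc'
    | det hc' => rw [hc] at hc'; cases hc'
    | guess y' hc' h' =>
      rw [hc] at hc'; injection hc' with e; subst e
      obtain ⟨r, rfl⟩ := hp
      obtain ⟨r', e'⟩ := hp'
      simp only [List.cons_append, List.cons.injEq] at e'
      obtain ⟨rfl, e'⟩ := e'
      exact ih h' ⟨r, rfl⟩ ⟨r', e'⟩

end OracleTM

/-! ## A while language and its compilation to random access machines -/

namespace While

/-- Integer expressions; `get e` reads the memory cell with index `|e|`. -/
inductive Expr where
  | lit (z : ℤ) : Expr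
  | var (x : ℕ) : Expr
  | add (a b : Expr) : Expr
  | sub (a b : Expr) : Expr
  | mul (a b : Expr) : Expr
  | get (a : Expr) : Expr

/-- A state: variables, memory cells, unread input. -/
@[ext] structure St where
  v : ℕ → ℤ
  m : ℕ → ℤ
  inp : List ℤ

def Expr.eval (σ : St) : Expr → ℤ
  | .lit z => z
  | .var x => σ.v x
  | .add a b => a.eval σ + b.eval σ
  | .sub a b => a.eval σ - b.eval σ
  | .mul a b => a.eval σ * b.eval σ
  | .get a => σ.m (a.eval σ).natAbs

/-- Statements; `ite e p q` and `loop e p` test whether `e` is positive. -/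
inductive Stmt where
  | skip : Stmt
  | set (x : ℕ) (e : Expr) : Stmt
  | inc (x : ℕ) (z : ℤ) : Stmt
  | put (a e : Expr) : Stmt
  | read (x : ℕ) : Stmt
  | seq (p q : Stmt) : Stmt
  | ite (e : Expr) (p q : Stmt) : Stmt
  | loop (e : Expr) (p : Stmt) : Stmt

infixr:60 " ;; " => Stmt.seq

def St.setv (σ : St) (x : ℕ) (z : ℤ) : St := { σ with v := Function.update σ.v x z }

def St.setm (σ : St) (i : ℕ) (z : ℤ) : St := { σ with m := Function.update σ.m i z }

/-- `Ev p σ t τ`: the statement `p` leads from `σ` to `τ` at charge `t`. An assignment is charged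
the absolute value assigned, so that the charge also bounds the growth of the values. -/
inductive Ev : Stmt → St → ℕ → St → Prop where
  | skip {σ} : Ev .skip σ 0 σ
  | set {x e σ} : Ev (.set x e) σ ((e.eval σ).natAbs + 1) (σ.setv x (e.eval σ))
  | inc {x z σ} : Ev (.inc x z) σ (z.natAbs + 1) (σ.setv x (σ.v x + z))
  | put {a e σ} : Ev (.put a e) σ ((e.eval σ).natAbs + 1) (σ.setm (a.eval σ).natAbs (e.eval σ))
  | read {x σ} : Ev (.read x) σ 1 { σ.setv x (σ.inp.headD 0) with inp := σ.inp.tail }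
  | seq {p q σ σ' τ t t'} (hp : Ev p σ t σ') (hq : Ev q σ' t' τ) : Ev (.seq p q) σ (t + t') τ
  | iteT {e p q σ τ t} (he : 0 < e.eval σ) (hp : Ev p σ t τ) : Ev (.ite e p q) σ (t + 1) τ
  | iteF {e p q σ τ t} (he : ¬ 0 < e.eval σ) (hq : Ev q σ t τ) : Ev (.ite e p q) σ (t + 1) τ
  | loopT {e p σ σ' τ t t'} (he : 0 < e.eval σ) (hp : Ev p σ t σ') (hq : Ev (.loop e p) σ' t' τ) :
      Ev (.loop e p) σ (t + t' + 1) τ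
  | loopF {e p σ} (he : ¬ 0 < e.eval σ) : Ev (.loop e p) σ 1 σ

/-- All values in the state have absolute value at most `B`. -/
def Bdd (B : ℕ) (σ : St) : Prop :=
  (∀ x, (σ.v x).natAbs ≤ B) ∧ (∀ i, (σ.m i).natAbs ≤ B) ∧ ∀ z ∈ σ.inp, z.natAbs ≤ B

theorem Bdd.mono {B B' : ℕ} {σ : St} (h : Bdd B σ) (hB : B ≤ B') : Bdd B' σ :=
  ⟨fun x => (h.1 x).trans hB, fun i => (h.2.1 i).trans hB, fun z hz => (h.2.2 z hz).trans hB⟩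

theorem Bdd.setv {B : ℕ} {σ : St} (h : Bdd B σ) {z : ℤ} (hz : z.natAbs ≤ B) (x : ℕ) :
    Bdd B (σ.setv x z) := by
  refine ⟨fun y => ?_, h.2.1, h.2.2⟩
  simp only [St.setv, Function.update_apply]
  split
  · exact hz
  · exact h.1 y

theorem Bdd.setm {B : ℕ} {σ : St} (h : Bdd B σ) {z : ℤ} (hz : z.natAbs ≤ B) (x : ℕ) :
    Bdd B (σ.setm x z) := by
  refine ⟨h.1, fun y => ?_, h.2.2⟩
  simp only [St.setm, Function.update_apply]
  split
  · exact hz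
  · exact h.2.1 y

/-- A run pays for every assignment with the value assigned, or with the increment, so no value can
outgrow the initial bound by more than the charge. Operand lengths are thus logarithmic in the
charge itself. -/
theorem Bdd.ev {p : Stmt} {σ τ : St} {t B : ℕ} (h : Ev p σ t τ) (hB : Bdd B σ) :
    Bdd (B + t) τ := by
  induction h generalizing B with
  | skip => exact hB
  | set => exact (hB.mono (by omega)).setv (by omega) _
  | @inc x z σ =>
    refine (hB.mono (by omega)).setv ?_ _
    have := hB.1 x
    omega
  | put => exact (hB.mono (by omega)).setm (by omega) _
  | @read x σ =>
    have h0 : (σ.inp.headD 0).natAbs ≤ B := by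
      cases hi : σ.inp with
      | nil => simp
      | cons a l => exact hB.2.2 a (by simp [hi])
    have := (hB.mono (by omega : B ≤ B + 1)).setv (h0.trans (by omega)) x
    exact ⟨this.1, this.2.1, fun z hz => this.2.2 z (List.mem_of_mem_tail hz)⟩
  | seq _ _ ih1 ih2 => exact (ih2 (ih1 hB)).mono (by omega)
  | iteT _ _ ih => exact (ih hB).mono (by omega)
  | iteF _ _ ih => exact (ih hB).mono (by omega)
  | loopT _ _ _ ih1 ih2 => exact (ih2 (ih1 hB)).mono (by omega)
  | loopF => exact hB.mono (by omega)

/-- Polynomial bound on the value of an expression. -/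
theorem Expr.eval_bound (e : Expr) :
    ∃ D, ∀ σ B, Bdd B σ → (e.eval σ).natAbs ≤ (B + 2) ^ D := by
  have base : ∀ (B D : ℕ), 1 ≤ (B + 2) ^ D := fun B D => Nat.one_le_pow _ _ (by omega)
  have hadd : ∀ (B D D' x y : ℕ), x ≤ (B + 2) ^ D → y ≤ (B + 2) ^ D' →
      x + y ≤ (B + 2) ^ (D + D' + 1) := by
    intro B D D' x y hx hy
    have h1 := base B D
    have h2 := base B D'
    have : (B + 2) ^ (D + D' + 1) = (B + 2) ^ D * (B + 2) ^ D' * (B + 2) := by ring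
    rw [this]
    nlinarith [Nat.mul_le_mul h1 h2, Nat.zero_le B,
      Nat.mul_le_mul_left ((B + 2) ^ D) h2, Nat.mul_le_mul_right ((B + 2) ^ D') h1]
  induction e with
  | lit z =>
    refine ⟨z.natAbs, fun σ B _ => ?_⟩
    exact (Nat.lt_two_pow_self).le.trans (Nat.pow_le_pow_left (by omega) _)
  | var x => exact ⟨1, fun σ B h => by have := h.1 x; simp [Expr.eval]; omega⟩
  | add a b iha ihb =>
    obtain ⟨D, hD⟩ := iha
    obtain ⟨D', hD'⟩ := ihb
    exact ⟨D + D' + 1, fun σ B h => (Int.natAbs_add_le _ _).trans (hadd _ _ _ _ _ (hD σ B h) (hD' σ B h))⟩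
  | sub a b iha ihb =>
    obtain ⟨D, hD⟩ := iha
    obtain ⟨D', hD'⟩ := ihb
    refine ⟨D + D' + 1, fun σ B h => ?_⟩
    refine le_trans ?_ (hadd _ _ _ _ _ (hD σ B h) (hD' σ B h))
    simp only [Expr.eval]
    omega
  | mul a b iha ihb =>
    obtain ⟨D, hD⟩ := iha
    obtain ⟨D', hD'⟩ := ihb
    refine ⟨D + D', fun σ B h => ?_⟩
    simp only [Expr.eval, Int.natAbs_mul, pow_add]
    exact Nat.mul_le_mul (hD σ B h) (hD' σ B h)
  | get a => exact ⟨1, fun σ B h => by have := h.2.1 (a.eval σ).natAbs; simp [Expr.eval]; omega⟩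

/-- The scale of the logarithmic cost for values up to `B`. -/
def scale (B : ℕ) : ℕ := Nat.log 2 (B + 2) + 1

theorem scale_mono {B B' : ℕ} (h : B ≤ B') : scale B ≤ scale B' :=
  Nat.add_le_add_right (Nat.log_mono_right (by omega)) 1

theorem one_le_scale (B : ℕ) : 1 ≤ scale B := Nat.le_add_left _ _

/-- Since B + 2 < 2 ^ `scale B`, a polynomial bound on a value becomes a linear bound on its length.
All logarithmic costs are estimated in this way. -/
theorem len_le {B D : ℕ} {z : ℤ} (h : z.natAbs ≤ (B + 2) ^ D) : RAM.len z ≤ (D + 1) * scale B := by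
  have h1 : B + 2 < 2 ^ scale B := Nat.lt_pow_succ_log_self (by norm_num) _
  have h2 : Nat.log 2 z.natAbs ≤ D * scale B := by
    refine (Nat.log_mono_right (h.trans (Nat.pow_le_pow_left h1.le D))).trans ?_
    rw [← pow_mul, mul_comm, Nat.log_pow (by norm_num)]
  have := one_le_scale B
  unfold RAM.len
  nlinarith

theorem Expr.len_bound (e : Expr) : ∃ C, ∀ σ B, Bdd B σ → RAM.len (e.eval σ) ≤ C * scale B := by
  obtain ⟨D, hD⟩ := e.eval_bound
  exact ⟨D + 1, fun σ B h => len_le (hD σ B h)⟩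

theorem len_const (z : ℤ) (B : ℕ) : RAM.len z ≤ RAM.len z * scale B :=
  Nat.le_mul_of_pos_right _ (one_le_scale B)

end While

/-! ### Reachability and placement of code for random access machines -/

namespace RAM

/-- `Reach P c s c'`: program `P` leads from `c` to `c'` at cost at most `s`. -/
inductive Reach (P : List Instr) : Cfg → ℕ → Cfg → Prop where
  | refl {c s} : Reach P c s c
  | step {c c' c'' s t} (hc : (c.current P).exec c = some c') (hs : (c.current P).cost c ≤ s)
      (h : Reach P c' t c'') : Reach P c (s + t) c''

theorem Reach.mono {P : List Instr} {c c' : Cfg} {s t : ℕ} (h : Reach P c s c') (hst : s ≤ t) :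
    Reach P c t c' := by
  induction h generalizing t with
  | refl => exact .refl
  | @step c c' c'' a b hc hs _ ih =>
    obtain ⟨r, rfl⟩ := Nat.exists_eq_add_of_le hst
    rw [add_assoc]
    exact .step hc hs (ih (by omega))

theorem Reach.trans {P : List Instr} {c c' c'' : Cfg} {s t : ℕ} (h : Reach P c s c')
    (h' : Reach P c' t c'') : Reach P c (s + t) c'' := by
  induction h with
  | refl => exact h'.mono (by omega)
  | step hc hs _ ih => rw [add_assoc]; exact .step hc hs (ih h')

theorem Reach.run {P : List Instr} {c c' : Cfg} {s : ℕ} (h : Reach P c s c')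
    (hh : (c'.current P).exec c' = none) : ∃ t ≤ s + (c'.current P).cost c', Run P c t c' := by
  induction h with
  | refl => exact ⟨_, by omega, .halt hh⟩
  | step hc hs _ ih =>
    obtain ⟨t, ht, hr⟩ := ih hh
    exact ⟨_, by omega, .step hc hr⟩

/-- The code `l` stands at position `b` of the program `P`. -/
def CodeAt (P : List Instr) (b : ℕ) (l : List Instr) : Prop :=
  ∀ i, i < l.length → P[b + i]? = l[i]?

theorem CodeAt.append {P : List Instr} {b : ℕ} {l l' : List Instr} :
    CodeAt P b (l ++ l') ↔ CodeAt P b l ∧ CodeAt P (b + l.length) l' := by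
  constructor
  · intro h
    refine ⟨fun i hi => ?_, fun i hi => ?_⟩
    · rw [h i (by simp; omega), List.getElem?_append_left hi]
    · rw [add_assoc, h _ (by simp; omega), List.getElem?_append_right (by omega)]
      simp
  · rintro ⟨h, h'⟩ i hi
    by_cases hl : i < l.length
    · rw [h i hl, List.getElem?_append_left hl]
    · rw [List.getElem?_append_right (by omega)]
      have := h' (i - l.length) (by simp at hi; omega)
      rw [← this]
      congr 1; omega

theorem CodeAt.cons {P : List Instr} {b : ℕ} {a : Instr} {l : List Instr} :
    CodeAt P b (a :: l) ↔ P[b]? = some a ∧ CodeAt P (b + 1) l := by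
  rw [show a :: l = [a] ++ l from rfl, CodeAt.append]
  refine and_congr ⟨fun h => by simpa using h 0 (by simp), fun h i hi => ?_⟩ Iff.rfl
  have : i = 0 := by simpa using hi
  simpa [this] using h

theorem Reach.one {P : List Instr} {b : ℕ} {r : ℕ → ℤ} {inp : List ℤ} {a : Instr} {c' : Cfg}
    {s : ℕ} (hP : P[b]? = some a) (hc : a.exec ⟨b, r, inp⟩ = some c') (hs : a.cost ⟨b, r, inp⟩ ≤ s) :
    Reach P ⟨b, r, inp⟩ s c' := by
  have e : Cfg.current P ⟨b, r, inp⟩ = a := by simp [Cfg.current, List.getD, hP]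
  have := Reach.step (P := P) (c := ⟨b, r, inp⟩) (c' := c') (c'' := c') (s := s) (t := 0)
    (by rw [e]; exact hc) (by rw [e]; exact hs) .refl
  simpa using this

end RAM

/-! ### Compilation of expressions -/

namespace While

open RAM

/-- The `d`-th scratch register. -/
def tmp (d : ℕ) : ℕ := 3 * d + 2

/-- Code that leaves the value of an expression in the accumulator, using only scratch registers
from the `d`-th on. -/
def Expr.comp : ℕ → Expr → List Instr
  | _, .lit z => [.load (.lit z)]
  | _, .var x => [.load (.mem (.dir (3 * x + 1)))]
  | d, .add a b => a.comp d ++ (.store (.dir (tmp d)) :: (b.comp (d + 1) ++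
      [.add (.mem (.dir (tmp d)))]))
  | d, .sub a b => b.comp d ++ (.store (.dir (tmp d)) :: (a.comp (d + 1) ++
      [.sub (.mem (.dir (tmp d)))]))
  | d, .mul a b => a.comp d ++ (.store (.dir (tmp d)) :: (b.comp (d + 1) ++
      [.mult (.mem (.dir (tmp d)))]))
  | d, .get a => a.comp d ++ [.store (.dir (tmp d)), .mult (.mem (.dir (tmp d))), .mult (.lit 3),
      .add (.lit 3), .store (.dir (tmp d)), .load (.mem (.ind (tmp d)))]

/-- The registers `r` hold the variables and memory of `σ`. -/
def Holds (σ : St) (r : ℕ → ℤ) : Prop :=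
  (∀ x, r (3 * x + 1) = σ.v x) ∧ ∀ n, r (3 * n ^ 2 + 3) = σ.m n

/-- Only the accumulator and scratch registers from the `d`-th on may differ. -/
def Keeps (d : ℕ) (r r' : ℕ → ℤ) : Prop :=
  ∀ i, i ≠ 0 → (∀ d', d ≤ d' → i ≠ tmp d') → r' i = r i

theorem Keeps.trans {d d' : ℕ} {r r' r'' : ℕ → ℤ} (h : Keeps d r r') (h' : Keeps d' r' r'')
    (hd : d ≤ d') : Keeps d r r'' := fun i hi ht =>
  (h' i hi fun e he => ht e (hd.trans he)).trans (h i hi ht)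

theorem Keeps.acc (d : ℕ) (r : ℕ → ℤ) (z : ℤ) : Keeps d r (Function.update r 0 z) := fun _ hi _ =>
  Function.update_of_ne hi _ _

theorem Keeps.scratch (d : ℕ) (r : ℕ → ℤ) (z : ℤ) :
    Keeps d r (Function.update r (tmp d) z) := fun _ _ ht =>
  Function.update_of_ne (ht d le_rfl) _ _

/-- Registers are separated by residues modulo 3: variables have residue 1, scratch registers
residue 2, memory cells residue 0 starting from 3, and register 0 is the accumulator. -/
theorem Keeps.holds {d : ℕ} {r r' : ℕ → ℤ} {σ : St} (h : Keeps d r r') (hr : Holds σ r) :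
    Holds σ r' :=
  ⟨fun x => (h _ (by omega) fun d' _ => by unfold tmp; omega).trans (hr.1 x),
   fun n => (h _ (by omega) fun d' _ => by unfold tmp; omega).trans (hr.2 n)⟩

/-- `code` leaves the value `val σ` in the accumulator at logarithmic cost. -/
def Evaluates (d : ℕ) (code : List Instr) (val : St → ℤ) : Prop :=
  ∃ C, ∀ P b r σ inp B, CodeAt P b code → Holds σ r → Bdd B σ →
    ∃ r', Reach P ⟨b, r, inp⟩ (C * scale B) ⟨b + code.length, r', inp⟩ ∧ r' 0 = val σ ∧
      Keeps d r r'

/-- The operand evaluated first waits in scratch register `tmp d` while the second one is computed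
with scratch registers from d + 1 on. It becomes the right argument of the operation, which is why a
subtraction is compiled with its subtrahend first. -/
theorem Evaluates.binary {d : ℕ} {ca cb : List Instr} {va vb : St → ℤ} (op : Operand → Instr)
    (f : ℤ → ℤ → ℤ)
    (hexec : ∀ (c : Cfg) i, (op (.mem (.dir i))).exec c = some (c.put 0 (f (c.reg 0) (c.reg i))))
    (hcost : ∀ (c : Cfg) i, (op (.mem (.dir i))).cost c =
      len (c.reg 0) + (len (i : ℤ) + len (c.reg i)))
    (ha : Evaluates d ca va) (hb : Evaluates (d + 1) cb vb)
    (hla : ∃ C, ∀ σ B, Bdd B σ → len (va σ) ≤ C * scale B)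
    (hlb : ∃ C, ∀ σ B, Bdd B σ → len (vb σ) ≤ C * scale B) :
    Evaluates d (ca ++ (.store (.dir (tmp d)) :: (cb ++ [op (.mem (.dir (tmp d)))])))
      fun σ => f (vb σ) (va σ) := by
  obtain ⟨Ca, ha⟩ := ha
  obtain ⟨Cb, hb⟩ := hb
  obtain ⟨Da, hla⟩ := hla
  obtain ⟨Db, hlb⟩ := hlb
  refine ⟨Ca + (Da + len (tmp d : ℕ)) + Cb + (Db + (len (tmp d : ℕ) + Da)), ?_⟩
  intro P b r σ inp B hP hr hB
  rw [CodeAt.append, CodeAt.cons, CodeAt.append, CodeAt.cons] at hP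
  obtain ⟨h1, h2, h3, h4, -⟩ := hP
  obtain ⟨r1, hr1, hv1, hk1⟩ := ha P b r σ inp B h1 hr hB
  have hr1' := hk1.holds hr
  have ct := len_const ((tmp d : ℕ) : ℤ) B
  have s1 : Reach P ⟨b + ca.length, r1, inp⟩ ((Da + len (tmp d : ℕ)) * scale B)
      ⟨b + ca.length + 1, Function.update r1 (tmp d) (va σ), inp⟩ := by
    refine Reach.one h2 (by simp [Instr.exec, Addr.loc, Cfg.put, hv1]) ?_
    simp only [Instr.cost, Addr.cost, hv1]
    have := hla σ B hB
    rw [add_mul]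
    omega
  have hk2 := Keeps.scratch d r1 (va σ)
  obtain ⟨r2, hr2, hv2, hk3⟩ := hb P _ _ σ inp B h3 (hk2.holds hr1') hB
  have e2 : r2 (tmp d) = va σ := by
    rw [hk3 _ (by unfold tmp; omega) (fun d' hd' => by unfold tmp; omega)]
    simp
  have s2 : Reach P ⟨b + ca.length + 1 + cb.length, r2, inp⟩
      ((Db + (len (tmp d : ℕ) + Da)) * scale B)
      ⟨b + ca.length + 1 + cb.length + 1, Function.update r2 0 (f (vb σ) (va σ)), inp⟩ := by
    refine Reach.one h4 (by simp [hexec, Cfg.put, hv2, e2]) ?_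
    simp only [hcost, hv2, e2]
    have := hla σ B hB
    have := hlb σ B hB
    rw [add_mul, add_mul]
    omega
  refine ⟨_, ?_, Function.update_self _ _ _, ((hk1.trans hk2 le_rfl).trans hk3 (by omega)).trans
    (Keeps.acc d r2 _) le_rfl⟩
  have := ((hr1.trans s1).trans hr2).trans s2
  refine cast ?_ (this.mono (t := (Ca + (Da + len (tmp d : ℕ)) + Cb +
    (Db + (len (tmp d : ℕ) + Da))) * scale B) (by simp only [add_mul]; omega))
  congr 2
  simp only [List.length_append, List.length_cons, List.length_nil]
  omega

/-- The address part of a memory access. -/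
theorem Evaluates.address {d : ℕ} {ca : List Instr} {va : St → ℤ} (ha : Evaluates d ca va)
    (hD : ∃ D, ∀ σ B, Bdd B σ → (va σ).natAbs ≤ (B + 2) ^ D) :
    (∃ C, ∀ P b r σ inp B, CodeAt P b (ca ++ [.store (.dir (tmp d)), .mult (.mem (.dir (tmp d))),
        .mult (.lit 3), .add (.lit 3), .store (.dir (tmp d))]) → Holds σ r → Bdd B σ →
      ∃ r', Reach P ⟨b, r, inp⟩ (C * scale B) ⟨b + (ca.length + 5), r', inp⟩ ∧
        r' (tmp d) = ((3 * (va σ).natAbs ^ 2 + 3 : ℕ) : ℤ) ∧ Keeps d r r') ∧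
    ∃ C, ∀ σ B, Bdd B σ → len ((3 * (va σ).natAbs ^ 2 + 3 : ℕ) : ℤ) ≤ C * scale B := by
  obtain ⟨Ca, ha⟩ := ha
  obtain ⟨D, hD⟩ := hD
  have big : ∀ σ B, Bdd B σ → 3 * (va σ).natAbs ^ 2 + 3 ≤ (B + 2) ^ (2 * D + 3) := by
    intro σ B hB
    have h1 := Nat.pow_le_pow_left (hD σ B hB) 2
    have h2 : 1 ≤ (B + 2) ^ (2 * D) := Nat.one_le_pow _ _ (by omega)
    have h3 : 2 ^ 3 ≤ (B + 2) ^ 3 := Nat.pow_le_pow_left (by omega) 3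
    have h4 := Nat.mul_le_mul_left ((B + 2) ^ (2 * D)) h3
    rw [pow_add]
    rw [← pow_mul, mul_comm D 2] at h1
    omega
  set K := 2 * D + 3 + 1 with hK
  have hlen : ∀ σ B (z : ℤ), Bdd B σ → z.natAbs ≤ 3 * (va σ).natAbs ^ 2 + 3 →
      len z ≤ K * scale B := fun σ B z hB hz => len_le (hz.trans (big σ B hB))
  refine ⟨⟨Ca + (K + len (tmp d : ℕ)) + (K + (len (tmp d : ℕ) + K)) + (K + len 3) + (K + len 3)
    + (K + len (tmp d : ℕ)), ?_⟩, K, fun σ B hB => hlen σ B _ hB (Int.natAbs_natCast _).le⟩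
  intro P b r σ inp B hP hr hB
  rw [CodeAt.append, CodeAt.cons, CodeAt.cons, CodeAt.cons, CodeAt.cons, CodeAt.cons] at hP
  obtain ⟨h1, h2, h3, h4, h5, h6, -⟩ := hP
  obtain ⟨r1, hr1, hv1, hk1⟩ := ha P b r σ inp B h1 hr hB
  set z := va σ with hz
  have sq : z.natAbs ≤ z.natAbs ^ 2 := Nat.le_self_pow (by norm_num) _
  have ct := len_const ((tmp d : ℕ) : ℤ) B
  have c3 := len_const 3 B
  have l1 : len z ≤ K * scale B := hlen σ B _ hB (by rw [← hz]; omega)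
  have l2 : len (z * z) ≤ K * scale B := hlen σ B _ hB (by
    rw [← hz, Int.natAbs_mul, ← pow_two]; omega)
  have l3 : len (z * z * 3) ≤ K * scale B := hlen σ B _ hB (by
    rw [← hz, Int.natAbs_mul, Int.natAbs_mul, ← pow_two]; simp; omega)
  -- Squaring makes the address depend on |z| only, so no branch is needed to form the absolute
  -- value. The register number stays polynomial in |z|, hence its length is of the same order.
  have e4 : z * z * 3 + 3 = ((3 * z.natAbs ^ 2 + 3 : ℕ) : ℤ) := by
    push_cast; rw [sq_abs]; ring
  have l4 : len (z * z * 3 + 3) ≤ K * scale B := hlen σ B _ hB (by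
    rw [e4, ← hz]; exact (Int.natAbs_natCast _).le)
  set t := tmp d with ht
  have t0 : t ≠ 0 := by rw [ht]; unfold tmp; omega
  have s1 : Reach P ⟨b + ca.length, r1, inp⟩ ((K + len (t : ℕ)) * scale B)
      ⟨b + ca.length + 1, Function.update r1 t z, inp⟩ := by
    refine Reach.one h2 (by simp [Instr.exec, Addr.loc, Cfg.put, hv1]) ?_
    simp only [Instr.cost, Addr.cost, hv1, add_mul]
    omega
  set r2 := Function.update r1 t z with hr2
  have a2 : r2 0 = z := by rw [hr2, Function.update_of_ne t0.symm, hv1]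
  have b2 : r2 t = z := by rw [hr2, Function.update_self]
  have s2 : Reach P ⟨b + ca.length + 1, r2, inp⟩ ((K + (len (t : ℕ) + K)) * scale B)
      ⟨b + ca.length + 1 + 1, Function.update r2 0 (z * z), inp⟩ := by
    refine Reach.one h3 (by simp [Instr.exec, Addr.loc, Cfg.put, Operand.val, a2, b2]) ?_
    simp only [Instr.cost, Operand.cost, Addr.cost, Addr.loc, a2, add_mul, Option.map_some,
      Option.getD_some, b2]
    omega
  set r3 := Function.update r2 0 (z * z) with hr3
  have a3 : r3 0 = z * z := by rw [hr3, Function.update_self]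
  have s3 : Reach P ⟨b + ca.length + 1 + 1, r3, inp⟩ ((K + len 3) * scale B)
      ⟨b + ca.length + 1 + 1 + 1, Function.update r3 0 (z * z * 3), inp⟩ := by
    refine Reach.one h4 (by simp [Instr.exec, Cfg.put, Operand.val, a3]) ?_
    simp only [Instr.cost, Operand.cost, a3, add_mul]
    omega
  set r4 := Function.update r3 0 (z * z * 3) with hr4
  have a4 : r4 0 = z * z * 3 := by rw [hr4, Function.update_self]
  have s4 : Reach P ⟨b + ca.length + 1 + 1 + 1, r4, inp⟩ ((K + len 3) * scale B)
      ⟨b + ca.length + 1 + 1 + 1 + 1, Function.update r4 0 (z * z * 3 + 3), inp⟩ := by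
    refine Reach.one h5 (by simp [Instr.exec, Cfg.put, Operand.val, a4]) ?_
    simp only [Instr.cost, Operand.cost, a4, add_mul]
    omega
  set r5 := Function.update r4 0 (z * z * 3 + 3) with hr5
  have a5 : r5 0 = z * z * 3 + 3 := by rw [hr5, Function.update_self]
  have s5 : Reach P ⟨b + ca.length + 1 + 1 + 1 + 1, r5, inp⟩ ((K + len (t : ℕ)) * scale B)
      ⟨b + ca.length + 1 + 1 + 1 + 1 + 1, Function.update r5 t (z * z * 3 + 3), inp⟩ := by
    refine Reach.one h6 (by simp [Instr.exec, Addr.loc, Cfg.put, a5]) ?_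
    simp only [Instr.cost, Addr.cost, a5, add_mul]
    omega
  refine ⟨Function.update r5 t (z * z * 3 + 3), ?_, by rw [Function.update_self, e4], ?_⟩
  · have := ((((hr1.trans s1).trans s2).trans s3).trans s4).trans s5
    refine cast ?_ (this.mono (t := (Ca + (K + len (t : ℕ)) + (K + (len (t : ℕ) + K)) + (K + len 3)
      + (K + len 3) + (K + len (t : ℕ))) * scale B) (by simp only [add_mul]; omega))
    congr 1
  · exact ((((hk1.trans (Keeps.scratch d r1 z) le_rfl).trans (Keeps.acc d r2 _) le_rfl).trans
      (Keeps.acc d r3 _) le_rfl).trans (Keeps.acc d r4 _) le_rfl).trans (Keeps.scratch d r5 _) le_rfl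

theorem Expr.evaluates (e : Expr) : ∀ d, Evaluates d (e.comp d) fun σ => e.eval σ := by
  induction e with
  | lit z =>
    intro d
    refine ⟨len z, fun P b r σ inp B hP hr hB => ⟨_, ?_, Function.update_self _ _ _, Keeps.acc d r z⟩⟩
    rw [Expr.comp, CodeAt.cons] at hP
    exact Reach.one hP.1 (by simp [Instr.exec, Operand.val, Cfg.put, Expr.comp, Expr.eval])
      (by simpa [Instr.cost, Operand.cost] using len_const z B)
  | var x =>
    intro d
    obtain ⟨C, hC⟩ := (Expr.var x).len_bound
    refine ⟨len ((3 * x + 1 : ℕ) : ℤ) + C, fun P b r σ inp B hP hr hB =>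
      ⟨_, ?_, Function.update_self _ _ _, Keeps.acc d r _⟩⟩
    rw [Expr.comp, CodeAt.cons] at hP
    refine Reach.one hP.1 (by simp [Instr.exec, Operand.val, Addr.loc, Cfg.put, Expr.comp,
      Expr.eval, hr.1]) ?_
    have h1 := len_const ((3 * x + 1 : ℕ) : ℤ) B
    have h2 := hC σ B hB
    simp only [Expr.eval] at h2
    simp only [Instr.cost, Operand.cost, Addr.cost, Addr.loc, Option.map_some, Option.getD_some,
      hr.1, add_mul]
    omega
  | add a b iha ihb =>
    intro d
    have := Evaluates.binary .add (fun x y => x + y) (fun _ _ => rfl) (fun _ _ => rfl) (iha d)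
      (ihb (d + 1)) a.len_bound b.len_bound
    simpa [Expr.comp, Expr.eval, add_comm] using this
  | sub a b iha ihb =>
    intro d
    exact Evaluates.binary .sub (fun x y => x - y) (fun _ _ => rfl) (fun _ _ => rfl) (ihb d)
      (iha (d + 1)) b.len_bound a.len_bound
  | mul a b iha ihb =>
    intro d
    have := Evaluates.binary .mult (fun x y => x * y) (fun _ _ => rfl) (fun _ _ => rfl) (iha d)
      (ihb (d + 1)) a.len_bound b.len_bound
    simpa [Expr.comp, Expr.eval, mul_comm] using this
  | get a iha =>
    intro d
    obtain ⟨⟨C, hC⟩, D, hD⟩ := (iha d).address a.eval_bound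
    obtain ⟨E, hE⟩ := (Expr.get a).len_bound
    refine ⟨C + (len (tmp d : ℕ) + D + E), fun P b r σ inp B hP hr hB => ?_⟩
    have hcode : (Expr.get a).comp d = (a.comp d ++ [.store (.dir (tmp d)),
        .mult (.mem (.dir (tmp d))), .mult (.lit 3), .add (.lit 3), .store (.dir (tmp d))]) ++
        [.load (.mem (.ind (tmp d)))] := by
      simp [Expr.comp]
    rw [hcode, CodeAt.append, CodeAt.cons] at hP
    obtain ⟨h1, h2, -⟩ := hP
    obtain ⟨r1, hr1, hv1, hk1⟩ := hC P b r σ inp B h1 hr hB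
    have hlen : (a.comp d ++ [Instr.store (.dir (tmp d)), .mult (.mem (.dir (tmp d))),
        .mult (.lit 3), .add (.lit 3), .store (.dir (tmp d))]).length = (a.comp d).length + 5 := by
      simp
    rw [hlen] at h2
    have hv : r1 (3 * (a.eval σ).natAbs ^ 2 + 3) = σ.m (a.eval σ).natAbs := (hk1.holds hr).2 _
    have hpos : (0 : ℤ) ≤ r1 (tmp d) := by rw [hv1]; positivity
    have htn : (r1 (tmp d)).toNat = 3 * (a.eval σ).natAbs ^ 2 + 3 := by rw [hv1]; rfl
    refine ⟨Function.update r1 0 (σ.m (a.eval σ).natAbs), ?_, Function.update_self _ _ _,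
      hk1.trans (Keeps.acc d r1 _) le_rfl⟩
    have s : Reach P ⟨b + ((a.comp d).length + 5), r1, inp⟩ ((len (tmp d : ℕ) + D + E) * scale B)
        ⟨b + ((a.comp d).length + 5) + 1, Function.update r1 0 (σ.m (a.eval σ).natAbs), inp⟩ := by
      refine Reach.one h2 (by simp [Instr.exec, Operand.val, Addr.loc, Cfg.put, hpos, htn, hv]) ?_
      have g1 := len_const ((tmp d : ℕ) : ℤ) B
      have g2 := hD σ B hB
      have g3 := hE σ B hB
      simp only [Expr.eval] at g3
      rw [← hv1] at g2
      simp only [Instr.cost, Operand.cost, Addr.cost, Addr.loc, hpos, if_true, htn,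
        Option.map_some, Option.getD_some, hv, add_mul]
      omega
    have := hr1.trans s
    refine cast ?_ (this.mono (t := (C + (len (tmp d : ℕ) + D + E)) * scale B)
      (by simp only [add_mul]; omega))
    congr 2
    simp [hcode]; omega

end While

/-! ### Compilation of statements -/

namespace While

open RAM

def Stmt.size : Stmt → ℕ
  | .skip => 0
  | .set _ e => (e.comp 0).length + 1
  | .inc _ _ => 3
  | .put a e => (a.comp 0).length + 5 + (e.comp 1).length + 1
  | .read _ => 1
  | .seq p q => p.size + q.size
  | .ite e p q => (e.comp 0).length + 1 + q.size + 1 + p.size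
  | .loop e p => (e.comp 0).length + 2 + p.size + 1

/-- The code of a statement, to be placed at position `b`. -/
def Stmt.comp : ℕ → Stmt → List Instr
  | _, .skip => []
  | _, .set x e => e.comp 0 ++ [.store (.dir (3 * x + 1))]
  | _, .inc x z => [.load (.mem (.dir (3 * x + 1))), .add (.lit z), .store (.dir (3 * x + 1))]
  | _, .put a e => (a.comp 0 ++ [.store (.dir (tmp 0)), .mult (.mem (.dir (tmp 0))),
      .mult (.lit 3), .add (.lit 3), .store (.dir (tmp 0))]) ++ (e.comp 1 ++
      [.store (.ind (tmp 0))])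
  | _, .read x => [.read (.dir (3 * x + 1))]
  | b, .seq p q => p.comp b ++ q.comp (b + p.size)
  | b, .ite e p q => e.comp 0 ++ (.jgtz (b + (e.comp 0).length + 1 + q.size + 1) ::
      (q.comp (b + (e.comp 0).length + 1) ++
        (.jump (b + (e.comp 0).length + 1 + q.size + 1 + p.size) ::
          p.comp (b + (e.comp 0).length + 1 + q.size + 1))))
  | b, .loop e p => e.comp 0 ++ (.jgtz (b + (e.comp 0).length + 2) ::
      .jump (b + (e.comp 0).length + 2 + p.size + 1) ::
        (p.comp (b + (e.comp 0).length + 2) ++ [.jump b]))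

/-- Jump targets depend on the position of the code, but its length does not; this allows forward
targets to be computed before the code is placed. -/
theorem Stmt.length_comp (p : Stmt) : ∀ b, (p.comp b).length = p.size := by
  induction p with
  | skip => intro b; rfl
  | set => intro b; simp [Stmt.comp, Stmt.size]
  | inc => intro b; rfl
  | put => intro b; simp [Stmt.comp, Stmt.size]; omega
  | read => intro b; rfl
  | seq p q ihp ihq => intro b; simp [Stmt.comp, Stmt.size, ihp, ihq]
  | ite e p q ihp ihq => intro b; simp [Stmt.comp, Stmt.size, ihp, ihq]; omega
  | loop e p ih => intro b; simp [Stmt.comp, Stmt.size, ih]; omega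

theorem Holds.setv {σ : St} {r : ℕ → ℤ} (h : Holds σ r) (x : ℕ) (z : ℤ) :
    Holds (σ.setv x z) (Function.update r (3 * x + 1) z) := by
  refine ⟨fun y => ?_, fun n => ?_⟩
  · by_cases hy : y = x
    · subst hy; simp [St.setv]
    · rw [Function.update_of_ne (by omega), h.1]
      simp [St.setv, hy]
  · rw [Function.update_of_ne (by omega), h.2]
    rfl

theorem Holds.setm {σ : St} {r : ℕ → ℤ} (h : Holds σ r) (n : ℕ) (z : ℤ) :
    Holds (σ.setm n z) (Function.update r (3 * n ^ 2 + 3) z) := by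
  refine ⟨fun y => ?_, fun k => ?_⟩
  · rw [Function.update_of_ne (by omega), h.1]
    rfl
  · by_cases hk : k = n
    · subst hk; simp [St.setm]
    · have : 3 * k ^ 2 + 3 ≠ 3 * n ^ 2 + 3 := by
        intro e
        exact hk (Nat.pow_left_injective (n := 2) (by norm_num) (by simpa using e))
      rw [Function.update_of_ne this, h.2]
      simp [St.setm, hk]

theorem Holds.inp {σ : St} {r : ℕ → ℤ} (h : Holds σ r) (l : List ℤ) :
    Holds { σ with inp := l } r := h

/-- `C` bounds the cost of the compiled statement relative to its charge. -/
def Stmt.CompiledWithin (p : Stmt) (C : ℕ) : Prop :=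
  ∀ {σ τ : St} {t : ℕ}, Ev p σ t τ → ∀ (P : List Instr) (b : ℕ) (r : ℕ → ℤ) (M B : ℕ),
    CodeAt P b (p.comp b) → Holds σ r → Bdd M σ → M + t ≤ B →
      ∃ r', Reach P ⟨b, r, σ.inp⟩ (C * t * scale B) ⟨b + p.size, r', τ.inp⟩ ∧ Holds τ r'

/-- Each unit of charge corresponds to boundedly many instructions, whose operands all have length
O(`scale B`). The bound B is fixed for the whole run and only has to dominate the initial values
plus the total charge, so the costs of consecutive parts can be added with the same factor. -/
theorem Stmt.compiled (p : Stmt) : ∃ C, p.CompiledWithin C := by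
  induction p with
  | skip =>
    refine ⟨0, fun h P b r M B hP hr hM hB => ?_⟩
    cases h
    exact ⟨r, .refl, hr⟩
  | set x e =>
    obtain ⟨C, hC⟩ := e.evaluates 0
    obtain ⟨D, hD⟩ := e.len_bound
    refine ⟨C + (D + len ((3 * x + 1 : ℕ) : ℤ)), fun {σ τ t} h P b r M B hP hr hM hB => ?_⟩
    cases h
    rw [Stmt.comp, CodeAt.append, CodeAt.cons] at hP
    have hMB : Bdd B σ := hM.mono (by omega)
    obtain ⟨r1, h1, hv, hk⟩ := hC P b r σ σ.inp B hP.1 hr hMB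
    refine ⟨_, ?_, (hk.holds hr).setv x (e.eval σ)⟩
    have s : Reach P ⟨b + (e.comp 0).length, r1, σ.inp⟩ ((D + len ((3 * x + 1 : ℕ) : ℤ)) * scale B)
        ⟨b + (e.comp 0).length + 1, Function.update r1 (3 * x + 1) (e.eval σ), σ.inp⟩ := by
      refine Reach.one hP.2.1 (by simp [Instr.exec, Addr.loc, Cfg.put, hv]) ?_
      have := hD σ B hMB
      have := len_const ((3 * x + 1 : ℕ) : ℤ) B
      simp only [Instr.cost, Addr.cost, hv, add_mul]
      omega
    refine (h1.trans s).mono ?_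
    rw [← add_mul]
    exact Nat.mul_le_mul_right _ (Nat.le_mul_of_pos_right _ (by omega))
  | inc x z =>
    obtain ⟨D, hD⟩ := (Expr.var x).len_bound
    obtain ⟨E, hE⟩ := (Expr.add (.var x) (.lit z)).len_bound
    have eE : ∀ σ B, Bdd B σ → len (σ.v x + z) ≤ E * scale B := hE
    have eD : ∀ σ B, Bdd B σ → len (σ.v x) ≤ D * scale B := hD
    set K := len ((3 * x + 1 : ℕ) : ℤ) with hK
    refine ⟨(K + D) + (D + len z) + (E + K), fun {σ τ t} h P b r M B hP hr hM hB => ?_⟩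
    cases h
    rw [Stmt.comp, CodeAt.cons, CodeAt.cons, CodeAt.cons] at hP
    obtain ⟨p1, p2, p3, -⟩ := hP
    have hMB : Bdd B σ := hM.mono (by omega)
    have b1 := eE σ B hMB
    have b2 := eD σ B hMB
    have b3 : K ≤ K * scale B := len_const ((3 * x + 1 : ℕ) : ℤ) B
    have b4 := len_const z B
    have s1 : Reach P ⟨b, r, σ.inp⟩ ((K + D) * scale B)
        ⟨b + 1, Function.update r 0 (σ.v x), σ.inp⟩ := by
      refine Reach.one p1 (by simp [Instr.exec, Operand.val, Addr.loc, Cfg.put, hr.1]) ?_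
      simp only [Instr.cost, Operand.cost, Addr.cost, Addr.loc, Option.map_some,
        Option.getD_some, hr.1, add_mul]
      omega
    set r1 := Function.update r 0 (σ.v x) with hr1
    have a1 : r1 0 = σ.v x := Function.update_self _ _ _
    have s2 : Reach P ⟨b + 1, r1, σ.inp⟩ ((D + len z) * scale B)
        ⟨b + 1 + 1, Function.update r1 0 (σ.v x + z), σ.inp⟩ := by
      refine Reach.one p2 (by simp [Instr.exec, Operand.val, Cfg.put, a1]) ?_
      simp only [Instr.cost, Operand.cost, a1, add_mul]
      omega
    set r2 := Function.update r1 0 (σ.v x + z) with hr2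
    have a2 : r2 0 = σ.v x + z := Function.update_self _ _ _
    have s3 : Reach P ⟨b + 1 + 1, r2, σ.inp⟩ ((E + K) * scale B)
        ⟨b + 1 + 1 + 1, Function.update r2 (3 * x + 1) (σ.v x + z), σ.inp⟩ := by
      refine Reach.one p3 (by simp [Instr.exec, Addr.loc, Cfg.put, a2]) ?_
      simp only [Instr.cost, Addr.cost, a2, add_mul]
      omega
    refine ⟨_, ?_, Holds.setv (((Keeps.acc 0 r (σ.v x)).trans
      (Keeps.acc 0 r1 (σ.v x + z)) le_rfl).holds hr) x (σ.v x + z)⟩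
    refine (((s1.trans s2).trans s3)).mono ?_
    rw [← add_mul, ← add_mul]
    exact Nat.mul_le_mul_right _ (Nat.le_mul_of_pos_right _ (by omega))
  | put a e =>
    obtain ⟨⟨C, hC⟩, D, hD⟩ := (a.evaluates 0).address a.eval_bound
    obtain ⟨C', hC'⟩ := e.evaluates 1
    obtain ⟨E, hE⟩ := e.len_bound
    refine ⟨C + C' + (E + (len (tmp 0 : ℕ) + D)), fun {σ τ t} h P b r M B hP hr hM hB => ?_⟩
    cases h
    rw [Stmt.comp, CodeAt.append] at hP
    obtain ⟨p1, p2⟩ := hP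
    rw [CodeAt.append, CodeAt.cons] at p2
    obtain ⟨p2, p3, -⟩ := p2
    have hMB : Bdd B σ := hM.mono (by omega)
    obtain ⟨r1, h1, hv1, hk1⟩ := hC P b r σ σ.inp B p1 hr hMB
    have hlen : (a.comp 0 ++ [Instr.store (.dir (tmp 0)), .mult (.mem (.dir (tmp 0))),
        .mult (.lit 3), .add (.lit 3), .store (.dir (tmp 0))]).length = (a.comp 0).length + 5 := by
      simp
    rw [hlen] at p2 p3
    obtain ⟨r2, h2, hv2, hk2⟩ := hC' P _ r1 σ σ.inp B p2 (hk1.holds hr) hMB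
    have hv1' : r2 (tmp 0) = ((3 * (a.eval σ).natAbs ^ 2 + 3 : ℕ) : ℤ) := by
      rw [hk2 _ (by unfold tmp; omega) (fun d' hd' => by unfold tmp; omega), hv1]
    have hpos : (0 : ℤ) ≤ r2 (tmp 0) := by rw [hv1']; positivity
    have htn : (r2 (tmp 0)).toNat = 3 * (a.eval σ).natAbs ^ 2 + 3 := by rw [hv1']; rfl
    have s : Reach P ⟨b + ((a.comp 0).length + 5) + (e.comp 1).length, r2, σ.inp⟩
        ((E + (len (tmp 0 : ℕ) + D)) * scale B)
        ⟨b + ((a.comp 0).length + 5) + (e.comp 1).length + 1,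
          Function.update r2 (3 * (a.eval σ).natAbs ^ 2 + 3) (e.eval σ), σ.inp⟩ := by
      refine Reach.one p3 (by simp [Instr.exec, Addr.loc, Cfg.put, hpos, htn, hv2]) ?_
      have g1 := len_const ((tmp 0 : ℕ) : ℤ) B
      have g2 := hD σ B hMB
      have g3 := hE σ B hMB
      rw [← hv1'] at g2
      simp only [Instr.cost, Addr.cost, hv2, add_mul]
      omega
    refine ⟨_, ?_, (hk2.holds (hk1.holds hr)).setm _ _⟩
    refine cast ?_ (((h1.trans h2).trans s).mono (t := (C + C' + (E + (len (tmp 0 : ℕ) + D))) *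
      ((e.eval σ).natAbs + 1) * scale B) ?_)
    · congr 2
      simp only [Stmt.size]; omega
    · rw [← add_mul, ← add_mul]
      exact Nat.mul_le_mul_right _ (Nat.le_mul_of_pos_right _ (by omega))
  | read x =>
    refine ⟨1 + 1 + len ((3 * x + 1 : ℕ) : ℤ), fun {σ τ t} h P b r M B hP hr hM hB => ?_⟩
    cases h
    rw [Stmt.comp, CodeAt.cons] at hP
    refine ⟨Function.update r (3 * x + 1) (σ.inp.headD 0), ?_, (hr.setv x _).inp _⟩
    refine Reach.one hP.1 (by simp [Instr.exec, Addr.loc, Cfg.put, Cfg.scanned, Stmt.size]) ?_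
    have h0 : (σ.inp.headD 0).natAbs ≤ (B + 2) ^ 1 := by
      cases hi : σ.inp with
      | nil => simp
      | cons a l =>
        have := hM.2.2 a (by simp [hi])
        simp only [List.headD_cons, pow_one]
        omega
    have h1 := len_le h0
    have := len_const ((3 * x + 1 : ℕ) : ℤ) B
    simp only [Instr.cost, Addr.cost, Cfg.scanned, add_mul, mul_one] at h1 ⊢
    omega
  | seq p q ihp ihq =>
    obtain ⟨C, hC⟩ := ihp
    obtain ⟨D, hD⟩ := ihq
    refine ⟨C + D, fun {σ τ t} h P b r M B hP hr hM hB => ?_⟩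
    cases h with
    | @seq _ _ _ σ' _ t t' h1 h2 =>
      rw [Stmt.comp, CodeAt.append, Stmt.length_comp] at hP
      obtain ⟨r1, g1, hr1⟩ := hC h1 P b r M B hP.1 hr hM (by omega)
      obtain ⟨r2, g2, hr2⟩ := hD h2 P _ r1 (M + t) B hP.2 hr1 (Bdd.ev h1 hM) (by omega)
      refine ⟨r2, ?_, hr2⟩
      refine cast ?_ ((g1.trans g2).mono (t := (C + D) * (t + t') * scale B) ?_)
      · simp [Stmt.size, add_assoc]
      · rw [← add_mul]
        exact Nat.mul_le_mul_right _ (by nlinarith)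
  | ite e p q ihp ihq =>
    obtain ⟨C, hC⟩ := ihp
    obtain ⟨D, hD⟩ := ihq
    obtain ⟨E, hE⟩ := e.evaluates 0
    obtain ⟨F, hF⟩ := e.len_bound
    refine ⟨C + D + (E + F + 1), fun {σ τ t} h P b r M B hP hr hM hB => ?_⟩
    rw [Stmt.comp, CodeAt.append, CodeAt.cons, CodeAt.append, CodeAt.cons, Stmt.length_comp] at hP
    obtain ⟨p1, p2, p3, p4, p5⟩ := hP
    have hMB : Bdd B σ := hM.mono (by omega)
    obtain ⟨r1, h1, hv1, hk1⟩ := hE P b r σ σ.inp B p1 hr hMB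
    have hl := hF σ B hMB
    rw [show e.eval σ = r1 0 from hv1.symm] at hl
    cases h with
    | @iteT _ _ _ _ _ t he hp =>
      have s : Reach P ⟨b + (e.comp 0).length, r1, σ.inp⟩ (F * scale B)
          ⟨b + (e.comp 0).length + 1 + q.size + 1, r1, σ.inp⟩ := by
        refine Reach.one p2 ?_ (by simpa [Instr.cost] using hl)
        simp only [Instr.exec, hv1, if_pos he]
      obtain ⟨r2, g2, hr2⟩ := hC hp P _ r1 M B p5 (hk1.holds hr) hM (by omega)
      refine ⟨r2, ?_, hr2⟩
      refine cast ?_ (((h1.trans s).trans g2).mono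
        (t := (C + D + (E + F + 1)) * (t + 1) * scale B) ?_)
      · simp [Stmt.size, add_assoc]
      · rw [← add_mul, ← add_mul]
        exact Nat.mul_le_mul_right _ (by nlinarith)
    | @iteF _ _ _ _ _ t he hq =>
      have s : Reach P ⟨b + (e.comp 0).length, r1, σ.inp⟩ (F * scale B)
          ⟨b + (e.comp 0).length + 1, r1, σ.inp⟩ := by
        refine Reach.one p2 ?_ (by simpa [Instr.cost] using hl)
        simp only [Instr.exec, hv1, if_neg he]
      obtain ⟨r2, g2, hr2⟩ := hD hq P _ r1 M B p3 (hk1.holds hr) hM (by omega)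
      have s' : Reach P ⟨b + (e.comp 0).length + 1 + q.size, r2, τ.inp⟩ (1 * scale B)
          ⟨b + (e.comp 0).length + 1 + q.size + 1 + p.size, r2, τ.inp⟩ := by
        refine Reach.one p4 rfl ?_
        simpa [Instr.cost] using one_le_scale B
      refine ⟨r2, ?_, hr2⟩
      refine cast ?_ ((((h1.trans s).trans g2).trans s').mono
        (t := (C + D + (E + F + 1)) * (t + 1) * scale B) ?_)
      · simp [Stmt.size, add_assoc]
      · rw [← add_mul, ← add_mul, ← add_mul]
        exact Nat.mul_le_mul_right _ (by nlinarith)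
  | loop e p ih =>
    obtain ⟨C, hC⟩ := ih
    obtain ⟨E, hE⟩ := e.evaluates 0
    obtain ⟨F, hF⟩ := e.len_bound
    refine ⟨C + (E + F + 1), fun {σ τ t} h => ?_⟩
    -- The number of iterations is not visible in the statement, so a second induction, on the
    -- derivation of the run, is needed.
    generalize hs : Stmt.loop e p = s at h
    induction h with
    | skip | set | inc | put | read | seq | iteT | iteF => cases hs
    | @loopT e' p' σ σ' τ t t' he hp hq _ ih =>
      injection hs with h1 h2
      subst h1 h2
      intro P b r M B hP hr hM hB
      have hP0 := hP
      rw [Stmt.comp, CodeAt.append, CodeAt.cons, CodeAt.cons, CodeAt.append, CodeAt.cons,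
        Stmt.length_comp] at hP
      obtain ⟨p1, p2, p3, p4, p5, -⟩ := hP
      have hMB : Bdd B σ := hM.mono (by omega)
      obtain ⟨r1, h1, hv1, hk1⟩ := hE P b r σ σ.inp B p1 hr hMB
      have hl := hF σ B hMB
      rw [show e.eval σ = r1 0 from hv1.symm] at hl
      have s : Reach P ⟨b + (e.comp 0).length, r1, σ.inp⟩ (F * scale B)
          ⟨b + (e.comp 0).length + 2, r1, σ.inp⟩ := by
        refine Reach.one p2 ?_ (by simpa [Instr.cost] using hl)
        simp only [Instr.exec, hv1, if_pos he]
      obtain ⟨r2, g2, hr2⟩ := hC hp P _ r1 M B p4 (hk1.holds hr) hM (by omega)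
      have s' : Reach P ⟨b + (e.comp 0).length + 2 + p.size, r2, σ'.inp⟩ (1 * scale B)
          ⟨b, r2, σ'.inp⟩ := by
        refine Reach.one p5 rfl ?_
        simpa [Instr.cost] using one_le_scale B
      obtain ⟨r3, g3, hr3⟩ := ih rfl P b r2 (M + t) B hP0 hr2 (Bdd.ev hp hM) (by omega)
      refine ⟨r3, ?_, hr3⟩
      refine ((((h1.trans s).trans g2).trans s').trans g3).mono ?_
      rw [← add_mul, ← add_mul, ← add_mul, ← add_mul]
      exact Nat.mul_le_mul_right _ (by nlinarith)
    | @loopF e' p' σ he =>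
      injection hs with h1 h2
      subst h1 h2
      intro P b r M B hP hr hM hB
      rw [Stmt.comp, CodeAt.append, CodeAt.cons, CodeAt.cons] at hP
      obtain ⟨p1, p2, p3, -⟩ := hP
      have hMB : Bdd B σ := hM.mono (by omega)
      obtain ⟨r1, h1, hv1, hk1⟩ := hE P b r σ σ.inp B p1 hr hMB
      have hl := hF σ B hMB
      rw [show e.eval σ = r1 0 from hv1.symm] at hl
      have s : Reach P ⟨b + (e.comp 0).length, r1, σ.inp⟩ (F * scale B)
          ⟨b + (e.comp 0).length + 1, r1, σ.inp⟩ := by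
        refine Reach.one p2 ?_ (by simpa [Instr.cost] using hl)
        simp only [Instr.exec, hv1, if_neg he]
      have s' : Reach P ⟨b + (e.comp 0).length + 1, r1, σ.inp⟩ (1 * scale B)
          ⟨b + (e.comp 0).length + 2 + p.size + 1, r1, σ.inp⟩ := by
        refine Reach.one p3 rfl ?_
        simpa [Instr.cost] using one_le_scale B
      refine ⟨r1, ?_, hk1.holds hr⟩
      refine cast ?_ (((h1.trans s).trans s').mono
        (t := (C + (E + F + 1)) * 1 * scale B) ?_)
      · simp [Stmt.size, add_assoc]
      · rw [← add_mul, ← add_mul]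
        exact Nat.mul_le_mul_right _ (by nlinarith)

/-- The state in which all variables and cells are zero. -/
def St.zero (inp : List ℤ) : St := ⟨fun _ => 0, fun _ => 0, inp⟩

/-- A statement whose runs decide a property within some charge yields a program for the random
access machine; the answer is in variable `a`. -/
theorem Stmt.decides (p : Stmt) (a : ℕ) : ∃ (P : List Instr) (C : ℕ), ∀ (x : List Bool) (t : ℕ)
    (τ : St) (q : Prop), Ev p (St.zero (x.map fun b => if b then 2 else 1)) t τ →
      (τ.v a ≠ 0 ↔ q) → DecidesWithin P x (C * (t + 1) * scale (t + 2)) q := by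
  obtain ⟨C, hC⟩ := p.compiled
  obtain ⟨D, hD⟩ := (Expr.var a).evaluates 0
  refine ⟨p.comp 0 ++ ((Expr.var a).comp 0 ++ [.halt]), C + D + 1, fun x t τ q h hq => ?_⟩
  have hcode : CodeAt (p.comp 0 ++ ((Expr.var a).comp 0 ++ [.halt])) 0
      (p.comp 0 ++ ((Expr.var a).comp 0 ++ [.halt])) := fun i _ => by simp
  have hcode' := hcode
  rw [CodeAt.append, CodeAt.append, CodeAt.cons, Stmt.length_comp] at hcode'
  obtain ⟨h1, h2, h3, -⟩ := hcode'
  -- The only non-zero values at the start are the input symbols 1 and 2; this is the origin of t +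
  -- 2 in the bound.
  have hz : Bdd 2 (St.zero (x.map fun b => if b then (2 : ℤ) else 1)) := by
    refine ⟨fun _ => by simp [St.zero], fun _ => by simp [St.zero], fun z hz => ?_⟩
    simp only [St.zero, List.mem_map] at hz
    obtain ⟨b, -, rfl⟩ := hz
    cases b <;> simp
  obtain ⟨r1, g1, hr1⟩ := hC h _ 0 (fun _ => 0) 2 (t + 2) h1 ⟨fun _ => rfl, fun _ => rfl⟩ hz
    (by omega)
  obtain ⟨r2, g2, hv2, -⟩ := hD _ _ r1 τ τ.inp (t + 2) h2 hr1 ((Bdd.ev h hz).mono (by omega))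
  have hh := (g1.trans g2)
  have hcur : Cfg.current (p.comp 0 ++ ((Expr.var a).comp 0 ++ [.halt]))
      ⟨0 + p.size + ((Expr.var a).comp 0).length, r2, τ.inp⟩ = .halt := by
    simp only [Cfg.current, List.getD, h3, Option.getD_some]
  obtain ⟨s, hs, hrun⟩ := hh.run (by rw [hcur]; rfl)
  refine ⟨s, hs.trans ?_, _, hrun, ?_⟩
  · rw [hcur]
    have := one_le_scale (t + 2)
    simp only [Instr.cost]
    nlinarith [Nat.zero_le (C * scale (t + 2)), Nat.zero_le (D * t * scale (t + 2)),
      Nat.zero_le (t * scale (t + 2))]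
  · change r2 0 ≠ 0 ↔ q
    rw [hv2]
    exact hq

end While

/-! ## Memory banks -/

namespace While

/-- An injective pairing of integers, with non-negative values. -/
def pairing (a b : ℤ) : ℤ := (a * (2 * a + 1) + b * (2 * b + 1)) ^ 2 + a * (2 * a + 1)

theorem fold_nonneg (a : ℤ) : 0 ≤ a * (2 * a + 1) := by
  rcases le_or_gt 0 a with h | h
  · positivity
  · nlinarith

/-- The difference of the two sides is (a - b)(2(a + b) + 1), and the second factor is odd. -/
theorem fold_injective {a b : ℤ} (h : a * (2 * a + 1) = b * (2 * b + 1)) : a = b := by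
  have : (a - b) * (2 * (a + b) + 1) = 0 := by linarith
  rcases mul_eq_zero.1 this with h | h <;> omega

theorem pairing_nonneg (a b : ℤ) : 0 ≤ pairing a b := by
  have := fold_nonneg a
  unfold pairing
  positivity

/-- With A, B ≥ 0 the folded arguments, (A + B)² + A lies strictly below (A + B + 1)². So A + B is
determined, then A, then B. -/
theorem pairing_inj {a b a' b' : ℤ} : pairing a b = pairing a' b' ↔ a = a' ∧ b = b' := by
  refine ⟨fun h => ?_, by rintro ⟨rfl, rfl⟩; rfl⟩
  unfold pairing at h
  have ha := fold_nonneg a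
  have hb := fold_nonneg b
  have ha' := fold_nonneg a'
  have hb' := fold_nonneg b'
  generalize hA : a * (2 * a + 1) = A at *
  generalize hB : b * (2 * b + 1) = B at *
  generalize hA' : a' * (2 * a' + 1) = A' at *
  generalize hB' : b' * (2 * b' + 1) = B' at *
  have hs : A + B = A' + B' := by
    rcases lt_trichotomy (A + B) (A' + B') with hlt | heq | hlt
    · nlinarith
    · exact heq
    · nlinarith
  have hAA : A = A' := by rw [hs] at h; linarith
  have hBB : B = B' := by linarith
  exact ⟨fold_injective (hA.trans (hAA.trans hA'.symm)), fold_injective (hB.trans (hBB.trans hB'.symm))⟩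

/-- The expression for `pairing`. -/
def Expr.pair (a b : Expr) : Expr :=
  let f (e : Expr) : Expr := .mul e (.add (.mul (.lit 2) e) (.lit 1))
  .add (.mul (.add (f a) (f b)) (.add (f a) (f b))) (f a)

@[simp] theorem Expr.eval_pair (σ : St) (a b : Expr) :
    (Expr.pair a b).eval σ = pairing (a.eval σ) (b.eval σ) := by
  simp only [Expr.pair, Expr.eval, pairing]; ring

@[simp] theorem Expr.eval_lit (σ : St) (z : ℤ) : (Expr.lit z).eval σ = z := rfl
@[simp] theorem Expr.eval_var (σ : St) (x : ℕ) : (Expr.var x).eval σ = σ.v x := rfl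
@[simp] theorem Expr.eval_add (σ : St) (a b : Expr) :
    (Expr.add a b).eval σ = a.eval σ + b.eval σ := rfl
@[simp] theorem Expr.eval_sub (σ : St) (a b : Expr) :
    (Expr.sub a b).eval σ = a.eval σ - b.eval σ := rfl
@[simp] theorem Expr.eval_mul (σ : St) (a b : Expr) :
    (Expr.mul a b).eval σ = a.eval σ * b.eval σ := rfl

/-- The `z`-th cell of bank `k`. -/
def St.bank (σ : St) (k : ℕ) (z : ℤ) : ℤ := σ.m (pairing k z).natAbs

/-- Change the `z`-th cell of bank `k`. -/
def St.setBank (σ : St) (k : ℕ) (z w : ℤ) : St := σ.setm (pairing k z).natAbs w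

/-- Expression for a cell of a bank. -/
def Expr.bank (k : ℕ) (e : Expr) : Expr := .get (.pair (.lit k) e)

/-- Assignment to a cell of a bank. -/
def Stmt.putBank (k : ℕ) (a e : Expr) : Stmt := .put (.pair (.lit k) a) e

@[simp] theorem Expr.eval_bank (σ : St) (k : ℕ) (e : Expr) :
    (Expr.bank k e).eval σ = σ.bank k (e.eval σ) := by
  simp [Expr.bank, Expr.eval, St.bank]

theorem Ev.putBank {k : ℕ} {a e : Expr} {σ : St} :
    Ev (.putBank k a e) σ ((e.eval σ).natAbs + 1) (σ.setBank k (a.eval σ) (e.eval σ)) := by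
  have := Ev.put (a := .pair (.lit k) a) (e := e) (σ := σ)
  simpa [Stmt.putBank, St.setBank] using this

theorem St.bank_setBank (σ : St) (k k' : ℕ) (z z' w : ℤ) :
    (σ.setBank k z w).bank k' z' = if k' = k ∧ z' = z then w else σ.bank k' z' := by
  unfold St.bank St.setBank St.setm
  simp only [Function.update_apply]
  have : (pairing k' z').natAbs = (pairing k z).natAbs ↔ k' = k ∧ z' = z := by
    rw [Int.natAbs_inj_of_nonneg_of_nonneg (pairing_nonneg _ _) (pairing_nonneg _ _), pairing_inj]
    simp
  simp only [this]

@[simp] theorem St.v_setBank (σ : St) (k : ℕ) (z w : ℤ) : (σ.setBank k z w).v = σ.v := rfl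
@[simp] theorem St.inp_setBank (σ : St) (k : ℕ) (z w : ℤ) : (σ.setBank k z w).inp = σ.inp := rfl
@[simp] theorem St.bank_setv (σ : St) (x : ℕ) (z : ℤ) : (σ.setv x z).bank = σ.bank := rfl
@[simp] theorem St.inp_setv (σ : St) (x : ℕ) (z : ℤ) : (σ.setv x z).inp = σ.inp := rfl
@[simp] theorem St.bank_withInp (σ : St) (l : List ℤ) :
    ({ σ with inp := l } : St).bank = σ.bank := rfl

theorem St.v_setv (σ : St) (x y : ℕ) (z : ℤ) :
    (σ.setv x z).v y = if y = x then z else σ.v y := by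
  simp [St.setv, Function.update_apply]

/-! ## Simulation of deterministic Turing machines -/

section Simulation

variable (M : OracleTM) (cΓ : M.Γ → ℤ) (cΛ : M.Λ → ℤ)

/-- Variable that holds the position of head `i`. -/
def headVar (i : ℕ) : ℕ := 4 + i

/-- Variable `3` holds the state, bank `i` holds tape `i`. -/
def Simulates (σ : St) (c : OracleTM.FCfg M) : Prop :=
  σ.v 3 = cΛ c.state ∧ (∀ i : Fin (M.workTapes + 1), σ.v (headVar i) = c.pos i) ∧
    ∀ (i : Fin (M.workTapes + 1)) z, σ.bank i z = cΓ (c.cont i z)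

/-- Squared distance between the scanned symbols and `s`, over the tapes in a list. -/
def scanDist (s : Fin (M.workTapes + 1) → M.Γ) (l : List (Fin (M.workTapes + 1))) : Expr :=
  l.foldr (fun (i : Fin (M.workTapes + 1)) e => .add (.mul (.sub (.bank i (.var (headVar i))) (.lit (cΓ (s i))))
    (.sub (.bank i (.var (headVar i))) (.lit (cΓ (s i))))) e) (.lit 0)

/-- Positive iff the state and the scanned symbols are the given ones. -/
def scanTest (κ : M.Λ × (Fin (M.workTapes + 1) → M.Γ)) : Expr :=
  .sub (.lit 1) (.add (.mul (.sub (.var 3) (.lit (cΛ κ.1))) (.sub (.var 3) (.lit (cΛ κ.1))))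
    (scanDist M cΓ κ.2 (List.finRange _)))

def tapeActs (a : TMAction (M.workTapes + 1) M.Γ M.Λ) (l : List (Fin (M.workTapes + 1))) : Stmt :=
  l.foldr (fun (i : Fin (M.workTapes + 1)) p => (.putBank i (.var (headVar i)) (.lit (cΓ (a.write i))) ;;
    .inc (headVar i) (OracleTM.shift (a.move i))) ;; p) .skip

/-- One step of the machine for a known state and known scanned symbols. Variable `1` says that
the machine is running, variable `2` is its answer. -/
def moveStmt : TMMove (M.workTapes + 1) M.Γ M.Λ → Stmt
  | .halt b => .set 1 (.lit 0) ;; .set 2 (.lit (if b then 1 else 0))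
  | .det a => tapeActs M cΓ a (List.finRange _) ;; .set 3 (.lit (cΛ a.next))
  | .guess _ => .set 1 (.lit 0)

def dispatch (l : List (M.Λ × (Fin (M.workTapes + 1) → M.Γ))) : Stmt :=
  l.foldr (fun κ p => .ite (scanTest M cΓ cΛ κ) (moveStmt M cΓ cΛ (M.trans κ.1 κ.2)) p) .skip

theorem scanDist_eval (s : Fin (M.workTapes + 1) → M.Γ) (hΓ : Function.Injective cΓ)
    {σ : St} {c : OracleTM.FCfg M} (h : Simulates M cΓ cΛ σ c) (l : List (Fin (M.workTapes + 1))) :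
    0 ≤ (scanDist M cΓ s l).eval σ ∧
      ((scanDist M cΓ s l).eval σ = 0 ↔ ∀ i ∈ l, c.cont i (c.pos i) = s i) := by
  induction l with
  | nil => simp [scanDist]
  | cons i l ih =>
    obtain ⟨h0, h1⟩ := ih
    have e : (scanDist M cΓ s (i :: l)).eval σ = (cΓ (c.cont i (c.pos i)) - cΓ (s i)) ^ 2 +
        (scanDist M cΓ s l).eval σ := by
      simp only [scanDist, List.foldr_cons, Expr.eval_add, Expr.eval_mul, Expr.eval_sub,
        Expr.eval_bank, Expr.eval_var, Expr.eval_lit, h.2.1 i, h.2.2 i]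
      ring
    rw [e]
    refine ⟨by positivity, ?_⟩
    rw [add_eq_zero_iff_of_nonneg (by positivity) h0, h1, List.forall_mem_cons]
    refine and_congr_left fun _ => ?_
    rw [pow_eq_zero_iff (by norm_num), sub_eq_zero]
    exact hΓ.eq_iff

theorem scanTest_eval (κ : M.Λ × (Fin (M.workTapes + 1) → M.Γ)) (hΓ : Function.Injective cΓ)
    (hΛ : Function.Injective cΛ) {σ : St} {c : OracleTM.FCfg M} (h : Simulates M cΓ cΛ σ c) :
    0 < (scanTest M cΓ cΛ κ).eval σ ↔ κ = (c.state, fun i => c.cont i (c.pos i)) := by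
  obtain ⟨h0, h1⟩ := scanDist_eval M cΓ cΛ κ.2 hΓ h (List.finRange _)
  have e : (scanTest M cΓ cΛ κ).eval σ = 1 - ((cΛ c.state - cΛ κ.1) ^ 2 +
      (scanDist M cΓ κ.2 (List.finRange _)).eval σ) := by
    simp only [scanTest, Expr.eval_add, Expr.eval_mul, Expr.eval_sub, Expr.eval_var,
      Expr.eval_lit, h.1]
    ring
  have hsq : 0 ≤ (cΛ c.state - cΛ κ.1) ^ 2 := by positivity
  rw [e]
  have : 0 < 1 - ((cΛ c.state - cΛ κ.1) ^ 2 + (scanDist M cΓ κ.2 (List.finRange _)).eval σ) ↔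
      (cΛ c.state - cΛ κ.1) ^ 2 = 0 ∧ (scanDist M cΓ κ.2 (List.finRange _)).eval σ = 0 := by
    omega
  rw [this, h1, pow_eq_zero_iff (by norm_num), sub_eq_zero, hΛ.eq_iff]
  constructor
  · rintro ⟨h2, h3⟩
    exact Prod.ext h2.symm (funext fun i => (h3 i (List.mem_finRange i)).symm)
  · rintro rfl
    exact ⟨rfl, fun i _ => rfl⟩

/-- The charge does not depend on the head positions, because heads are moved by `inc`, which is
charged for the displacement and not for the new value. The last three clauses frame the tapes not
yet treated and the control variables. -/
theorem tapeActs_ev (a : TMAction (M.workTapes + 1) M.Γ M.Λ) {Z : ℕ}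
    (hZ : ∀ γ, (cΓ γ).natAbs ≤ Z) (c : OracleTM.FCfg M) (l : List (Fin (M.workTapes + 1)))
    (hl : l.Nodup) (σ : St) (h1 : ∀ i ∈ l, σ.v (headVar i) = c.pos i)
    (h2 : ∀ i ∈ l, ∀ z, σ.bank i z = cΓ (c.cont i z)) :
    ∃ t ≤ l.length * (Z + 3), ∃ τ, Ev (tapeActs M cΓ a l) σ t τ ∧
      (∀ i ∈ l, τ.v (headVar i) = (c.act a).pos i) ∧
      (∀ i ∈ l, ∀ z, τ.bank i z = cΓ ((c.act a).cont i z)) ∧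
      (∀ i : Fin (M.workTapes + 1), i ∉ l → τ.v (headVar i) = σ.v (headVar i)) ∧
      (∀ i : Fin (M.workTapes + 1), i ∉ l → τ.bank i = σ.bank i) ∧
      ∀ x < 4, τ.v x = σ.v x := by
  induction l generalizing σ with
  | nil => exact ⟨0, by simp, σ, .skip, by simp, by simp, by simp, by simp, by simp⟩
  | cons i l ih =>
    rw [List.nodup_cons] at hl
    set σ1 := (σ.setBank i (σ.v (headVar i)) (cΓ (a.write i))) with hσ1
    set σ2 := σ1.setv (headVar i) (σ1.v (headVar i) + OracleTM.shift (a.move i)) with hσ2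
    have ne : ∀ j : Fin (M.workTapes + 1), j ≠ i → headVar j ≠ headVar i := by
      intro j hj e
      exact hj (Fin.ext (by simpa [headVar] using e))
    have hv2 : ∀ x, x ≠ headVar i → σ2.v x = σ.v x := by
      intro x hx; simp [hσ2, hσ1, St.v_setv, hx]
    have hb2 : ∀ j : Fin (M.workTapes + 1), j ≠ i → σ2.bank j = σ.bank j := by
      intro j hj
      funext z
      have : (j : ℕ) ≠ i := fun e => hj (Fin.ext e)
      simp [hσ2, hσ1, St.bank_setBank, this]
    obtain ⟨t, ht, τ, hev, g1, g2, g3, g4, g5⟩ := ih hl.2 σ2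
      (fun j hj => by
        have : j ≠ i := fun e => hl.1 (e ▸ hj)
        rw [hv2 _ (ne j this), h1 j (List.mem_cons_of_mem _ hj)])
      (fun j hj z => by
        have : j ≠ i := fun e => hl.1 (e ▸ hj)
        rw [hb2 j this, h2 j (List.mem_cons_of_mem _ hj)])
    have e1 : Ev (.putBank i (.var (headVar i)) (.lit (cΓ (a.write i)))) σ
        ((cΓ (a.write i)).natAbs + 1) σ1 := Ev.putBank
    have e2 : Ev (.inc (headVar i) (OracleTM.shift (a.move i))) σ1
        ((OracleTM.shift (a.move i)).natAbs + 1) σ2 := Ev.inc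
    have hs : (OracleTM.shift (a.move i)).natAbs ≤ 1 := by
      cases a.move i with
      | none => simp [OracleTM.shift]
      | some d => cases d <;> simp [OracleTM.shift]
    refine ⟨_, ?_, τ, .seq (.seq e1 e2) hev, ?_, ?_, ?_, ?_, ?_⟩
    · have := hZ (a.write i)
      simp only [List.length_cons, add_mul, one_mul]
      omega
    · intro j hj
      by_cases hji : j = i
      · subst hji
        rw [g3 j hl.1]
        simp [hσ2, hσ1, St.v_setv, OracleTM.FCfg.act, h1 j (by simp)]
      · exact g1 j (by simpa [hji] using hj)
    · intro j hj z
      by_cases hji : j = i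
      · subst hji
        rw [g4 j hl.1]
        simp only [hσ2, hσ1, St.bank_setv, St.bank_setBank, OracleTM.FCfg.act,
          Function.update_apply, h1 j (by simp), h2 j (by simp), true_and]
        split <;> rfl
      · exact g2 j (by simpa [hji] using hj) z
    · intro j hj
      simp only [List.mem_cons, not_or] at hj
      rw [g3 j hj.2, hv2 _ (ne j hj.1)]
    · intro j hj
      simp only [List.mem_cons, not_or] at hj
      rw [g4 j hj.2, hb2 _ hj.1]
    · intro x hx
      rw [g5 x hx, hv2 x (by unfold headVar; omega)]

theorem dispatch_ev (hΓ : Function.Injective cΓ) (hΛ : Function.Injective cΛ) {σ τ : St}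
    {c : OracleTM.FCfg M} {t : ℕ} (h : Simulates M cΓ cΛ σ c)
    (hm : Ev (moveStmt M cΓ cΛ c.current) σ t τ)
    (l : List (M.Λ × (Fin (M.workTapes + 1) → M.Γ)))
    (hl : (c.state, fun i => c.cont i (c.pos i)) ∈ l) :
    ∃ t' ≤ t + l.length, Ev (dispatch M cΓ cΛ l) σ t' τ := by
  induction l with
  | nil => simp at hl
  | cons κ l ih =>
    have ht := scanTest_eval M cΓ cΛ κ hΓ hΛ h
    by_cases hκ : κ = (c.state, fun i => c.cont i (c.pos i))
    · refine ⟨t + 1, by simp, .iteT (ht.2 hκ) ?_⟩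
      rw [hκ]
      exact hm
    · obtain ⟨t', ht', hev⟩ := ih (by simpa [Ne.symm hκ] using hl)
      exact ⟨t' + 1, by simp; omega, .iteF (fun hp => hκ (ht.1 hp)) hev⟩

/-- A step amounts to one pass through the finite transition table followed by boundedly many
assignments of bounded charge. A run that receives no oracle bits never reaches a `guess` entry. -/
theorem simulate_run (hΓ : Function.Injective cΓ) (hΛ : Function.Injective cΛ) {Z : ℕ}
    (hZ : ∀ γ, (cΓ γ).natAbs ≤ Z) (hZ' : ∀ q, (cΛ q).natAbs ≤ Z)
    (l : List (M.Λ × (Fin (M.workTapes + 1) → M.Γ))) (hl : ∀ κ, κ ∈ l) :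
    ∀ {c : OracleTM.FCfg M} {bs : List Bool} {t : ℕ} {b : Bool}, OracleTM.FRun c bs t b → bs = [] →
      ∀ σ, Simulates M cΓ cΛ σ c → σ.v 1 = 1 →
        ∃ t' ≤ ((M.workTapes + 1) * (Z + 3) + Z + l.length + 6) * (t + 1), ∃ τ,
          Ev (.loop (.var 1) (dispatch M cΓ cΛ l)) σ t' τ ∧ τ.v 2 = if b then 1 else 0 := by
  intro c bs t b h
  set K := (M.workTapes + 1) * (Z + 3) + Z + l.length + 6 with hK
  induction h with
  | @halt c b hc =>
    intro _ σ hσ h1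
    have hm : Ev (moveStmt M cΓ cΛ c.current) σ (1 + ((if b then (1 : ℤ) else 0).natAbs + 1))
        ((σ.setv 1 0).setv 2 (if b then 1 else 0)) := by
      rw [hc]
      exact .seq (Ev.set (e := .lit 0)) (Ev.set (e := .lit _))
    obtain ⟨t', ht', hev⟩ := dispatch_ev M cΓ cΛ hΓ hΛ hσ hm l (hl _)
    refine ⟨t' + 1 + 1, ?_, _, .loopT (by simp [h1]) hev (.loopF (by simp [St.v_setv])), ?_⟩
    · have : (if b then (1 : ℤ) else 0).natAbs ≤ 1 := by cases b <;> simp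
      rw [hK]
      have := Nat.zero_le ((M.workTapes + 1) * (Z + 3))
      omega
    · simp [St.v_setv]
  | @det c a bs t b hc _ ih =>
    intro hbs σ hσ h1
    obtain ⟨s, hs, σ1, e1, g1, g2, -, -, g5⟩ := tapeActs_ev M cΓ a hZ c (List.finRange _)
      (List.nodup_finRange _) σ (fun i _ => hσ.2.1 i) (fun i _ => hσ.2.2 i)
    have hm : Ev (moveStmt M cΓ cΛ c.current) σ (s + ((cΛ a.next).natAbs + 1))
        (σ1.setv 3 (cΛ a.next)) := by
      rw [hc]
      exact .seq e1 (Ev.set (e := .lit _))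
    obtain ⟨t', ht', hev⟩ := dispatch_ev M cΓ cΛ hΓ hΛ hσ hm l (hl _)
    have hσ' : Simulates M cΓ cΛ (σ1.setv 3 (cΛ a.next)) (c.act a) := by
      refine ⟨by simp [St.v_setv, OracleTM.FCfg.act], fun i => ?_, fun i z => ?_⟩
      · rw [St.v_setv, if_neg (by unfold headVar; omega)]
        exact g1 i (List.mem_finRange i)
      · exact g2 i (List.mem_finRange i) z
    obtain ⟨t2, ht2, τ, hev2, hτ⟩ := ih hbs _ hσ' (by simp [St.v_setv, g5 1, h1])
    refine ⟨t' + t2 + 1, ?_, τ, .loopT (by simp [h1]) hev hev2, hτ⟩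
    have := hZ' a.next
    rw [List.length_finRange] at hs
    rw [mul_add, mul_one]
    omega
  | guess y hc _ ih => intro hbs; cases hbs

/-- Initialization of the heads. -/
def initHeads (n : ℕ) : Stmt :=
  (List.range n).foldr (fun i p => .set (headVar i) (.lit 0) ;; p) .skip

theorem initHeads_ev (n : ℕ) (σ : St) : ∃ t ≤ n, ∃ τ, Ev (initHeads n) σ t τ ∧
    (∀ i < n, τ.v (headVar i) = 0) ∧ τ.bank = σ.bank ∧ ∀ x < 4, τ.v x = σ.v x := by
  -- For the induction a head variable is allowed to be zero already instead of being listed: those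
  -- treated earlier must stay zero.
  suffices H : ∀ (l : List ℕ) (σ : St), ∃ t ≤ l.length, ∃ τ,
      Ev (l.foldr (fun i p => .set (headVar i) (.lit 0) ;; p) .skip) σ t τ ∧
      (∀ i, i ∈ l ∨ σ.v (headVar i) = 0 → τ.v (headVar i) = 0) ∧ τ.bank = σ.bank ∧
      ∀ x < 4, τ.v x = σ.v x by
    obtain ⟨t, ht, τ, h, h1, h2⟩ := H (List.range n) σ
    exact ⟨t, by simpa using ht, τ, h, fun i hi => h1 i (.inl (List.mem_range.2 hi)), h2⟩
  intro l
  induction l with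
  | nil => exact fun σ => ⟨0, by simp, σ, .skip, by simp, rfl, fun _ _ => rfl⟩
  | cons i l ih =>
    intro σ
    obtain ⟨t, ht, τ, h, h1, h2, h3⟩ := ih (σ.setv (headVar i) 0)
    refine ⟨_, ?_, τ, .seq (Ev.set (e := .lit 0)) h, fun j hj => h1 j ?_, h2, fun x hx => ?_⟩
    · simp; omega
    · simp only [List.mem_cons] at hj
      rcases hj with (rfl | hj) | hj
      · right; simp [St.v_setv]
      · exact .inl hj
      · right; rw [St.v_setv]; split <;> simp [*]
    · rw [h3 x hx, St.v_setv, if_neg (by unfold headVar; omega)]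

/-- The program that runs `M` on the content of bank `0`. -/
def simulator (l : List (M.Λ × (Fin (M.workTapes + 1) → M.Γ))) : Stmt :=
  .set 1 (.lit 1) ;; .set 3 (.lit (cΛ M.start)) ;; initHeads (M.workTapes + 1) ;;
    .loop (.var 1) (dispatch M cΓ cΛ l)

end Simulation

/-- Every Turing machine has a simulating program. -/
theorem exists_simulator (M : OracleTM) : ∃ (p : Stmt) (sym : Bool → ℤ) (C : ℕ),
    ∀ (x : List Bool) (t : ℕ) (b : Bool), OracleTM.Run (M.init x) [] t b → ∀ σ : St,
      (∀ z : ℤ, σ.bank 0 z = if 0 ≤ z then ((x[z.toNat]?).map sym).getD 0 else 0) →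
      (∀ i z, 0 < i → i ≤ M.workTapes → σ.bank i z = 0) →
      ∃ t' ≤ C * (t + 1), ∃ τ, Ev p σ t' τ ∧ τ.v 2 = if b then 1 else 0 := by
  classical
  have : Fintype M.Γ := Fintype.ofFinite _
  have : Fintype M.Λ := Fintype.ofFinite _
  let eΓ := Fintype.equivFin M.Γ
  let eΛ := Fintype.equivFin M.Λ
  -- Subtracting the number of the blank gives it the code 0, so that untouched memory represents
  -- blank tape.
  let cΓ : M.Γ → ℤ := fun γ => (eΓ γ : ℕ) - (eΓ default : ℕ)
  let cΛ : M.Λ → ℤ := fun q => (eΛ q : ℕ)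
  have hΓ : Function.Injective cΓ := fun a b h => by
    have : (eΓ a : ℕ) = eΓ b := by simpa [cΓ] using h
    exact eΓ.injective (Fin.ext this)
  have hΛ : Function.Injective cΛ := fun a b h => by
    have : (eΛ a : ℕ) = eΛ b := by simpa [cΛ] using h
    exact eΛ.injective (Fin.ext this)
  have h0 : cΓ default = 0 := by simp [cΓ]
  set Z := Fintype.card M.Γ + Fintype.card M.Λ with hZdef
  have hZ : ∀ γ, (cΓ γ).natAbs ≤ Z := fun γ => by
    have h1 := (eΓ γ).2
    have h2 := (eΓ default).2
    simp only [cΓ]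
    omega
  have hZ' : ∀ q, (cΛ q).natAbs ≤ Z := fun q => by
    have h1 := (eΛ q).2
    simp only [cΛ]
    omega
  set l := (Finset.univ : Finset (M.Λ × (Fin (M.workTapes + 1) → M.Γ))).toList with hl
  set K := (M.workTapes + 1) * (Z + 3) + Z + l.length + 6 with hK
  refine ⟨simulator M cΓ cΛ l, fun b => cΓ (M.sym b), K + (2 + (Z + 1) + (M.workTapes + 1)), ?_⟩
  intro x t b hrun σ hx hw
  rw [OracleTM.run_init_iff] at hrun
  obtain ⟨s, hs, τ, h1, h2, h3, h4⟩ := initHeads_ev (M.workTapes + 1)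
    ((σ.setv 1 1).setv 3 (cΛ M.start))
  have hsim : Simulates M cΓ cΛ τ (OracleTM.finit M x) := by
    refine ⟨?_, fun i => ?_, fun i z => ?_⟩
    · rw [h4 3 (by norm_num)]; simp [St.v_setv, OracleTM.finit]
    · rw [h2 i i.2]; rfl
    · rw [h3]
      simp only [St.bank_setv, OracleTM.finit]
      by_cases hi : i = 0
      · subst hi
        simp only [if_true, OracleTM.wordTape]
        rw [Fin.val_zero, hx z]
        split
        · cases x[z.toNat]? <;> simp [h0]
        · exact h0.symm
      · have hi' : 0 < (i : ℕ) := Nat.pos_of_ne_zero fun e => hi (Fin.ext e)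
        rw [if_neg hi, hw i z hi' (by omega), h0]
  obtain ⟨t', ht', ω, hev, hω⟩ := simulate_run M cΓ cΛ hΓ hΛ hZ hZ' l (by simp [hl]) hrun rfl τ hsim
    (by rw [h4 1 (by norm_num)]; simp [St.v_setv])
  refine ⟨_, ?_, ω, .seq (Ev.set (e := .lit 1)) (.seq (Ev.set (e := .lit _)) (.seq h1 hev)), hω⟩
  have := hZ' M.start
  simp only [Expr.eval_lit, Int.natAbs_one]
  nlinarith [Nat.zero_le ((2 + (Z + 1) + (M.workTapes + 1)) * t)]

end While

/-! ## Programs that generate a stream of commands -/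

namespace While

/-- The unary code of a sequence of commands. -/
def encodeCommands (l : List ℕ) : List Bool := l.flatMap fun j => List.replicate j true ++ [false]

@[simp] theorem encodeCommands_nil : encodeCommands [] = [] := rfl

@[simp] theorem encodeCommands_append (l l' : List ℕ) :
    encodeCommands (l ++ l') = encodeCommands l ++ encodeCommands l' := by
  simp [encodeCommands]

/-- Bank `0` holds the word `l`, and variable `0` its length. -/
def Output (sym : Bool → ℤ) (σ : St) (l : List Bool) : Prop :=
  σ.v 0 = l.length ∧
    ∀ z : ℤ, σ.bank 0 z = if 0 ≤ z then ((l[z.toNat]?).map sym).getD 0 else 0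

/-- The states agree on the variables `1, …, d - 1` and on the banks other than bank `0`. -/
def Agree (d : ℕ) (σ τ : St) : Prop :=
  (∀ y, 0 < y → y < d → τ.v y = σ.v y) ∧ ∀ k, 0 < k → τ.bank k = σ.bank k

theorem Agree.refl (d : ℕ) (σ : St) : Agree d σ σ := ⟨fun _ _ _ => rfl, fun _ _ => rfl⟩

theorem Agree.trans {d : ℕ} {σ τ ω : St} (h : Agree d σ τ) (h' : Agree d τ ω) : Agree d σ ω :=
  ⟨fun y h0 hy => (h'.1 y h0 hy).trans (h.1 y h0 hy), fun k hk => (h'.2 k hk).trans (h.2 k hk)⟩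

theorem Agree.mono {d d' : ℕ} {σ τ : St} (h : Agree d σ τ) (hd : d' ≤ d) : Agree d' σ τ :=
  ⟨fun y h0 hy => h.1 y h0 (hy.trans_le hd), h.2⟩

/-- The value of the expression is determined by the variables `1, …, d - 1` and the banks other
than bank `0`. -/
def Indep (d : ℕ) (e : Expr) : Prop := ∀ σ τ, Agree d σ τ → e.eval τ = e.eval σ

/-- The statement `p` appends the commands `f σ` to the output, in time linear in their number. -/
def Generates (sym : Bool → ℤ) (d : ℕ) (p : Stmt) (f : St → List ℕ) : Prop :=
  (∀ σ τ, Agree d σ τ → f τ = f σ) ∧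
    ∃ C, ∀ σ l, Output sym σ l → ∃ t ≤ C * ((f σ).length + 1), ∃ τ, Ev p σ t τ ∧
      Output sym τ (l ++ encodeCommands (f σ)) ∧ Agree d σ τ

variable {sym : Bool → ℤ}

def emitBits (sym : Bool → ℤ) (l : List Bool) : Stmt :=
  l.foldr (fun b p => (.putBank 0 (.var 0) (.lit (sym b)) ;; .inc 0 1) ;; p) .skip

def emit (sym : Bool → ℤ) (j : ℕ) : Stmt := emitBits sym (encodeCommands [j])

theorem emitBits_ev (w : List Bool) : ∃ C, ∀ σ l, Output sym σ l → ∃ t ≤ C, ∃ τ,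
    Ev (emitBits sym w) σ t τ ∧ Output sym τ (l ++ w) ∧ ∀ d, Agree d σ τ := by
  induction w with
  | nil => exact ⟨0, fun σ l h => ⟨0, le_rfl, σ, .skip, by simpa using h, fun d => .refl d σ⟩⟩
  | cons b w ih =>
    obtain ⟨C, hC⟩ := ih
    refine ⟨((sym b).natAbs + 1) + (1 + 1) + C, fun σ l h => ?_⟩
    set σ1 := (σ.setBank 0 (σ.v 0) (sym b)).setv 0 (σ.v 0 + 1) with hσ1
    have h1 : Output sym σ1 (l ++ [b]) := by
      refine ⟨by simp [hσ1, St.v_setv, h.1], fun z => ?_⟩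
      simp only [hσ1, St.bank_setv, St.bank_setBank, h.1, h.2 z, true_and]
      by_cases hz : z = l.length
      · subst hz; simp
      · rw [if_neg hz]
        by_cases h0 : 0 ≤ z
        · rw [if_pos h0, if_pos h0]
          by_cases hlt : z.toNat < l.length
          · rw [List.getElem?_append_left hlt]
          · have h2 : l.length + 1 ≤ z.toNat := by omega
            rw [List.getElem?_eq_none (by omega), List.getElem?_eq_none (by simpa using h2)]
        · rw [if_neg h0, if_neg h0]
    obtain ⟨t, ht, τ, hev, ho, ha⟩ := hC σ1 _ h1
    have e1 : Ev (.putBank 0 (.var 0) (.lit (sym b)) ;; .inc 0 1) σ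
        (((sym b).natAbs + 1) + (1 + 1)) σ1 :=
      .seq (Ev.putBank (a := .var 0) (e := .lit (sym b))) Ev.inc
    refine ⟨_, by omega, τ, .seq e1 hev, by simpa using ho, fun d => Agree.trans ?_ (ha d)⟩
    refine ⟨fun y hy _ => by simp [hσ1, St.v_setv, hy.ne'], fun k hk => ?_⟩
    funext z
    simp [hσ1, St.bank_setBank, hk.ne']

theorem generates_emit (d j : ℕ) : Generates sym d (emit sym j) fun _ => [j] := by
  obtain ⟨C, hC⟩ := emitBits_ev (sym := sym) (encodeCommands [j])
  refine ⟨fun _ _ _ => rfl, C, fun σ l h => ?_⟩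
  obtain ⟨t, ht, τ, hev, ho, ha⟩ := hC σ l h
  exact ⟨t, by nlinarith, τ, hev, ho, ha d⟩

theorem Generates.seq {d : ℕ} {p q : Stmt} {f g : St → List ℕ} (hp : Generates sym d p f)
    (hq : Generates sym d q g) : Generates sym d (p ;; q) fun σ => f σ ++ g σ := by
  obtain ⟨hf, C, hC⟩ := hp
  obtain ⟨hg, D, hD⟩ := hq
  refine ⟨fun σ τ h => by simp only [hf σ τ h, hg σ τ h], C + D, fun σ l h => ?_⟩
  obtain ⟨t, ht, τ, hev, ho, ha⟩ := hC σ l h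
  obtain ⟨t', ht', τ', hev', ho', ha'⟩ := hD τ _ ho
  rw [hg σ τ ha] at ht' ho'
  refine ⟨t + t', ?_, τ', .seq hev hev', by simpa using ho', ha.trans ha'⟩
  rw [List.length_append]
  nlinarith [Nat.zero_le (C * (g σ).length), Nat.zero_le (D * (f σ).length)]

theorem Generates.ite {d : ℕ} {e : Expr} {p q : Stmt} {f g : St → List ℕ} (he : Indep d e)
    (hp : Generates sym d p f) (hq : Generates sym d q g) :
    Generates sym d (.ite e p q) fun σ => if 0 < e.eval σ then f σ else g σ := by
  obtain ⟨hf, C, hC⟩ := hp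
  obtain ⟨hg, D, hD⟩ := hq
  refine ⟨fun σ τ h => by simp only [hf σ τ h, hg σ τ h, he σ τ h], C + D + 1, fun σ l h => ?_⟩
  by_cases h0 : 0 < e.eval σ
  · obtain ⟨t, ht, τ, hev, ho, ha⟩ := hC σ l h
    refine ⟨t + 1, ?_, τ, .iteT h0 hev, by simpa [h0] using ho, ha⟩
    simp only [h0, if_true]
    nlinarith [Nat.zero_le (D * (f σ).length)]
  · obtain ⟨t, ht, τ, hev, ho, ha⟩ := hD σ l h
    refine ⟨t + 1, ?_, τ, .iteF h0 hev, by simpa [h0] using ho, ha⟩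
    simp only [h0, if_false]
    nlinarith [Nat.zero_le (C * (g σ).length)]

/-- `for x = 0, …, e - 1` do `p`. -/
def forLoop (x : ℕ) (e : Expr) (p : Stmt) : Stmt :=
  .set x (.lit 0) ;; .loop (.sub e (.var x)) (p ;; .inc x 1)

/-- Every round emits at least one command, which pays for the overhead of the round; without `hne`
the charge could not be linear in the length of the output. This is the purpose of the idle commands
0 that are placed in the bodies of loops in the stream. -/
theorem Generates.forLoop {x : ℕ} (hx : 0 < x) {e : Expr} {p : Stmt} {f : St → List ℕ}
    (he : Indep x e) (hp : Generates sym (x + 1) p f) (hne : ∀ σ, f σ ≠ []) :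
    Generates sym x (forLoop x e p) fun σ =>
      (List.range (e.eval σ).toNat).flatMap fun i : ℕ => f (σ.setv x i) := by
  obtain ⟨hf, C, hC⟩ := hp
  have agree : ∀ {σ τ : St} {i : ℤ}, Agree x σ τ → τ.v x = i → Agree (x + 1) (σ.setv x i) τ := by
    intro σ τ i h hi
    refine ⟨fun y h0 hy => ?_, fun k hk => h.2 k hk⟩
    rw [St.v_setv]
    split
    · next e => rw [e, hi]
    · exact h.1 y h0 (by omega)
  refine ⟨fun σ τ h => ?_, 2 * C + 4, fun σ l h => ?_⟩
  · simp only [he σ τ h]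
    congr 1
    funext i
    refine hf _ _ (agree (τ := τ.setv x i) ⟨fun y h0 hy => ?_, h.2⟩ (by simp [St.v_setv]))
    rw [St.v_setv, if_neg hy.ne]
    exact h.1 y h0 hy
  set N := (e.eval σ).toNat with hN
  -- Here i rounds are done and n remain. The commands are expressed through the state σ before the
  -- loop, which differs from the current one only in the loop variable, variables above it, and the
  -- output.
  have key : ∀ n i τ l, i + n = N → Agree x σ τ → τ.v x = (i : ℕ) → Output sym τ l →
      ∃ t ≤ (2 * C + 3) * ((List.range' i n).flatMap fun i => f (σ.setv x (i : ℕ))).length + 1, ∃ ω,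
        Ev (.loop (.sub e (.var x)) (p ;; .inc x 1)) τ t ω ∧
        Output sym ω (l ++ encodeCommands ((List.range' i n).flatMap fun i => f (σ.setv x (i : ℕ)))) ∧
        Agree x σ ω := by
    intro n
    induction n with
    | zero =>
      intro i τ l hi ha hv ho
      refine ⟨1, by simp, τ, .loopF ?_, by simpa using ho, ha⟩
      simp only [Expr.eval_sub, Expr.eval_var, he σ τ ha, hv]
      omega
    | succ n ih =>
      intro i τ l hi ha hv ho
      obtain ⟨t, ht, τ1, hev, ho1, ha1⟩ := hC τ l ho
      rw [hf _ _ (agree ha hv)] at ht ho1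
      have hv1 : τ1.v x = i := (ha1.1 x hx (by omega)).trans hv
      have ha2 : Agree x σ (τ1.setv x (τ1.v x + 1)) := by
        refine (ha.trans (ha1.mono (by omega))).trans ⟨fun y h0 hy => ?_, fun k hk => rfl⟩
        rw [St.v_setv, if_neg hy.ne]
      have ho2 : Output sym (τ1.setv x (τ1.v x + 1))
          (l ++ encodeCommands (f (σ.setv x (i : ℕ)))) := by
        refine ⟨?_, ho1.2⟩
        rw [St.v_setv, if_neg hx.ne, ho1.1]
      obtain ⟨t', ht', ω, hev', ho', ha'⟩ := ih (i + 1) _ _ (by omega) ha2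
        (by rw [St.v_setv, if_pos rfl, hv1]; push_cast; ring) ho2
      refine ⟨(t + (1 + 1)) + t' + 1, ?_, ω, .loopT ?_ (.seq hev Ev.inc) hev', ?_, ha'⟩
      · rw [List.range'_succ, List.flatMap_cons, List.length_append]
        have : 1 ≤ (f (σ.setv x (i : ℕ))).length := List.length_pos_iff.2 (hne _)
        nlinarith [Nat.mul_le_mul_left C this]
      · simp only [Expr.eval_sub, Expr.eval_var, he σ τ ha, hv]
        omega
      · rw [List.range'_succ, List.flatMap_cons, encodeCommands_append, ← List.append_assoc]
        exact ho'
  have ha0 : Agree x σ (σ.setv x 0) :=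
    ⟨fun y h0 hy => by rw [St.v_setv, if_neg hy.ne], fun k hk => rfl⟩
  obtain ⟨t, ht, τ, hev, ho, ha⟩ := key N 0 (σ.setv x 0) l (by omega) ha0 (by simp [St.v_setv])
    ⟨by rw [St.v_setv, if_neg hx.ne]; exact h.1, h.2⟩
  rw [← List.range_eq_range'] at ht ho
  refine ⟨1 + t, ?_, τ, .seq (Ev.set (e := .lit 0)) hev, ho, ha⟩
  simp only [← hN]
  nlinarith

/-- Emit a command `e` times. -/
def emitMany (sym : Bool → ℤ) (x : ℕ) (e : Expr) (j : ℕ) : Stmt := forLoop x e (emit sym j)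

theorem generates_emitMany {x : ℕ} (hx : 0 < x) {e : Expr} (he : Indep x e) (j : ℕ) :
    Generates sym x (emitMany sym x e j) fun σ => List.replicate (e.eval σ).toNat j := by
  have := Generates.forLoop (sym := sym) hx he (generates_emit (x + 1) j) (by simp)
  refine cast ?_ this
  congr 1
  funext σ
  rw [List.flatMap_def]
  simp

end While

/-! ## Reading an instance -/

namespace While

/-- The value of a list of binary digits, least significant digit first. -/
def bitsVal (l : List Bool) : ℕ := l.foldr (fun b n => b.toNat + 2 * n) 0

theorem bitsVal_bits (n : ℕ) : bitsVal n.bits = n := by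
  induction n using Nat.binaryRec' with
  | zero => simp [bitsVal]
  | bit b n h ih =>
    rw [Nat.bits_append_bit _ _ h]
    change b.toNat + 2 * bitsVal n.bits = _
    rw [ih, Nat.bit_val]; ring

theorem bitsVal_append (l l' : List Bool) :
    bitsVal (l ++ l') = bitsVal l + 2 ^ l.length * bitsVal l' := by
  induction l with
  | nil => simp [bitsVal]
  | cons b l ih =>
    change b.toNat + 2 * bitsVal (l ++ l') = b.toNat + 2 * bitsVal l + _
    rw [ih, List.length_cons, pow_succ]; ring

theorem length_bits (n : ℕ) : n.bits.length = n.size := Nat.size_eq_bits_len n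

/-- The `t`-th signed binary digit of an integer. -/
def digit (z : ℤ) (t : ℕ) : ℤ := (if z < 0 then -1 else 1) * (z.natAbs.bits[t]?.getD false).toNat

theorem sum_getD_bits (l : List Bool) (b : ℕ) (h : l.length ≤ b) :
    ∑ t ∈ Finset.range b, (l[t]?.getD false).toNat * 2 ^ t = bitsVal l := by
  induction l generalizing b with
  | nil => simp [bitsVal]
  | cons c l ih =>
    cases b with
    | zero => simp at h
    | succ b =>
      rw [Finset.sum_range_succ']
      have := ih b (by simpa using h)
      simp only [List.getElem?_cons_succ, List.getElem?_cons_zero, Option.getD_some, pow_zero,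
        mul_one]
      change _ = c.toNat + 2 * bitsVal l
      rw [← this, Finset.mul_sum, add_comm]
      congr 1
      refine Finset.sum_congr rfl fun t _ => ?_
      rw [pow_succ]; ring

theorem sum_digit (z : ℤ) (b : ℕ) (h : z.natAbs.size ≤ b) :
    ∑ t ∈ Finset.range b, digit z t * 2 ^ t = z := by
  have h1 := sum_getD_bits z.natAbs.bits b (by rwa [length_bits])
  rw [bitsVal_bits] at h1
  have : ∑ t ∈ Finset.range b, digit z t * 2 ^ t = (if z < 0 then -1 else 1) *
      ((∑ t ∈ Finset.range b, (z.natAbs.bits[t]?.getD false).toNat * 2 ^ t : ℕ) : ℤ) := by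
    rw [Nat.cast_sum, Finset.mul_sum]
    refine Finset.sum_congr rfl fun t _ => ?_
    simp only [digit]; push_cast; ring
  rw [this, h1]
  split <;> omega

theorem digit_abs (z : ℤ) (t : ℕ) : |digit z t| ≤ 1 := by
  unfold digit
  split <;> cases z.natAbs.bits[t]?.getD false <;> simp

/-- The input symbol for a bit. -/
def inSym (b : Bool) : ℤ := if b then 2 else 1

/-- Read a self-delimiting list of bits, executing `body` for every bit, which is in variable `4`. -/
def readBits (body : Stmt) : Stmt :=
  .read 3 ;; .loop (.sub (.var 3) (.lit 1)) (.read 4 ;; body ;; .read 3)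

/-- An invariant rule: `Inv pre` describes the state after the digits `pre`. It must be insensitive
to variables 3 and 4 and to the unread input, since reading changes these. -/
theorem readBits_ev {body : Stmt} {full : List Bool} {Inv : List Bool → St → Prop} {T : ℕ}
    (h3 : ∀ {pre σ} z, Inv pre σ → Inv pre (σ.setv 3 z))
    (h4 : ∀ {pre σ} z, Inv pre σ → Inv pre (σ.setv 4 z))
    (hi : ∀ {pre σ} l, Inv pre σ → Inv pre { σ with inp := l })
    (hbody : ∀ pre b σ, pre ++ [b] <+: full → Inv pre σ → σ.v 4 = inSym b →
      ∃ t ≤ T, ∃ τ, Ev body σ t τ ∧ Inv (pre ++ [b]) τ ∧ τ.inp = σ.inp)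
    {σ : St} {rest : List Bool} (h0 : Inv [] σ)
    (hin : σ.inp = ((full.flatMap fun b => [true, b]) ++ [false] ++ rest).map inSym) :
    ∃ t ≤ full.length * (T + 3) + 2, ∃ τ, Ev (readBits body) σ t τ ∧ Inv full τ ∧
      τ.inp = rest.map inSym := by
  -- At the head of the loop variable 3 already holds the next symbol c, which announces a digit or
  -- the end; r is what is still unread.
  have key : ∀ (l pre : List Bool) (σ : St), pre ++ l = full → Inv pre σ →
      (∃ c r, σ.v 3 = inSym c ∧ σ.inp = r.map inSym ∧
        c :: r = (l.flatMap fun b => [true, b]) ++ [false] ++ rest) →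
      ∃ t ≤ l.length * (T + 3) + 1, ∃ τ,
        Ev (.loop (.sub (.var 3) (.lit 1)) (.read 4 ;; body ;; .read 3)) σ t τ ∧ Inv full τ ∧
          τ.inp = rest.map inSym := by
    intro l
    induction l with
    | nil =>
      rintro pre σ hpre hI ⟨c, r, hc, hr, e⟩
      simp only [List.flatMap_nil, List.nil_append, List.cons_append, List.cons.injEq] at e
      obtain ⟨rfl, rfl⟩ := e
      rw [List.append_nil] at hpre
      subst hpre
      exact ⟨1, by simp, σ, .loopF (by simp [hc, inSym]), hI, hr⟩
    | cons b l ih =>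
      rintro pre σ hpre hI ⟨c, r, hc, hr, e⟩
      simp only [List.flatMap_cons, List.cons_append, List.nil_append, List.cons.injEq] at e
      obtain ⟨rfl, e⟩ := e
      obtain ⟨r', rfl⟩ : ∃ r', r = b :: r' := ⟨_, e⟩
      simp only [List.cons.injEq, true_and] at e
      set σ1 : St := { σ.setv 4 (σ.inp.headD 0) with inp := σ.inp.tail } with hσ1
      have hI1 : Inv pre σ1 := hi _ (h4 _ hI)
      have hb1 : σ1.v 4 = inSym b := by simp [hσ1, hr, St.v_setv]
      obtain ⟨t, ht, σ2, hev, hI2, hin2⟩ := hbody pre b σ1 ⟨l, by simp [← hpre]⟩ hI1 hb1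
      set σ3 : St := { σ2.setv 3 (σ2.inp.headD 0) with inp := σ2.inp.tail } with hσ3
      have hI3 : Inv (pre ++ [b]) σ3 := hi _ (h3 _ hI2)
      have hin1 : σ2.inp = r'.map inSym := by rw [hin2, hσ1]; simp [hr]
      have : ∃ c r, σ3.v 3 = inSym c ∧ σ3.inp = r.map inSym ∧
          c :: r = (l.flatMap fun b => [true, b]) ++ [false] ++ rest := by
        cases hr' : r' with
        | nil => rw [hr'] at e; simp at e
        | cons c r'' =>
          refine ⟨c, r'', ?_, ?_, by rw [← hr', e]⟩
          · simp [hσ3, hin1, hr', St.v_setv]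
          · simp [hσ3, hin1, hr']
      obtain ⟨t', ht', τ, hev', hI', hr''⟩ := ih (pre ++ [b]) σ3 (by simpa using hpre) hI3 this
      refine ⟨(1 + (t + 1)) + t' + 1, ?_, τ, .loopT (by simp [hc, inSym])
        (.seq Ev.read (.seq hev Ev.read)) hev', hI', hr''⟩
      rw [List.length_cons, add_mul]
      omega
  set σ1 : St := { σ.setv 3 (σ.inp.headD 0) with inp := σ.inp.tail } with hσ1
  have : ∃ c r, σ1.v 3 = inSym c ∧ σ1.inp = r.map inSym ∧
      c :: r = (full.flatMap fun b => [true, b]) ++ [false] ++ rest := by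
    cases hl : (full.flatMap fun b => [true, b]) ++ [false] ++ rest with
    | nil => simp at hl
    | cons c r =>
      rw [hl] at hin
      exact ⟨c, r, by simp [hσ1, hin, St.v_setv], by simp [hσ1, hin], rfl⟩
  obtain ⟨t, ht, τ, hev, hI, hr⟩ := key full [] σ1 rfl (hi _ (h3 _ h0)) this
  exact ⟨1 + t, by omega, τ, .seq Ev.read hev, hI, hr⟩

/-- Read a natural number into variable `1`. -/
def readNat : Stmt :=
  .set 2 (.lit 1) ;; readBits (.set 1 (.add (.var 1) (.mul (.var 2) (.sub (.var 4) (.lit 1)))) ;;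
    .set 2 (.mul (.var 2) (.lit 2)))

/-- Variable 2 runs through the powers of two. A charge quadratic in n is harmless, because only the
number of vertices is read in this way and (N + 1)² is dominated by the size of the matrix. -/
theorem readNat_ev (n : ℕ) {rest : List Bool} {σ : St} (h1 : σ.v 1 = 0)
    (hin : σ.inp = (CliqueInstance.encodeNat n ++ rest).map inSym) :
    ∃ t ≤ (n + 4) * (3 * n + 5) , ∃ τ, Ev readNat σ t τ ∧ τ.v 1 = n ∧ (∀ x, x = 0 ∨ 4 < x → τ.v x = σ.v x) ∧
      τ.bank = σ.bank ∧ τ.inp = rest.map inSym := by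
  let Inv : List Bool → St → Prop := fun pre τ => τ.v 1 = bitsVal pre ∧ τ.v 2 = 2 ^ pre.length ∧
    (∀ x, x = 0 ∨ 4 < x → τ.v x = σ.v x) ∧ τ.bank = σ.bank
  have hset : ∀ {pre τ} x (z : ℤ), 2 < x → x < 5 → Inv pre τ → Inv pre (τ.setv x z) := by
    rintro pre τ x z hx hx' ⟨a, b, c, d⟩
    refine ⟨?_, ?_, fun y hy => ?_, d⟩
    · rw [St.v_setv, if_neg (by omega), a]
    · rw [St.v_setv, if_neg (by omega), b]
    · rw [St.v_setv, if_neg (by omega), c y hy]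
  have key := readBits_ev (full := n.bits) (Inv := Inv) (T := 3 * n + 2)
    (body := .set 1 (.add (.var 1) (.mul (.var 2) (.sub (.var 4) (.lit 1)))) ;;
      .set 2 (.mul (.var 2) (.lit 2))) (σ := σ.setv 2 1) (rest := rest)
    (fun z h => hset 3 z (by norm_num) (by norm_num) h)
    (fun z h => hset 4 z (by norm_num) (by norm_num) h) (fun l h => h) ?_ ?_ ?_
  · obtain ⟨t, ht, τ, hev, hI, hr⟩ := key
    refine ⟨_, ?_, τ, .seq (Ev.set (e := .lit 1)) hev, ?_, hI.2.2.1, hI.2.2.2, hr⟩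
    · have : n.bits.length ≤ n := by
        rw [length_bits, Nat.size_le]; exact Nat.lt_two_pow_self
      simp only [Expr.eval_lit, Int.natAbs_one]
      nlinarith
    · rw [hI.1, bitsVal_bits]
  · rintro pre b τ hpre ⟨a1, a2, a3, a4⟩ hb
    have hle : bitsVal (pre ++ [b]) ≤ n := by
      obtain ⟨l, hl⟩ := hpre
      have := bitsVal_append (pre ++ [b]) l
      rw [hl, bitsVal_bits] at this
      rw [this]; exact Nat.le_add_right _ _
    have hpow : 2 ^ pre.length ≤ n := by
      have := hpre.length_le
      rw [length_bits, List.length_append, List.length_singleton] at this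
      exact Nat.lt_size.1 (by omega)
    have hval : τ.v 1 + τ.v 2 * (τ.v 4 - 1) = bitsVal (pre ++ [b]) := by
      rw [bitsVal_append, a1, a2, hb]
      cases b <;> simp [inSym, bitsVal]
    refine ⟨_, ?_, _, .seq Ev.set Ev.set, ⟨?_, ?_, fun x hx => ?_, a4⟩, rfl⟩
    · simp only [Expr.eval_add, Expr.eval_mul, Expr.eval_sub, Expr.eval_var, Expr.eval_lit, hval,
        St.v_setv]
      simp only [Int.natAbs_natCast, Int.natAbs_mul, a2]
      norm_num [Int.natAbs_pow]
      omega
    · simp only [Expr.eval_add, Expr.eval_mul, Expr.eval_sub, Expr.eval_var, Expr.eval_lit, hval,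
        St.v_setv]
      simp
    · simp [St.v_setv, a2, pow_succ]
    · rw [St.v_setv, if_neg (by omega), St.v_setv, if_neg (by omega), a3 x hx]
  · refine ⟨by simp [St.v_setv, h1, bitsVal], by simp [St.v_setv], fun x hx => ?_, rfl⟩
    rw [St.v_setv, if_neg (by omega)]
  · simpa [CliqueInstance.encodeNat] using hin

/-- Read an integer, storing its digits in bank `k` at `((v₈, v₉), t)`, and update the maximal
number of digits in variable `7`. -/
def readInt (k : ℕ) : Stmt :=
  .read 5 ;; .set 6 (.lit 0) ;;
    readBits (.putBank k (.pair (.pair (.var 8) (.var 9)) (.var 6))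
      (.mul (.sub (.var 4) (.lit 1)) (.sub (.lit 3) (.mul (.lit 2) (.var 5)))) ;; .inc 6 1) ;;
    .ite (.sub (.var 6) (.var 7)) (.set 7 (.var 6)) .skip

/-- Weights are never assembled into numbers, whose charge would be exponential in their length;
they are stored as signed digits in {-1, 0, 1}, each at bounded charge. Cells beyond the last digit
must already be zero. -/
theorem readInt_ev (k : ℕ) (z : ℤ) {rest : List Bool} {σ : St} {i j w : ℕ} (hi : σ.v 8 = i)
    (hj : σ.v 9 = j) (hw : σ.v 7 = w)
    (hz : ∀ t : ℕ, σ.bank k (pairing (pairing i j) t) = 0)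
    (hin : σ.inp = (CliqueInstance.encodeInt z ++ rest).map inSym) :
    ∃ t ≤ 10 * (z.natAbs.size + 1), ∃ τ, Ev (readInt k) σ t τ ∧
      τ.v 7 = (max w z.natAbs.size : ℕ) ∧ (∀ x, x < 3 ∨ 7 < x → τ.v x = σ.v x) ∧
      (∀ k', k' ≠ k → τ.bank k' = σ.bank k') ∧
      (∀ a b t : ℕ, τ.bank k (pairing (pairing a b) t) =
        if a = i ∧ b = j then digit z t else σ.bank k (pairing (pairing a b) t)) ∧
      τ.inp = rest.map inSym := by
  let Inv : List Bool → St → Prop := fun pre τ => τ.v 6 = pre.length ∧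
    τ.v 5 = inSym (decide (z < 0)) ∧ (∀ x, x < 3 ∨ 6 < x → τ.v x = σ.v x) ∧
    (∀ k', k' ≠ k → τ.bank k' = σ.bank k') ∧
    ∀ a b t : ℕ, τ.bank k (pairing (pairing a b) t) =
      if a = i ∧ b = j then (if z < 0 then -1 else 1) * ((pre[t]?.getD false).toNat : ℤ)
      else σ.bank k (pairing (pairing a b) t)
  have hset : ∀ {pre τ} x (y : ℤ), 2 < x → x < 5 → Inv pre τ → Inv pre (τ.setv x y) := by
    rintro pre τ x y hx hx' ⟨a, b, c, d⟩
    refine ⟨?_, ?_, fun y hy => ?_, d⟩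
    · rw [St.v_setv, if_neg (by omega), a]
    · rw [St.v_setv, if_neg (by omega), b]
    · rw [St.v_setv, if_neg (by omega), c y hy]
  set σ1 : St := { σ.setv 5 (σ.inp.headD 0) with inp := σ.inp.tail } with hσ1
  have hz5 : σ.inp.headD 0 = inSym (decide (z < 0)) := by
    rw [hin]; simp [CliqueInstance.encodeInt]
  have key := readBits_ev (full := z.natAbs.bits) (Inv := Inv) (T := 4)
    (body := .putBank k (.pair (.pair (.var 8) (.var 9)) (.var 6))
      (.mul (.sub (.var 4) (.lit 1)) (.sub (.lit 3) (.mul (.lit 2) (.var 5)))) ;; .inc 6 1)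
    (σ := σ1.setv 6 0) (rest := rest)
    (fun z h => hset 3 z (by norm_num) (by norm_num) h)
    (fun z h => hset 4 z (by norm_num) (by norm_num) h) (fun l h => h) ?_ ?_ ?_
  · obtain ⟨t, ht, τ, hev, hI, hr⟩ := key
    obtain ⟨a1, -, a3, a4, a5⟩ := hI
    have h7 : τ.v 7 = w := (a3 7 (by norm_num)).trans hw
    rw [length_bits] at a1 ht
    have hbank : ∀ a b t : ℕ, τ.bank k (pairing (pairing a b) t) =
        if a = i ∧ b = j then digit z t else σ.bank k (pairing (pairing a b) t) := a5
    by_cases hlt : w < z.natAbs.size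
    · refine ⟨_, ?_, τ.setv 7 (τ.v 6), .seq Ev.read (.seq (Ev.set (e := .lit 0)) (.seq hev
        (.iteT (by simp [a1, h7, hlt]) (Ev.set (e := .var 6))))), ?_, fun x hx => ?_, a4, hbank, hr⟩
      · simp only [Expr.eval_lit, Expr.eval_var, a1, Int.natAbs_natCast, Int.natAbs_zero]
        omega
      · simp only [St.v_setv, if_true, a1]
        rw [max_eq_right hlt.le]
      · rw [St.v_setv, if_neg (by omega), a3 x (by omega)]
    · refine ⟨_, ?_, τ, .seq Ev.read (.seq (Ev.set (e := .lit 0)) (.seq hev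
        (.iteF (by simp [a1, h7]; omega) .skip))), ?_, fun x hx => a3 x (by omega), a4, hbank, hr⟩
      · simp only [Expr.eval_lit, Int.natAbs_zero]
        omega
      · rw [h7, max_eq_left (by omega)]
  · rintro pre b τ - ⟨a1, a2, a3, a4, a5⟩ hb
    have h8 : τ.v 8 = i := (a3 8 (by norm_num)).trans hi
    have h9 : τ.v 9 = j := (a3 9 (by norm_num)).trans hj
    -- Bits are read as 1 and 2: the first factor is the digit, and the second one turns the sign
    -- symbol 2 or 1 into -1 or 1.
    have hval : (τ.v 4 - 1) * (3 - 2 * τ.v 5) = (if z < 0 then -1 else 1) * (b.toNat : ℤ) := by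
      rw [hb, a2]
      by_cases hz : z < 0 <;> cases b <;> simp [inSym, hz]
    refine ⟨_, ?_, _, .seq Ev.putBank Ev.inc, ⟨?_, ?_, fun x hx => ?_, fun k' hk' => ?_,
      fun a c t => ?_⟩, rfl⟩
    · simp only [Expr.eval_mul, Expr.eval_sub, Expr.eval_var, Expr.eval_lit, hval]
      by_cases hz : z < 0 <;> cases b <;> simp [hz]
    · simp [St.v_setv, a1]
    · simp [St.v_setv, a2]
    · rw [St.v_setv, if_neg (by omega), St.v_setBank, a3 x hx]
    · rw [St.bank_setv, ← a4 k' hk']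
      funext y
      rw [St.bank_setBank, if_neg (by tauto)]
    · simp only [St.bank_setv, St.bank_setBank, Expr.eval_pair, Expr.eval_var, pairing_inj, h8,
        h9, a1, Expr.eval_mul, Expr.eval_sub, Expr.eval_lit, hval, true_and, Nat.cast_inj, a5]
      by_cases hac : a = i ∧ c = j
      · simp only [hac, true_and, and_self, if_true]
        by_cases ht : t = pre.length
        · subst ht; simp
        · rw [if_neg ht]
          by_cases hlt : t < pre.length
          · rw [List.getElem?_append_left hlt]
          · rw [List.getElem?_eq_none (by omega), List.getElem?_eq_none (by simp; omega)]
      · rw [if_neg (by tauto), if_neg hac, if_neg hac]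
  · refine ⟨by simp [St.v_setv], by rw [← hz5]; simp [St.v_setv, hσ1], fun x hx => ?_, fun k' _ => rfl,
      fun a b t => ?_⟩
    · rw [St.v_setv, if_neg (by omega)]
      change (σ.setv 5 _).v x = _
      rw [St.v_setv, if_neg (by omega)]
    · change σ.bank k _ = _
      split
      · next h => rw [h.1, h.2, hz t]; simp
      · rfl
  · change σ.inp.tail = _
    rw [hin]
    simp [CliqueInstance.encodeInt, CliqueInstance.encodeNat]

/-- The invariant rule for `forLoop`. -/
theorem forLoop_ev {x : ℕ} {e : Expr} {p : Stmt} {N T : ℕ} {Inv : ℕ → St → Prop}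
    (hv : ∀ i σ, Inv i σ → σ.v x = i ∧ e.eval σ = N)
    (hstep : ∀ i σ, i < N → Inv i σ →
      ∃ t ≤ T, ∃ τ, Ev p σ t τ ∧ Inv (i + 1) (τ.setv x (τ.v x + 1)))
    {σ : St} (h0 : Inv 0 (σ.setv x 0)) :
    ∃ t ≤ N * (T + 3) + 2, ∃ τ, Ev (forLoop x e p) σ t τ ∧ Inv N τ := by
  have key : ∀ n i σ, i + n = N → Inv i σ → ∃ t ≤ n * (T + 3) + 1, ∃ τ,
      Ev (.loop (.sub e (.var x)) (p ;; .inc x 1)) σ t τ ∧ Inv N τ := by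
    intro n
    induction n with
    | zero =>
      intro i σ hi h
      obtain ⟨h1, h2⟩ := hv i σ h
      have : i = N := by omega
      subst this
      exact ⟨1, by simp, σ, .loopF (by simp [h1, h2]), h⟩
    | succ n ih =>
      intro i σ hi h
      obtain ⟨h1, h2⟩ := hv i σ h
      obtain ⟨t, ht, τ, hev, hI⟩ := hstep i σ (by omega) h
      obtain ⟨t', ht', ω, hev', hI'⟩ := ih (i + 1) _ (by omega) hI
      refine ⟨(t + (1 + 1)) + t' + 1, ?_, ω, .loopT ?_ (.seq hev Ev.inc) hev', hI'⟩
      · rw [add_mul]; omega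
      · simp only [Expr.eval_sub, Expr.eval_var, h1, h2]; omega
  obtain ⟨t, ht, τ, hev, hI⟩ := key N 0 _ (by omega) h0
  exact ⟨1 + t, by omega, τ, .seq (Ev.set (e := .lit 0)) hev, hI⟩

end While

/-! ### Instances indexed by natural numbers -/

namespace CliqueInstance

variable {N : ℕ}

/-- Adjacency of the vertices with numbers `a` and `c`. -/
def AdjN (I : CliqueInstance N) (a c : ℕ) : Prop :=
  ∃ (ha : a < N) (hc : c < N), I.graph.Adj ⟨a, ha⟩ ⟨c, hc⟩

/-- Weight of the pair of vertices with numbers `a` and `c`. -/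
def weightN (I : CliqueInstance N) (a c : ℕ) : ℤ :=
  if h : a < N ∧ c < N then I.weight s(⟨a, h.1⟩, ⟨c, h.2⟩) else 0

open Classical in
/-- Code of a matrix entry. -/
def entryCode (I : CliqueInstance N) (a c : ℕ) : List Bool :=
  if I.AdjN a c then true :: encodeInt (I.weightN a c) else [false]

theorem flatMap_finRange {α : Type*} (n : ℕ) (f : ℕ → List α) :
    ((List.finRange n).flatMap fun i : Fin n => f i) = (List.range n).flatMap f := by
  rw [← List.map_coe_finRange_eq_range, List.flatMap_map]

/-- Rows and columns become ranges of natural numbers, to match the loop counters of the parser. -/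
theorem encode_eq (I : CliqueInstance N) : I.encode = encodeNat N ++ (encodeInt I.bound ++
    (List.range N).flatMap fun a => (List.range N).flatMap fun c => I.entryCode a c) := by
  unfold encode
  rw [List.append_assoc]
  congr 2
  rw [← flatMap_finRange]
  refine congrArg (fun f => List.flatMap f (List.finRange N)) (funext fun i => ?_)
  rw [← flatMap_finRange]
  refine congrArg (fun f => List.flatMap f (List.finRange N)) (funext fun j => ?_)
  have : I.AdjN i j ↔ I.graph.Adj i j :=
    ⟨fun ⟨_, _, h⟩ => h, fun h => ⟨i.2, j.2, h⟩⟩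
  have hw : I.weightN i j = I.weight s(i, j) := by simp [weightN]
  rw [entryCode, hw]
  by_cases h : I.graph.Adj i j
  · rw [if_pos h, if_pos (this.2 h)]
  · rw [if_neg h, if_neg (mt this.1 h)]

end CliqueInstance

namespace While

open CliqueInstance

/-- The state after the threshold and the entries in `P` have been read. -/
structure Parsed (w : ℕ) {N : ℕ} (I : CliqueInstance N) (W : ℕ) (P : ℕ → ℕ → Prop) (σ : St) :
    Prop where
  out : σ.v 0 = 0
  size : σ.v 1 = N
  width : ∃ b : ℕ, σ.v 7 = b ∧ b ≤ W ∧ I.bound.natAbs.size ≤ b ∧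
    ∀ a c, P a c → I.AdjN a c → (I.weightN a c).natAbs.size ≤ b
  low : ∀ k ≤ w, ∀ z, σ.bank k z = 0
  digits : ∀ a c t : ℕ,
    (P a c ∧ I.AdjN a c → σ.bank (w + 1) (pairing (pairing a c) t) = digit (I.weightN a c) t) ∧
    (¬ (P a c ∧ I.AdjN a c) → σ.bank (w + 1) (pairing (pairing a c) t) = 0)
  adj : ∀ a c : ℕ, (P a c ∧ I.AdjN a c → σ.bank (w + 2) (pairing a c) = 1) ∧
    (¬ (P a c ∧ I.AdjN a c) → σ.bank (w + 2) (pairing a c) = 0)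
  bound : ∀ t : ℕ, σ.bank (w + 3) (pairing (pairing 0 0) t) = digit I.bound t

/-- The set of entries read matters on edges only, because a non-edge leaves nothing in memory.
Hence it may be changed freely at non-adjacent pairs, in particular outside the matrix. -/
theorem Parsed.congr {w : ℕ} {N : ℕ} {I : CliqueInstance N} {W : ℕ} {P P' : ℕ → ℕ → Prop} {σ : St}
    (h : Parsed w I W P σ) (hP : ∀ a c, I.AdjN a c → (P a c ↔ P' a c)) : Parsed w I W P' σ := by
  have e : ∀ a c, (P a c ∧ I.AdjN a c) = (P' a c ∧ I.AdjN a c) := fun a c =>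
    propext ⟨fun h => ⟨(hP a c h.2).1 h.1, h.2⟩, fun h => ⟨(hP a c h.2).2 h.1, h.2⟩⟩
  obtain ⟨h1, h2, ⟨b, b1, b2, b3, b4⟩, h4, h5, h6, h7⟩ := h
  refine ⟨h1, h2, ⟨b, b1, b2, b3, fun a c hp ha => b4 a c ((hP a c ha).2 hp) ha⟩, h4, ?_, ?_, h7⟩
  · intro a c t; rw [← e a c]; exact h5 a c t
  · intro a c; rw [← e a c]; exact h6 a c

theorem Parsed.setv {w : ℕ} {N : ℕ} {I : CliqueInstance N} {W : ℕ} {P : ℕ → ℕ → Prop} {σ : St}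
    (h : Parsed w I W P σ) (x : ℕ) (hx : x ≠ 0 ∧ x ≠ 1 ∧ x ≠ 7) (z : ℤ) :
    Parsed w I W P (σ.setv x z) := by
  obtain ⟨h1, h2, h3, h4, h5, h6, h7⟩ := h
  refine ⟨?_, ?_, ?_, h4, h5, h6, h7⟩
  · rw [St.v_setv, if_neg hx.1.symm, h1]
  · rw [St.v_setv, if_neg hx.2.1.symm, h2]
  · rw [St.v_setv, if_neg hx.2.2.symm]; exact h3

theorem Parsed.withInp {w : ℕ} {N : ℕ} {I : CliqueInstance N} {W : ℕ} {P : ℕ → ℕ → Prop} {σ : St}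
    (h : Parsed w I W P σ) (l : List ℤ) : Parsed w I W P { σ with inp := l } := by
  obtain ⟨h1, h2, h3, h4, h5, h6, h7⟩ := h
  exact ⟨h1, h2, h3, h4, h5, h6, h7⟩

/-- Read a matrix entry. -/
def readEntry (w : ℕ) : Stmt :=
  .read 3 ;; .ite (.sub (.var 3) (.lit 1))
    (.putBank (w + 2) (.pair (.var 8) (.var 9)) (.lit 1) ;; readInt (w + 1)) .skip

theorem readEntry_ev {w N : ℕ} {I : CliqueInstance N} {W : ℕ} {P : ℕ → ℕ → Prop} {σ : St} {i j : ℕ}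
    (hW : ∀ a c, I.AdjN a c → (I.weightN a c).natAbs.size ≤ W)
    (h : Parsed w I W P σ) (hi : σ.v 8 = i) (hj : σ.v 9 = j) (hP : ¬ P i j) {rest : List Bool}
    (hin : σ.inp = (I.entryCode i j ++ rest).map inSym) :
    ∃ t ≤ 14 * (W + 1), ∃ τ, Ev (readEntry w) σ t τ ∧
      Parsed w I W (fun a c => P a c ∨ (a = i ∧ c = j)) τ ∧ τ.v 8 = i ∧ τ.v 9 = j ∧
      τ.inp = rest.map inSym := by
  classical
  set σ1 : St := { σ.setv 3 (σ.inp.headD 0) with inp := σ.inp.tail } with hσ1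
  have h1 : Parsed w I W P σ1 := (h.setv 3 (by norm_num) _).withInp _
  have v8 : σ1.v 8 = i := by simp [hσ1, St.v_setv, hi]
  have v9 : σ1.v 9 = j := by simp [hσ1, St.v_setv, hj]
  by_cases ha : I.AdjN i j
  · rw [entryCode, if_pos ha] at hin
    have v3 : σ1.v 3 = 2 := by simp [hσ1, St.v_setv, hin, inSym]
    have hin1 : σ1.inp = (encodeInt (I.weightN i j) ++ rest).map inSym := by simp [hσ1, hin]
    set σ2 := σ1.setBank (w + 2) (pairing i j) 1 with hσ2
    obtain ⟨b, b1, b2, b3, b4⟩ := h1.width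
    have hz : ∀ t : ℕ, σ2.bank (w + 1) (pairing (pairing i j) t) = 0 := by
      intro t
      rw [hσ2, St.bank_setBank, if_neg (by omega)]
      exact (h1.digits i j t).2 (by tauto)
    obtain ⟨t, ht, τ, hev, g1, g2, g3, g4, g5⟩ := readInt_ev (w + 1) (I.weightN i j) (σ := σ2)
      v8 v9 b1 hz hin1
    have e2 : Ev (.putBank (w + 2) (.pair (.var 8) (.var 9)) (.lit 1)) σ1 ((1 : ℤ).natAbs + 1) σ2 := by
      have := Ev.putBank (k := w + 2) (a := .pair (.var 8) (.var 9)) (e := .lit 1) (σ := σ1)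
      simpa only [Expr.eval_pair, Expr.eval_var, Expr.eval_lit, v8, v9] using this
    refine ⟨_, ?_, τ, .seq Ev.read (.iteT (show 0 < σ1.v 3 - 1 by rw [v3]; norm_num) (.seq e2 hev)),
      ⟨?_, ?_, ?_, ?_, ?_, ?_, ?_⟩, ?_, ?_, g5⟩
    · have := hW i j ha
      simp only [Int.natAbs_one]
      omega
    · rw [g2 0 (by norm_num)]; exact h1.out
    · rw [g2 1 (by norm_num)]; exact h1.size
    · refine ⟨_, g1, max_le b2 (hW i j ha), b3.trans (le_max_left _ _), fun a c hp hac => ?_⟩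
      rcases hp with hp | ⟨rfl, rfl⟩
      · exact (b4 a c hp hac).trans (le_max_left _ _)
      · exact le_max_right _ _
    · intro k hk z
      rw [g3 k (by omega), hσ2, St.bank_setBank, if_neg (by omega), h1.low k hk]
    · intro a c t
      rw [g4]
      by_cases hac : a = i ∧ c = j
      · rw [if_pos hac]
        obtain ⟨rfl, rfl⟩ := hac
        exact ⟨fun _ => rfl, fun h => absurd ⟨Or.inr ⟨rfl, rfl⟩, ha⟩ h⟩
      · rw [if_neg hac, hσ2, St.bank_setBank, if_neg (by omega)]
        simpa only [hac, or_false] using h1.digits a c t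
    · intro a c
      rw [g3 _ (by omega), hσ2, St.bank_setBank]
      by_cases hac : a = i ∧ c = j
      · obtain ⟨rfl, rfl⟩ := hac
        rw [if_pos ⟨rfl, rfl⟩]
        exact ⟨fun _ => rfl, fun h => absurd ⟨Or.inr ⟨rfl, rfl⟩, ha⟩ h⟩
      · rw [if_neg (by rw [pairing_inj]; simpa using hac)]
        simpa only [hac, or_false] using h1.adj a c
    · intro t
      rw [g3 _ (by omega), hσ2, St.bank_setBank, if_neg (by omega), h1.bound]
    · rw [g2 8 (by norm_num)]; exact v8
    · rw [g2 9 (by norm_num)]; exact v9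
  · rw [entryCode, if_neg ha] at hin
    have v3 : σ1.v 3 = 1 := by simp [hσ1, St.v_setv, hin, inSym]
    refine ⟨_, ?_, σ1, .seq Ev.read (.iteF (show ¬ 0 < σ1.v 3 - 1 by rw [v3]; norm_num) .skip), h1.congr ?_, v8, v9, ?_⟩
    · omega
    · intro a c hac
      refine ⟨Or.inl, fun h => h.resolve_right ?_⟩
      rintro ⟨rfl, rfl⟩
      exact ha hac
    · simp [hσ1, hin]

/-- Read a weighted graph. -/
def readGraph (w : ℕ) : Stmt :=
  readNat ;; readInt (w + 3) ;; forLoop 8 (.var 1) (forLoop 9 (.var 1) (readEntry w))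

/-- Each of the N² entries is read at charge O(W + 1). Banks 0 to w remain blank for the tapes of
the machine to be simulated; the instance occupies the three banks after them. -/
theorem readGraph_ev (w : ℕ) {N : ℕ} (I : CliqueInstance N) (W : ℕ)
    (hW : ∀ a c, I.AdjN a c → (I.weightN a c).natAbs.size ≤ W)
    (hW' : I.bound.natAbs.size ≤ W) :
    ∃ t ≤ 60 * ((N + 1) ^ 2 * (W + 1)), ∃ τ,
      Ev (readGraph w) (St.zero (I.encode.map inSym)) t τ ∧
        Parsed w I W (fun _ _ => True) τ := by
  rw [encode_eq]
  set σ := St.zero ((encodeNat N ++ (encodeInt I.bound ++ (List.range N).flatMap fun a =>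
    (List.range N).flatMap fun c => I.entryCode a c)).map inSym) with hσ
  have hb0 : ∀ k z, σ.bank k z = 0 := fun _ _ => rfl
  obtain ⟨t1, ht1, σ1, e1, n1, n2, n3, n4⟩ := readNat_ev N (σ := σ) rfl rfl
  obtain ⟨t2, ht2, σ2, e2, i1, i2, i3, i4, i5⟩ := readInt_ev (w + 3) I.bound (σ := σ1) (i := 0)
    (j := 0) (w := 0) (by rw [n2 8 (by norm_num)]; rfl) (by rw [n2 9 (by norm_num)]; rfl)
    (by rw [n2 7 (by norm_num)]; rfl) (fun t => by rw [n3]; exact hb0 _ _) n4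
  rw [Nat.zero_max] at i1
  have p2 : Parsed w I W (fun _ _ => False) σ2 := by
    refine ⟨?_, ?_, ⟨_, i1, hW', le_rfl, fun _ _ h => h.elim⟩, fun k hk z => ?_, fun a c t => ?_,
      fun a c => ?_, fun t => ?_⟩
    · rw [i2 0 (by norm_num), n2 0 (by norm_num)]; rfl
    · rw [i2 1 (by norm_num), n1]
    · rw [i3 k (by omega), n3]; exact hb0 _ _
    · rw [i3 _ (by omega), n3]; exact ⟨fun h => h.1.elim, fun _ => hb0 _ _⟩
    · rw [i3 _ (by omega), n3]; exact ⟨fun h => h.1.elim, fun _ => hb0 _ _⟩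
    · simpa using i4 0 0 t
  set rows : ℕ → ℕ → List Bool := fun i n => (List.range' i n).flatMap fun a =>
    (List.range N).flatMap fun c => I.entryCode a c with hrows
  let Inv : ℕ → St → Prop := fun i τ => i ≤ N ∧ Parsed w I W (fun a _ => a < i) τ ∧ τ.v 8 = i ∧
    τ.inp = (rows i (N - i)).map inSym
  have step : ∀ i τ, i < N → Inv i τ → ∃ t ≤ N * (14 * (W + 1) + 3) + 2, ∃ τ',
      Ev (forLoop 9 (.var 1) (readEntry w)) τ t τ' ∧ Inv (i + 1) (τ'.setv 8 (τ'.v 8 + 1)) := by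
    rintro i τ hi ⟨-, hp, h8, hin⟩
    set rest := rows (i + 1) (N - (i + 1)) with hrest
    -- Entries are read in lexicographic order: all rows before i, and the first j entries of row i.
    let Inv' : ℕ → St → Prop := fun j τ => j ≤ N ∧
      Parsed w I W (fun a c => a < i ∨ (a = i ∧ c < j)) τ ∧ τ.v 8 = i ∧ τ.v 9 = j ∧
      τ.inp = (((List.range' j (N - j)).flatMap fun c => I.entryCode i c) ++ rest).map inSym
    obtain ⟨t, ht, τ', hev, -, hp', h8', h9', hin'⟩ := forLoop_ev (x := 9) (e := .var 1)
      (p := readEntry w) (N := N) (T := 14 * (W + 1)) (Inv := Inv') (σ := τ)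
      (fun j ω h => ⟨h.2.2.2.1, h.2.1.size⟩)
      (by
        rintro j ω hj ⟨-, q1, q2, q3, q4⟩
        have hsub : N - j = (N - (j + 1)) + 1 := by omega
        rw [hsub, List.range'_succ, List.flatMap_cons, List.append_assoc] at q4
        obtain ⟨t, ht, ω', hev, r1, r2, r3, r4⟩ := readEntry_ev hW q1 q2 q3 (by omega) q4
        refine ⟨t, ht, ω', hev, hj, (r1.setv 9 (by norm_num) _).congr ?_, ?_, ?_, r4⟩
        · intro a c _; omega
        · rw [St.v_setv, if_neg (by norm_num), r2]
        · rw [St.v_setv, if_pos rfl, r3]; push_cast; ring)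
      ⟨Nat.zero_le _, (hp.setv 9 (by norm_num) _).congr (by intro a c _; omega),
        by rw [St.v_setv, if_neg (by norm_num), h8], by rw [St.v_setv, if_pos rfl]; rfl, by
          have hsub : N - i = (N - (i + 1)) + 1 := by omega
          rw [hrows, hsub] at hin
          simp only [List.range'_succ, List.flatMap_cons] at hin
          rw [← List.range_eq_range', Nat.sub_zero]
          exact hin⟩
    refine ⟨t, ht, τ', hev, hi, (hp'.setv 8 (by norm_num) _).congr ?_, ?_, ?_⟩
    · rintro a c ⟨_, hc, _⟩; omega
    · rw [St.v_setv, if_pos rfl, h8']; push_cast; ring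
    · simpa using hin'
  obtain ⟨t3, ht3, σ3, e3, -, p3, -, -⟩ := forLoop_ev (x := 8) (e := .var 1) (N := N) (Inv := Inv)
    (σ := σ2) (fun i τ h => ⟨h.2.2.1, h.2.1.size⟩) step
    ⟨Nat.zero_le _, (p2.setv 8 (by norm_num) _).congr (by intro a c _; simp),
      by rw [St.v_setv, if_pos rfl]; rfl, by
        rw [hrows, Nat.sub_zero]; simp only [← List.range_eq_range']; exact i5⟩
  refine ⟨_, ?_, σ3, .seq e1 (.seq e2 e3), p3.congr ?_⟩
  · have h1 : t1 ≤ 20 * (N + 1) ^ 2 := by nlinarith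
    have h2 : t2 ≤ 10 * (W + 1) := by omega
    have h3 : t3 ≤ 24 * ((N + 1) ^ 2 * (W + 1)) - 6 * (W + 1) := by
      have : t3 + 6 * (W + 1) ≤ 24 * ((N + 1) ^ 2 * (W + 1)) := by
        nlinarith [Nat.zero_le (N * N * W), Nat.zero_le (N * W), Nat.zero_le (N * N)]
      omega
    have h4 : (N + 1) ^ 2 ≤ (N + 1) ^ 2 * (W + 1) := Nat.le_mul_of_pos_right _ (by omega)
    have h5 : W + 1 ≤ (N + 1) ^ 2 * (W + 1) := Nat.le_mul_of_pos_left _ (by positivity)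
    omega
  · rintro a c ⟨ha, -, -⟩; simp [ha]

/-- Compute `2 ^ (p * m)` in variable `10`, `2 ^ (s * m)` in variable `11` and `p * m` in variable
`12`, for the least `m` such that the first is at least the number of vertices. -/
def setup (p s : ℕ) : Stmt :=
  .set 10 (.lit 1) ;; .set 11 (.lit 1) ;; .set 12 (.lit 0) ;;
    .loop (.sub (.var 1) (.var 10)) (.set 10 (.mul (.var 10) (.lit (2 ^ p : ℕ))) ;;
      .set 11 (.mul (.var 11) (.lit (2 ^ s : ℕ))) ;; .inc 12 p)

/-- The value in variable 11 at least doubles in each round and dominates the one in variable 10, so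
the charges form a geometric sum of the order of the last term 2^(sm). Minimality of m gives
2^(p(m-1)) < N if m > 0, whence the upper bound on 2^(pm). -/
theorem setup_ev (p s : ℕ) (hp : 0 < p) (hps : p ≤ s) (N : ℕ) (σ : St) (hσ : σ.v 1 = N) :
    ∃ m t τ, N ≤ 2 ^ (p * m) ∧ 2 ^ (p * m) ≤ 2 ^ p * (N + 1) ∧ t ≤ (2 * p + 20) * 2 ^ (s * m) ∧
      Ev (setup p s) σ t τ ∧
      τ.v 10 = (2 ^ (p * m) : ℕ) ∧ τ.v 11 = (2 ^ (s * m) : ℕ) ∧ τ.v 12 = (p * m : ℕ) ∧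
      (∀ x < 10, τ.v x = σ.v x) ∧ τ.bank = σ.bank := by
  have hex : ∃ m, N ≤ 2 ^ (p * m) := ⟨N, (Nat.lt_two_pow_self).le.trans
    (Nat.pow_le_pow_right (by norm_num) (Nat.le_mul_of_pos_left _ hp))⟩
  classical
  set m := Nat.find hex with hm
  have hmin : ∀ j < m, 2 ^ (p * j) < N := fun j hj => not_le.1 (Nat.find_min hex hj)
  -- The geometric sum in telescoped form: (2p + 14)·2^(sj) serves as a potential that grows by at
  -- least the charge of a round.
  have key : ∀ (n j : ℕ) (τ : St), j + n = m → τ.v 1 = N → τ.v 10 = (2 ^ (p * j) : ℕ) →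
      τ.v 11 = (2 ^ (s * j) : ℕ) → τ.v 12 = (p * j : ℕ) → ∃ t ω,
      t + (2 * p + 14) * 2 ^ (s * j) ≤ (2 * p + 14) * 2 ^ (s * m) + 1 ∧
      Ev (.loop (.sub (.var 1) (.var 10)) (.set 10 (.mul (.var 10) (.lit (2 ^ p : ℕ))) ;;
        .set 11 (.mul (.var 11) (.lit (2 ^ s : ℕ))) ;; .inc 12 p)) τ t ω ∧
      ω.v 10 = (2 ^ (p * m) : ℕ) ∧ ω.v 11 = (2 ^ (s * m) : ℕ) ∧ ω.v 12 = (p * m : ℕ) ∧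
      (∀ x < 10, ω.v x = τ.v x) ∧ ω.bank = τ.bank := by
    intro n
    induction n with
    | zero =>
      intro j τ hj h1 h10 h11 h12
      have : j = m := by omega
      subst this
      refine ⟨1, τ, by omega, .loopF ?_, h10, h11, h12, fun _ _ => rfl, rfl⟩
      have := Nat.find_spec hex
      rw [← hm] at this
      simp only [Expr.eval_sub, Expr.eval_var, h1, h10]
      omega
    | succ n ih =>
      intro j τ hj h1 h10 h11 h12
      have hlt := hmin j (by omega)
      have m10 : τ.v 10 * (2 ^ p : ℕ) = (2 ^ (p * (j + 1)) : ℕ) := by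
        rw [h10, mul_add, pow_add]; push_cast; simp
      have m11 : τ.v 11 * (2 ^ s : ℕ) = (2 ^ (s * (j + 1)) : ℕ) := by
        rw [h11, mul_add, pow_add]; push_cast; simp
      set τ1 := τ.setv 10 (2 ^ (p * (j + 1)) : ℕ) with hτ1
      set τ2 := τ1.setv 11 (2 ^ (s * (j + 1)) : ℕ) with hτ2
      have e1 : Ev (.set 10 (.mul (.var 10) (.lit (2 ^ p : ℕ)))) τ (2 ^ (p * (j + 1)) + 1) τ1 := by
        have := Ev.set (x := 10) (e := .mul (.var 10) (.lit (2 ^ p : ℕ))) (σ := τ)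
        simp only [Expr.eval_mul, Expr.eval_var, Expr.eval_lit, m10, Int.natAbs_natCast] at this
        exact this
      have e2 : Ev (.set 11 (.mul (.var 11) (.lit (2 ^ s : ℕ)))) τ1 (2 ^ (s * (j + 1)) + 1) τ2 := by
        have := Ev.set (x := 11) (e := .mul (.var 11) (.lit (2 ^ s : ℕ))) (σ := τ1)
        have m11' : τ1.v 11 * (2 ^ s : ℕ) = (2 ^ (s * (j + 1)) : ℕ) := by
          rw [← m11, hτ1, St.v_setv, if_neg (by norm_num)]
        simp only [Expr.eval_mul, Expr.eval_var, Expr.eval_lit, m11', Int.natAbs_natCast] at this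
        exact this
      have e3 : Ev (.inc 12 p) τ2 ((p : ℤ).natAbs + 1) (τ2.setv 12 (τ2.v 12 + p)) := Ev.inc
      obtain ⟨t, ω, ht, hev, g1, g2, g3, g4, g5⟩ := ih (j + 1) (τ2.setv 12 (τ2.v 12 + p)) (by omega)
        (by simp [hτ2, hτ1, St.v_setv, h1]) (by simp [hτ2, hτ1, St.v_setv])
        (by simp [hτ2, hτ1, St.v_setv])
        (by simp only [hτ2, hτ1, St.v_setv]; norm_num [h12]; ring)
      refine ⟨_, ω, ?_, .loopT ?_ (.seq e1 (.seq e2 e3)) hev, g1, g2, g3, fun x hx => ?_, g5⟩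
      · have a1 : 2 ^ (p * (j + 1)) ≤ 2 ^ (s * (j + 1)) :=
          Nat.pow_le_pow_right (by norm_num) (Nat.mul_le_mul_right _ hps)
        have a2 : 2 * 2 ^ (s * j) ≤ 2 ^ (s * (j + 1)) := by
          rw [← pow_succ']
          exact Nat.pow_le_pow_right (by norm_num) (by rw [mul_add]; omega)
        have a3 : 1 ≤ 2 ^ (s * j) := Nat.one_le_two_pow
        rw [Int.natAbs_natCast]
        nlinarith [Nat.mul_le_mul_left p a3, Nat.mul_le_mul_left p a2]
      · simp only [Expr.eval_sub, Expr.eval_var, h1, h10]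
        omega
      · rw [g4 x hx]
        simp only [hτ2, hτ1, St.v_setv]
        rw [if_neg (by omega), if_neg (by omega), if_neg (by omega)]
  set σ3 := ((σ.setv 10 1).setv 11 1).setv 12 0 with hσ3
  obtain ⟨t, ω, ht, hev, g1, g2, g3, g4, g5⟩ := key m 0 σ3 (by omega)
    (by simp [hσ3, St.v_setv, hσ]) (by simp [hσ3, St.v_setv]) (by simp [hσ3, St.v_setv])
    (by simp [hσ3, St.v_setv])
  refine ⟨m, 2 + (2 + (1 + t)), ω, Nat.find_spec hex, ?_, ?_,
    .seq (Ev.set (e := .lit 1)) (.seq (Ev.set (e := .lit 1)) (.seq (Ev.set (e := .lit 0)) hev)),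
    g1, g2, g3, fun x hx => ?_, g5⟩
  · rcases Nat.eq_zero_or_pos m with h0 | hpos
    · rw [h0, mul_zero, pow_zero]
      exact Nat.mul_pos (by positivity) (by omega)
    · have := hmin (m - 1) (by omega)
      calc 2 ^ (p * m) = 2 ^ p * 2 ^ (p * (m - 1)) := by
            rw [← pow_add]; congr 1
            obtain ⟨k, hk⟩ := Nat.exists_eq_add_of_le' hpos
            rw [hk]; simp; ring
        _ ≤ 2 ^ p * (N + 1) := Nat.mul_le_mul_left _ (by omega)
  · have a3 : 1 ≤ 2 ^ (s * m) := Nat.one_le_two_pow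
    rw [mul_zero, pow_zero] at ht
    nlinarith
  · rw [g4 x hx]
    simp only [hσ3, St.v_setv]
    rw [if_neg (by omega), if_neg (by omega), if_neg (by omega)]

end While

set_option linter.unusedSectionVars false

/-! ## A real-time interpreter for command streams -/

namespace Interp

open OracleTM

/-- Control of the interpreter in its main phase. -/
@[ext] structure Ctl (Q g : ℕ) where
  cnt : Fin 32
  quota : Fin g
  mat : Bool
  d : ZMod Q
  car : ZMod Q
  ans : Bool

/-- States of the interpreter. -/
inductive State (Q R g : ℕ) where
  | start : State Q R g
  | pad (role : Bool) (c : Fin R) : State Q R g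
  | main (s : Ctl Q g) : State Q R g

variable {Q R g : ℕ}

instance [Fact (2 < Q)] : NeZero Q := ⟨by have := Fact.out (p := 2 < Q); omega⟩

instance [NeZero Q] : Finite (Ctl Q g) :=
  Finite.of_injective (fun s : Ctl Q g => (s.cnt, s.quota, s.mat, s.d, s.car, s.ans)) fun s t h => by
    simp only [Prod.mk.injEq] at h
    exact Ctl.ext h.1 h.2.1 h.2.2.1 h.2.2.2.1 h.2.2.2.2.1 h.2.2.2.2.2

instance [NeZero Q] : Finite (State Q R g) :=
  Finite.of_injective (β := Option ((Bool × Fin R) ⊕ Ctl Q g)) (fun s => match s with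
    | .start => none
    | .pad r c => some (.inl (r, c))
    | .main s => some (.inr s)) fun s t h => by
      cases s <;> cases t <;> simp_all

/-- The effect of a command on the control and on the three data tapes. -/
structure Effect (Q g : ℕ) where
  ctl : Ctl Q g
  wG : ZMod Q
  w1 : ZMod Q
  w2 : ZMod Q
  mG : Option Turing.Dir
  m1 : Option Turing.Dir
  m2 : Option Turing.Dir

/-- The commands other than the request for an oracle bit, for the scanned symbols `a`, `x`, `y`
of the data tapes. -/
def command (K : ZMod Q) (j : ℕ) (s : Ctl Q g) (a x y : ZMod Q) : Effect Q g :=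
  match j with
  | 1 => ⟨s, a, x, y, none, some .right, none⟩
  | 2 => ⟨s, a, x, y, none, some .left, none⟩
  | 3 => ⟨s, a, x, y, none, none, some .right⟩
  | 4 => ⟨s, a, x, y, none, none, some .left⟩
  | 5 => ⟨s, a, x, y, some .right, none, none⟩
  | 6 => ⟨s, a, x, y, some .left, none, none⟩
  -- One digit of a binary decrement, with `mat` as the borrow: a 1 absorbs the borrow, a 0 becomes
  -- 1 and passes it on. After all digits, `mat` says whether the counter was zero, that is, whether
  -- the current row is the guessed one.
  | 8 => if s.mat then
      if a = 1 then ⟨{ s with mat := false }, 0, x, y, none, none, none⟩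
      else ⟨s, 1, x, y, none, none, none⟩
    else ⟨s, a, x, y, none, none, none⟩
  | 9 => ⟨{ s with mat := true }, a, x, y, none, none, none⟩
  | 10 => ⟨{ s with d := 0 }, a, x, y, none, none, none⟩
  | 11 => ⟨{ s with d := 1 }, a, x, y, none, none, none⟩
  | 12 => ⟨{ s with d := -1 }, a, x, y, none, none, none⟩
  | 13 => ⟨{ s with d := K }, a, x, y, none, none, none⟩
  -- Commands 14 and 15 are the updates of the second and of the first data tape; both are disabled
  -- unless the row is the guessed one.
  | 14 => ⟨{ s with d := 0 }, a, x, if s.mat then y + (s.d + x) else y, none, none, none⟩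
  | 15 => ⟨{ s with d := 0 }, a, if s.mat then x + s.d else x, y, none, none, none⟩
  -- Commands 16 and 17 compute the sign of a sum: the carry is halved with rounding down, and a
  -- negative last carry leads to acceptance.
  | 16 => ⟨{ s with d := 0, car := ((s.car + s.d + x + y).valMinAbs / 2 : ℤ) }, a, x, y,
      none, none, none⟩
  | 17 => ⟨{ s with car := 0, ans := s.ans || decide (s.car.valMinAbs < 0) }, a, x, y,
      none, none, none⟩
  | _ => ⟨s, a, x, y, none, none, none⟩

/-- The symbol for an oracle bit on a data tape. -/
def bitSym (b : Bool) : ZMod Q := if b then 1 else 0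

/-- The transition table. Tape `0` is the input, tapes `1` and `2` hold unary counters, tape `3` a
stack of tokens, and tapes `4`, `5`, `6` the data. -/
def trans (K : ZMod Q) [NeZero R] [NeZero g] :
    State Q R g → (Fin 7 → ZMod Q) → TMMove 7 (ZMod Q) (State Q R g)
  | .start, v => .det ⟨.pad false 0, ![v 0, 1, 1, 1, v 4, v 5, v 6],
      ![none, some .right, none, none, none, none, none]⟩
  | .pad r c, v =>
    if v 0 = 2 then .det ⟨.main ⟨1, 0, false, 0, 0, false⟩, v,
      ![some .right, none, none, none, none, none, none]⟩
    else if v 0 = 1 then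
      -- In the padding phase one unary counter is emptied while the other receives R units for each
      -- unit removed. When the source reaches its marker, a token is added and the counters
      -- exchange roles; the next round therefore takes R times as long.
      if (if r then v 2 else v 1) = 1 then
        .det ⟨.pad (!r) 0, v, ![some .right, none, none, some .right, none, none, none]⟩
      else if h : (c : ℕ) + 1 < R then
        .det ⟨.pad r ⟨c + 1, h⟩, v, ![some .right, if r then some .right else none,
          if r then none else some .right, none, none, none, none]⟩
      else
        .det ⟨.pad r 0, v, ![some .right, if r then some .right else some .left,
          if r then some .left else some .right, none, none, none, none]⟩
    else .halt false
  | .main s, v =>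
    if v 0 = 2 then .det ⟨.main { s with cnt := s.cnt + 1 }, v,
      ![some .right, none, none, none, none, none, none]⟩
    else if v 0 = 1 then
      if (s.cnt : ℕ) = 7 then
        if 0 < (s.quota : ℕ) then
          .guess fun y => ⟨.main { s with cnt := 0, quota := ⟨s.quota - 1, by omega⟩ },
            ![v 0, v 1, v 2, v 3, bitSym y, v 5, v 6],
            ![some .right, none, none, none, none, none, none]⟩
        else if v 3 = 1 then .det ⟨.main { s with cnt := 0 }, v,
          ![some .right, none, none, none, none, none, none]⟩
        else
          .guess fun y => ⟨.main { s with cnt := 0, quota := ⟨g - 1, Nat.sub_one_lt (NeZero.ne g)⟩ },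
            ![v 0, v 1, v 2, v 3, bitSym y, v 5, v 6],
            ![some .right, none, none, some .left, none, none, none]⟩
      else
        let e := command K s.cnt { s with cnt := 0 } (v 4) (v 5) (v 6)
        .det ⟨.main e.ctl, ![v 0, v 1, v 2, v 3, e.wG, e.w1, e.w2],
          ![some .right, none, none, none, e.mG, e.m1, e.m2]⟩
    else .halt s.ans

variable [Fact (2 < Q)]

theorem one_ne_zero' : (1 : ZMod Q) ≠ 0 := by
  have h : 2 < Q := Fact.out
  have : ((1 : ℕ) : ZMod Q) ≠ 0 := by
    rw [Ne, ZMod.natCast_eq_zero_iff]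
    exact fun h' => by have := Nat.le_of_dvd (by norm_num) h'; omega
  simpa using this

theorem two_ne_zero' : (2 : ZMod Q) ≠ 0 := by
  have h : 2 < Q := Fact.out
  have : ((2 : ℕ) : ZMod Q) ≠ 0 := by
    rw [Ne, ZMod.natCast_eq_zero_iff]
    exact fun h' => by have := Nat.le_of_dvd (by norm_num) h'; omega
  simpa using this

theorem one_ne_two : (1 : ZMod Q) ≠ 2 := fun h => by
  have : (2 : ZMod Q) - 1 = 0 := by rw [← h]; ring
  exact one_ne_zero' (Q := Q) (by rw [← this]; ring)

/-- The interpreter. -/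
abbrev machine (Q R g : ℕ) (K : ZMod Q) [Fact (2 < Q)] [NeZero R] [NeZero g] : OracleTM where
  workTapes := 6
  Γ := ZMod Q
  Λ := State Q R g
  blank := ⟨0⟩
  sym b := if b then 2 else 1
  sym_injective a b h := by
    cases a <;> cases b <;> simp_all [one_ne_two, one_ne_two.symm]
  sym_ne_blank b := by
    cases b
    · exact one_ne_zero'
    · exact two_ne_zero'
  start := .start
  trans := trans K

/-- A tape with an absolute head position. -/
@[ext] structure Tp (Q : ℕ) where
  pos : ℤ
  cell : ℤ → ZMod Q

def Tp.head (T : Tp Q) : ZMod Q := T.cell T.pos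

def Tp.act (T : Tp Q) (w : ZMod Q) (m : Option Turing.Dir) : Tp Q :=
  ⟨T.pos + shift m, Function.update T.cell T.pos w⟩

/-- The relevant part of a configuration in the main phase; `used` counts oracle bits. -/
@[ext] structure ICfg (Q g : ℕ) where
  ctl : Ctl Q g
  tok : ℕ
  used : ℕ
  G : Tp Q
  S1 : Tp Q
  S2 : Tp Q

namespace ICfg

variable (K : ZMod Q) (ω : ℕ → Bool)

/-- Execution of a command, with the oracle bits taken from `ω`. -/
def exec (I : ICfg Q g) (j : ℕ) : ICfg Q g :=
  if j = 7 then
    if 0 < (I.ctl.quota : ℕ) then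
      { I with
        ctl := { I.ctl with quota := ⟨I.ctl.quota - 1, by omega⟩ }
        used := I.used + 1
        G := I.G.act (bitSym (ω I.used)) none }
    else if I.tok = 0 then I
    else
      { I with
        ctl := { I.ctl with quota := ⟨g - 1, Nat.sub_one_lt_of_lt I.ctl.quota.2⟩ }
        tok := I.tok - 1
        used := I.used + 1
        G := I.G.act (bitSym (ω I.used)) none }
  else
    let e := command K j I.ctl I.G.head I.S1.head I.S2.head
    { I with
      ctl := e.ctl
      G := I.G.act e.wG e.mG
      S1 := I.S1.act e.w1 e.m1
      S2 := I.S2.act e.w2 e.m2 }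

/-- Processing of one input bit. -/
def bstep (I : ICfg Q g) (b : Bool) : ICfg Q g :=
  if b then { I with ctl := { I.ctl with cnt := I.ctl.cnt + 1 } }
  else exec K ω { I with ctl := { I.ctl with cnt := 0 } } I.ctl.cnt

/-- The initial configuration of the main phase. -/
def initial (Q g : ℕ) [NeZero g] (j : ℕ) : ICfg Q g :=
  ⟨⟨0, 0, false, 0, 0, false⟩, j, 0, ⟨0, 0⟩, ⟨0, 0⟩, ⟨0, 0⟩⟩

/-- The number of oracle bits that may still be used. -/
def budget (I : ICfg Q g) : ℕ := I.ctl.quota + g * I.tok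

theorem command_quota (j : ℕ) (s : Ctl Q g) (a x y : ZMod Q) :
    (command K j s a x y).ctl.quota = s.quota := by
  unfold command
  split <;> (try split) <;> (try split) <;> rfl

/-- Conservation of oracle bits: a request uses up one unit of the quota, or breaks a token into one
bit used and a quota of g - 1, or is ignored when nothing is left. -/
theorem exec_budget (I : ICfg Q g) (j : ℕ) :
    (I.exec K ω j).used + (I.exec K ω j).budget = I.used + I.budget ∧ I.used ≤ (I.exec K ω j).used := by
  unfold exec budget
  by_cases h1 : j = 7
  · rw [if_pos h1]
    by_cases h2 : 0 < (I.ctl.quota : ℕ)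
    · rw [if_pos h2]
      dsimp only
      omega
    · rw [if_neg h2]
      by_cases h3 : I.tok = 0
      · rw [if_pos h3]
        exact ⟨rfl, le_rfl⟩
      · rw [if_neg h3]
        have := I.ctl.quota.2
        have e : g * I.tok = g * (I.tok - 1) + g := by
          conv_lhs => rw [show I.tok = I.tok - 1 + 1 by omega]
          ring
        dsimp only
        omega
  · rw [if_neg h1]
    simp [command_quota]

theorem bstep_budget (I : ICfg Q g) (b : Bool) :
    (I.bstep K ω b).used + (I.bstep K ω b).budget = I.used + I.budget ∧ I.used ≤ (I.bstep K ω b).used := by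
  unfold bstep
  split_ifs
  · exact ⟨rfl, le_rfl⟩
  · exact exec_budget K ω { I with ctl := { I.ctl with cnt := 0 } } _

theorem foldl_bstep_budget (l : List Bool) : ∀ I : ICfg Q g,
    (l.foldl (bstep K ω) I).used + (l.foldl (bstep K ω) I).budget = I.used + I.budget ∧
      I.used ≤ (l.foldl (bstep K ω) I).used := by
  induction l with
  | nil => exact fun I => ⟨rfl, le_rfl⟩
  | cons b l ih =>
    intro I
    have h1 := ih (I.bstep K ω b)
    have h2 := bstep_budget K ω I b
    rw [List.foldl_cons]
    omega

end ICfg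

variable [NeZero R] [NeZero g] {K : ZMod Q}

/-- The configuration `c` of the machine, which has read `i` symbols of `x`, is described by `I`. -/
structure Rep (x : List Bool) (i : ℕ) (c : FCfg (machine Q R g K)) (I : ICfg Q g) : Prop where
  state : c.state = .main I.ctl
  pos0 : c.pos 0 = i
  cont0 : c.cont 0 = wordTape (machine Q R g K) x
  pos3 : c.pos 3 = I.tok
  cont3 : c.cont 3 = fun z => if z = 0 then 1 else 0
  pos4 : c.pos 4 = I.G.pos
  cont4 : c.cont 4 = I.G.cell
  pos5 : c.pos 5 = I.S1.pos
  cont5 : c.cont 5 = I.S1.cell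
  pos6 : c.pos 6 = I.S2.pos
  cont6 : c.cont 6 = I.S2.cell

theorem wordTape_drop {x l : List Bool} {i : ℕ} (h : x.drop i = l) :
    wordTape (machine Q R g K) x i =
      (l.head?.map fun b => (if b then 2 else 1 : ZMod Q)).getD 0 := by
  have e : x[i]? = l.head? := by rw [← h, List.head?_drop]
  unfold wordTape
  rw [if_pos (by positivity), Int.toNat_natCast, e]
  rfl

/-- The machine makes exactly one step per input symbol, and the oracle bits it receives form the
segment of ω between the initial and the final value of `used`. -/
theorem main_run (ω : ℕ → Bool) (x : List Bool) : ∀ (l : List Bool) (i : ℕ)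
    (c : FCfg (machine Q R g K)) (I : ICfg Q g), x.drop i = l → Rep x i c I →
    FRun c ((List.range' I.used ((l.foldl (ICfg.bstep K ω) I).used - I.used)).map ω) l.length
      (l.foldl (ICfg.bstep K ω) I).ctl.ans := by
  intro l
  induction l with
  | nil =>
    intro i c I hl hc
    have h0 := wordTape_drop (K := K) (R := R) (g := g) hl
    simp only [List.foldl_nil, Nat.sub_self, List.range'_zero, List.map_nil, List.length_nil]
    refine .halt ?_
    change trans K c.state (fun i => c.cont i (c.pos i)) = _
    rw [hc.state]
    simp [trans, hc.pos0, hc.cont0, h0, two_ne_zero'.symm, one_ne_zero'.symm]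
  | cons b l ih =>
    intro i c I hl hc
    have hl' : x.drop (i + 1) = l := by rw [← List.drop_drop, hl]; rfl
    have h0 := wordTape_drop (K := K) (R := R) (g := g) hl
    set v : Fin 7 → ZMod Q := fun i => c.cont i (c.pos i) with hv
    have hcur : c.current = trans K (.main I.ctl) v := by
      rw [← hc.state]; rfl
    have v0 : v 0 = if b then 2 else 1 := by
      simp only [hv, hc.pos0, hc.cont0, h0]
      rfl
    have v3 : v 3 = if I.tok = 0 then 1 else 0 := by simp [hv, hc.pos3, hc.cont3]
    have v4 : v 4 = I.G.head := by simp [hv, hc.pos4, hc.cont4, Tp.head]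
    have v5 : v 5 = I.S1.head := by simp [hv, hc.pos5, hc.cont5, Tp.head]
    have v6 : v 6 = I.S2.head := by simp [hv, hc.pos6, hc.cont6, Tp.head]
    rw [List.foldl_cons]
    have same : ∀ a, c.current = .det a → (I.bstep K ω b).used = I.used →
        Rep x (i + 1) (c.act a) (I.bstep K ω b) →
        FRun c ((List.range' I.used ((l.foldl (ICfg.bstep K ω) (I.bstep K ω b)).used - I.used)).map ω)
          (b :: l).length (l.foldl (ICfg.bstep K ω) (I.bstep K ω b)).ctl.ans := by
      intro a ha hu hr
      have := ih (i + 1) (c.act a) _ hl' hr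
      rw [hu] at this
      exact .det ha this
    have ask : ∀ a, c.current = .guess a → (I.bstep K ω b).used = I.used + 1 →
        Rep x (i + 1) (c.act (a (ω I.used))) (I.bstep K ω b) →
        FRun c ((List.range' I.used ((l.foldl (ICfg.bstep K ω) (I.bstep K ω b)).used - I.used)).map ω)
          (b :: l).length (l.foldl (ICfg.bstep K ω) (I.bstep K ω b)).ctl.ans := by
      intro a ha hu hr
      have h1 := ih (i + 1) _ _ hl' hr
      have h2 := (ICfg.foldl_bstep_budget K ω l (I.bstep K ω b)).2
      rw [show (l.foldl (ICfg.bstep K ω) (I.bstep K ω b)).used - I.used =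
        (l.foldl (ICfg.bstep K ω) (I.bstep K ω b)).used - (I.bstep K ω b).used + 1 by omega,
        List.range'_succ, List.map_cons]
      rw [hu] at h1 ⊢
      exact .guess _ ha h1
    -- the shape of every successor configuration
    have succ : ∀ (s : Ctl Q g) (w4 w5 w6 : ZMod Q) (m3 m4 m5 m6 : Option Turing.Dir) (I' : ICfg Q g),
        I'.ctl = s → (I'.tok : ℤ) = I.tok + shift m3 → I'.G = I.G.act w4 m4 →
        I'.S1 = I.S1.act w5 m5 → I'.S2 = I.S2.act w6 m6 →
        Rep x (i + 1) (c.act ⟨.main s, ![v 0, v 1, v 2, v 3, w4, w5, w6],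
          ![some .right, none, none, m3, m4, m5, m6]⟩) I' := by
      rintro s w4 w5 w6 m3 m4 m5 m6 I' rfl htok hG h1 h2
      constructor
      · rfl
      · simp [FCfg.act, shift, hc.pos0]
      · simp [FCfg.act, hv, hc.cont0]
      · simp [FCfg.act, htok, hc.pos3]
      · simp [FCfg.act, hv, hc.cont3]
      · simp [FCfg.act, hG, Tp.act, hc.pos4]
      · simp [FCfg.act, hG, Tp.act, hc.pos4, hc.cont4]
      · simp [FCfg.act, h1, Tp.act, hc.pos5]
      · simp [FCfg.act, h1, Tp.act, hc.pos5, hc.cont5]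
      · simp [FCfg.act, h2, Tp.act, hc.pos6]
      · simp [FCfg.act, h2, Tp.act, hc.pos6, hc.cont6]
    have hself : v = ![v 0, v 1, v 2, v 3, v 4, v 5, v 6] := by
      funext i
      fin_cases i <;> rfl
    have idle : ∀ T : Tp Q, T = T.act T.head none := fun T => by
      simp [Tp.act, Tp.head, shift]
    have hn12 : (1 : ZMod Q) ≠ 2 := one_ne_two
    cases b with
    | true =>
      rw [if_pos rfl] at v0
      refine same ⟨.main { I.ctl with cnt := I.ctl.cnt + 1 }, ![v 0, v 1, v 2, v 3, v 4, v 5, v 6],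
        ![some .right, none, none, none, none, none, none]⟩ (hcur.trans ?_) rfl ?_
      · rw [← hself]
        simp only [trans, v0, if_pos]
      · rw [v4, v5, v6]
        exact succ _ _ _ _ _ _ _ _ _ rfl (by simp [ICfg.bstep, shift]) (idle _) (idle _) (idle _)
    | false =>
      rw [if_neg (by simp)] at v0
      have hb : I.bstep K ω false =
        ICfg.exec K ω { I with ctl := { I.ctl with cnt := 0 } } I.ctl.cnt := rfl
      have hcur' := hcur
      rw [trans.eq_3, if_neg (by rw [v0]; exact hn12), if_pos v0] at hcur'
      by_cases h1 : (I.ctl.cnt : ℕ) = 7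
      · rw [if_pos h1] at hcur'
        by_cases h2 : 0 < (I.ctl.quota : ℕ)
        · rw [if_pos h2] at hcur'
          rw [ICfg.exec, if_pos h1, if_pos h2] at hb
          refine ask _ hcur' (by rw [hb]) ?_
          rw [hb, v5, v6]
          exact succ _ _ _ _ _ _ _ _ _ rfl (by simp [shift]) rfl (idle _) (idle _)
        · rw [if_neg h2] at hcur'
          by_cases h3 : I.tok = 0
          · rw [if_pos h3] at v3
            rw [if_pos v3] at hcur'
            rw [ICfg.exec, if_pos h1, if_neg h2, if_pos h3] at hb
            refine same _ hcur' (by rw [hb]) ?_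
            rw [hb, hself, v4, v5, v6]
            exact succ _ _ _ _ _ _ _ _ _ rfl (by simp [shift]) (idle _) (idle _) (idle _)
          · rw [if_neg h3] at v3
            rw [if_neg (by rw [v3]; exact one_ne_zero'.symm)] at hcur'
            rw [ICfg.exec, if_pos h1, if_neg h2, if_neg h3] at hb
            refine ask _ hcur' (by rw [hb]) ?_
            rw [hb, v5, v6]
            exact succ _ _ _ _ _ _ _ _ _ rfl (by simp [shift]; omega) rfl (idle _) (idle _)
      · rw [if_neg h1, v4, v5, v6] at hcur'
        rw [ICfg.exec, if_neg h1] at hb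
        refine same _ hcur' (by rw [hb]) ?_
        rw [hb]
        exact succ _ _ _ _ _ _ _ _ _ rfl (by simp [shift]) rfl rfl rfl

end Interp

/-! ### The padding phase and the language of the interpreter -/

namespace Interp

open OracleTM

variable {Q R g : ℕ} [Fact (2 < Q)] [NeZero R] [NeZero g] {K : ZMod Q}

/-- The number of leading zeros after which the interpreter has `j` tokens. -/
def padTime (R : ℕ) : ℕ → ℕ
  | 0 => 0
  | j + 1 => padTime R j + R ^ (j + 1) + 1

theorem padTime_strictMono (R : ℕ) : StrictMono (padTime R) :=
  strictMono_nat_of_lt_succ fun j => by rw [padTime]; omega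

theorem pow_le_padTime (R j : ℕ) (hj : 0 < j) : R ^ j ≤ padTime R j := by
  cases j with
  | zero => omega
  | succ j => rw [padTime]; omega

/-- A geometric sum; it shows that 3·R^j leading zeros yield j tokens. The constant 3 in the length
of the padding comes from here. -/
theorem padTime_le (R j : ℕ) (hR : 2 ≤ R) : padTime R j + 3 ≤ 3 * R ^ j := by
  induction j with
  | zero => simp [padTime]
  | succ j ih =>
    have h1 : 1 ≤ R ^ j := Nat.one_le_pow _ _ (by omega)
    have h2 : 2 * R ^ j ≤ R ^ (j + 1) := by rw [pow_succ, mul_comm]; gcongr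
    rw [padTime]
    omega

def marker : ℤ → ZMod Q := fun z => if z = 0 then 1 else 0

/-- The configuration `c` in the padding phase; `a` and `e` are the contents of the counters. -/
structure PadRep (x : List Bool) (i : ℕ) (c : FCfg (machine Q R g K)) (r : Bool) (k : Fin R)
    (a e j : ℕ) : Prop where
  state : c.state = .pad r k
  pos0 : c.pos 0 = i
  cont0 : c.cont 0 = wordTape (machine Q R g K) x
  posA : c.pos (1 : Fin 7) = if r then ((R * e + k : ℕ) : ℤ) else a
  posB : c.pos (2 : Fin 7) = if r then (a : ℤ) else ((R * e + k : ℕ) : ℤ)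
  contA : c.cont (1 : Fin 7) = marker
  contB : c.cont (2 : Fin 7) = marker
  pos3 : c.pos 3 = j
  cont3 : c.cont 3 = marker
  pos4 : c.pos 4 = 0
  cont4 : c.cont 4 = 0
  pos5 : c.pos 5 = 0
  cont5 : c.cont 5 = 0
  pos6 : c.pos 6 = 0
  cont6 : c.cont 6 = 0
  sum : a + e = R ^ j
  last : a = 0 → (k : ℕ) = 0
  time : i = padTime R j + R * e + k

/-- Within a round at most R(a + e) = R^(j+1) units are moved, so the time is still below `padTime R
(j + 1)`; the field `last` is needed when the source is empty. -/
theorem PadRep.reach {x : List Bool} {i : ℕ} {c : FCfg (machine Q R g K)} {r : Bool} {k : Fin R}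
    {a e j : ℕ} (hc : PadRep x i c r k a e j) (j₀ : ℕ) (hj : padTime R j₀ ≤ i) : j₀ ≤ j := by
  by_contra hlt
  have h1 := (padTime_strictMono R).monotone (show j + 1 ≤ j₀ by omega)
  rw [padTime, pow_succ, ← hc.sum, add_mul] at h1
  have h2 := hc.time
  have h4 := k.2
  have h5 : R * e = e * R := mul_comm _ _
  rcases Nat.eq_zero_or_pos a with h | h
  · have := hc.last h
    omega
  · have : R ≤ a * R := Nat.le_mul_of_pos_left R h
    omega

/-- A zero read in the initial control state is the idle command 0. The padding may thus be regarded
as part of the command stream. -/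
theorem bstep_initial_false (ω : ℕ → Bool) (j : ℕ) :
    (ICfg.initial Q g j).bstep K ω false = ICfg.initial Q g j := by
  simp [ICfg.bstep, ICfg.initial, ICfg.exec, command, Tp.act, Tp.head, shift]

/-- Here j' is the number of tokens when the padding ends. As the zeros read so far act as idle
commands, the outcome is that of the main phase on the whole remaining input, with j' tokens
available from the outset. If no 1 ever appears, the machine rejects, in accordance with the initial
answer. -/
theorem pad_run (ω : ℕ → Bool) (x : List Bool) : ∀ (l : List Bool) (i : ℕ)
    (c : FCfg (machine Q R g K)) (r : Bool) (k : Fin R) (a e j : ℕ), x.drop i = l →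
    i + l.length = x.length → PadRep x i c r k a e j →
    ∃ j', padTime R j' ≤ x.length ∧
      (∀ F x', l = List.replicate F false ++ x' → ∀ j₀, padTime R j₀ ≤ i + F → j₀ ≤ j') ∧
      FRun c ((List.range' 0 (l.foldl (ICfg.bstep K ω) (ICfg.initial Q g j')).used).map ω) l.length
        (l.foldl (ICfg.bstep K ω) (ICfg.initial Q g j')).ctl.ans := by
  intro l
  induction l with
  | nil =>
    intro i c r k a e j hl hlen hc
    have h0 := wordTape_drop (K := K) (R := R) (g := g) hl
    refine ⟨j, ?_, fun F x' hF j₀ hj => hc.reach j₀ ?_, ?_⟩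
    · have := hc.time; simp at hlen; omega
    · have : F = 0 := by
        have := congrArg List.length hF
        simp at this; omega
      omega
    · refine .halt ?_
      change trans K c.state (fun i => c.cont i (c.pos i)) = _
      rw [hc.state]
      simp [trans, hc.pos0, hc.cont0, h0, two_ne_zero'.symm, one_ne_zero'.symm, ICfg.initial]
  | cons b l ih =>
    intro i c r k a e j hl hlen hc
    have hl' : x.drop (i + 1) = l := by rw [← List.drop_drop, hl]; rfl
    have h0 := wordTape_drop (K := K) (R := R) (g := g) hl
    set v : Fin 7 → ZMod Q := fun i => c.cont i (c.pos i) with hv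
    have hcur : c.current = trans K (.pad r k) v := by
      rw [← hc.state]; rfl
    have v0 : v 0 = if b then 2 else 1 := by
      simp only [hv, hc.pos0, hc.cont0, h0]
      rfl
    have hn12 : (1 : ZMod Q) ≠ 2 := one_ne_two
    have hkR := k.2
    cases b with
    | true =>
      rw [if_pos rfl] at v0
      rw [trans.eq_2, if_pos v0] at hcur
      refine ⟨j, ?_, fun F x' hF j₀ hj => hc.reach j₀ ?_, ?_⟩
      · have := hc.time; omega
      · cases F with
        | zero => simpa using hj
        | succ F => simp [List.replicate_succ] at hF
      · rw [List.foldl_cons]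
        have hr : Rep x (i + 1) (c.act ⟨.main ⟨1, 0, false, 0, 0, false⟩, v,
            ![some .right, none, none, none, none, none, none]⟩)
            ((ICfg.initial Q g j).bstep K ω true) := by
          constructor
          · rfl
          all_goals simp [FCfg.act, shift, hv, hc.pos0, hc.cont0, hc.pos3, hc.cont3, hc.pos4,
            hc.cont4, hc.pos5, hc.cont5, hc.pos6, hc.cont6, ICfg.bstep, ICfg.initial]
          all_goals rfl
        have := main_run ω x l (i + 1) _ _ hl' hr
        exact .det hcur this
    | false =>
      rw [if_neg (by simp)] at v0
      have hgo : ∀ a', c.current = .det a' → ∀ r' k' a₁ e' j', PadRep x (i + 1) (c.act a') r' k' a₁ e' j' →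
          ∃ j', padTime R j' ≤ x.length ∧
          (∀ F x', false :: l = List.replicate F false ++ x' → ∀ j₀, padTime R j₀ ≤ i + F → j₀ ≤ j') ∧
          FRun c ((List.range' 0 ((false :: l).foldl (ICfg.bstep K ω) (ICfg.initial Q g j')).used).map ω)
            (false :: l).length
            ((false :: l).foldl (ICfg.bstep K ω) (ICfg.initial Q g j')).ctl.ans := by
        intro a' ha r' k' a₁ e' j' hr
        obtain ⟨j'', g1, g2, g3⟩ := ih (i + 1) _ r' k' a₁ e' j' hl'
          (by rw [← hlen, List.length_cons]; omega) hr
        refine ⟨j'', g1, fun F x' hF j₀ hj => ?_, ?_⟩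
        · cases F with
          | zero => exact g2 0 l (by simp) j₀ (by omega)
          | succ F =>
            rw [List.replicate_succ, List.cons_append] at hF
            injection hF with _ hF
            exact g2 F x' hF j₀ (by omega)
        · rw [List.foldl_cons, bstep_initial_false]
          exact .det ha g3
      rw [trans.eq_2, if_neg (by rw [v0]; exact hn12), if_pos v0] at hcur
      have hsrc : (if r then v 2 else v 1) = if a = 0 then 1 else 0 := by
        cases r <;> simp [hv, hc.posA, hc.posB, hc.contA, hc.contB, marker]
      have htime := hc.time
      rw [hsrc] at hcur
      by_cases ha : a = 0
      · rw [if_pos ha, if_pos rfl] at hcur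
        refine hgo _ hcur (!r) 0 (R ^ (j + 1)) 0 (j + 1) ?_
        have hk := hc.last ha
        have hs := hc.sum
        have hd : R * e + k = R ^ (j + 1) := by rw [hk, pow_succ, ← hs, ha]; ring
        constructor
        · rfl
        case sum => simp
        case last => simp
        case time => simp only [padTime]; rw [htime, add_assoc _ _ (k : ℕ), hd]; simp
        case posA => 
          have := hc.posA
          cases r <;> simp [FCfg.act, shift, this, ha]
          exact_mod_cast hd
        case posB =>
          have := hc.posB
          cases r <;> simp [FCfg.act, shift, this, ha]
          exact_mod_cast hd
        all_goals simp [FCfg.act, shift, hv, hc.pos0, hc.cont0, hc.pos3, hc.cont3, hc.pos4,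
            hc.cont4, hc.pos5, hc.cont5, hc.pos6, hc.cont6, hc.contA, hc.contB]
      · rw [if_neg ha, if_neg one_ne_zero'.symm] at hcur
        by_cases hk : (k : ℕ) + 1 < R
        · rw [dif_pos hk] at hcur
          refine hgo _ hcur r ⟨k + 1, hk⟩ a e j ?_
          constructor
          · rfl
          case sum => exact hc.sum
          case last => exact fun h => absurd h ha
          case time => simp only; omega
          case posA =>
            have := hc.posA
            cases r <;> simp [FCfg.act, shift, this]
            ring
          case posB =>
            have := hc.posB
            cases r <;> simp [FCfg.act, shift, this]
            ring
          all_goals simp [FCfg.act, shift, hv, hc.pos0, hc.cont0, hc.pos3, hc.cont3, hc.pos4,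
            hc.cont4, hc.pos5, hc.cont5, hc.pos6, hc.cont6, hc.contA, hc.contB]
        · rw [dif_neg hk] at hcur
          have hk' : (k : ℕ) + 1 = R := by omega
          have hR : R * (e + 1) + ((0 : Fin R) : ℕ) = R * e + k + 1 := by
            simp; rw [mul_add]; omega
          refine hgo _ hcur r 0 (a - 1) (e + 1) j ?_
          constructor
          · rfl
          case sum => have := hc.sum; omega
          case last => simp
          case time => omega
          case posA =>
            have := hc.posA
            rw [hR]
            cases r <;> simp [FCfg.act, shift, this]
            omega
          case posB =>
            have := hc.posB
            rw [hR]
            cases r <;> simp [FCfg.act, shift, this]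
            omega
          all_goals simp [FCfg.act, shift, hv, hc.pos0, hc.cont0, hc.pos3, hc.cont3, hc.pos4,
            hc.cont4, hc.pos5, hc.cont5, hc.pos6, hc.cont6, hc.contA, hc.contB]

/-- On every input and every oracle the interpreter halts within `|x| + 1` steps. -/
theorem machine_run (ω : ℕ → Bool) (x : List Bool) : ∃ j, padTime R j ≤ x.length ∧
    (∀ F x', x = List.replicate F false ++ x' → ∀ j₀, padTime R j₀ ≤ F → j₀ ≤ j) ∧
    (x.foldl (ICfg.bstep K ω) (ICfg.initial Q g j)).used ≤ g * j ∧
    Run ((machine Q R g K).init x)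
      ((List.range (x.foldl (ICfg.bstep K ω) (ICfg.initial Q g j)).used).map ω) (x.length + 1)
      (x.foldl (ICfg.bstep K ω) (ICfg.initial Q g j)).ctl.ans := by
  have hstep : (finit (machine Q R g K) x).current = .det ⟨.pad false 0,
      ![wordTape (machine Q R g K) x 0, 1, 1, 1, 0, 0, 0],
      ![none, some .right, none, none, none, none, none]⟩ := rfl
  have hrep : PadRep x 0 ((finit (machine Q R g K) x).act ⟨.pad false 0,
      ![wordTape (machine Q R g K) x 0, 1, 1, 1, 0, 0, 0],
      ![none, some .right, none, none, none, none, none]⟩) false 0 1 0 0 := by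
    have h1 : Function.update (fun _ => (0 : ZMod Q)) (0 : ℤ) 1 = marker := by
      funext z; simp [marker, Function.update_apply]
    have h0 : Function.update (fun _ => (0 : ZMod Q)) (0 : ℤ) 0 = 0 := by
      funext z; simp
    constructor
    · rfl
    case contA => exact h1
    case contB => exact h1
    case cont3 => exact h1
    case cont4 => exact h0
    case cont5 => exact h0
    case cont6 => exact h0
    case time => simp [padTime]
    all_goals simp [FCfg.act, finit, shift]
  obtain ⟨j, h1, h2, h3⟩ := pad_run (K := K) (g := g) ω x x 0 _ _ _ _ _ _ rfl (by simp) hrep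
  refine ⟨j, h1, fun F x' hF j₀ hj => h2 F x' hF j₀ (by omega), ?_, ?_⟩
  · have := (ICfg.foldl_bstep_budget K ω x (ICfg.initial Q g j)).1
    simp only [ICfg.initial, ICfg.budget] at this ⊢
    simp at this
    omega
  · rw [run_init_iff, List.range_eq_range']
    exact .det hstep h3

theorem isPrefix_map_range (ω : ℕ → Bool) {m n : ℕ} (h : m ≤ n) :
    (List.range m).map ω <+: (List.range n).map ω :=
  (List.prefix_iff_eq_take.2 (by simp [List.take_range, h])).map ω

theorem map_range_getD (ys : List Bool) : (List.range ys.length).map (ys.getD · false) = ys := by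
  refine List.ext_getElem (by simp) fun i h1 h2 => ?_
  simp at h1
  simp [h1]

/-- Acceptance by the interpreter, for streams whose effect does not depend on the number of
tokens as long as there are enough of them. -/
theorem exists_run_iff {x x' : List Bool} {F j₀ : ℕ} (hx : x = List.replicate F false ++ x')
    (hF : padTime R j₀ ≤ F) (good : (ℕ → Bool) → Prop)
    (hgood : ∀ ω j, j₀ ≤ j →
      ((x.foldl (ICfg.bstep K ω) (ICfg.initial Q g j)).ctl.ans = true ↔ good ω)) :
    (∃ bs t, Run ((machine Q R g K).init x) bs t true) ↔ ∃ ω, good ω := by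
  constructor
  · rintro ⟨bs, t, h⟩
    -- The finite oracle string is continued by `false`. Two runs on prefixes of the same ω give the
    -- same answer, so the accepting run agrees with the one of `machine_run`.
    set ω : ℕ → Bool := (bs.getD · false) with hω
    obtain ⟨j, -, h2, -, h4⟩ := machine_run (K := K) (R := R) (g := g) ω x
    refine ⟨ω, (hgood ω j (h2 F x' hx j₀ hF)).1 ?_⟩
    rw [run_init_iff] at h h4
    have hb : bs = (List.range bs.length).map ω := (map_range_getD bs).symm
    rw [hb] at h
    exact (h.unique h4 (isPrefix_map_range ω (le_max_left _ _))
      (isPrefix_map_range ω (le_max_right _ _))).symm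
  · rintro ⟨ω, h⟩
    obtain ⟨j, -, h2, -, h4⟩ := machine_run (K := K) (R := R) (g := g) ω x
    rw [(hgood ω j (h2 F x' hx j₀ hF)).2 h] at h4
    exact ⟨_, _, h4⟩

/-- The language of the interpreter is solvable in linear time. -/
theorem language_mem_NDTIME (f : ℕ → ℕ) (hf : ∀ n j, padTime R j ≤ n → g * j ≤ f n) :
    {x | ∃ bs t, Run ((machine Q R g K).init x) bs t true} ∈ NDTIME f (fun n => (n : ℝ)) := by
  refine ⟨machine Q R g K, fun n => n + 1, ?_, fun x => ⟨fun ys hys => ?_, Iff.rfl⟩⟩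
  · refine IsBigO.of_bound 2 ?_
    filter_upwards [eventually_ge_atTop 1] with n hn
    have : (1 : ℝ) ≤ n := by exact_mod_cast hn
    rw [Real.norm_of_nonneg (by positivity), Real.norm_of_nonneg (by positivity)]
    push_cast
    linarith
  · obtain ⟨j, h1, -, h3, h4⟩ := machine_run (K := K) (R := R) (g := g) (ys.getD · false) x
    refine ⟨_, ?_, _, le_rfl, _, h4⟩
    conv_rhs => rw [← map_range_getD ys]
    refine isPrefix_map_range _ (h3.trans ?_)
    rw [hys]
    exact hf _ _ h1

end Interp

/-! ### Effect of lists of commands -/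

namespace Interp

open OracleTM

variable {Q g : ℕ}

namespace ICfg

variable (K : ZMod Q) (ω : ℕ → Bool)

/-- Execution of a list of commands. -/
def execs (l : List ℕ) (I : ICfg Q g) : ICfg Q g := l.foldl (exec K ω) I

@[simp] theorem execs_nil (I : ICfg Q g) : execs K ω [] I = I := rfl

@[simp] theorem execs_cons (j : ℕ) (l : List ℕ) (I : ICfg Q g) :
    execs K ω (j :: l) I = execs K ω l (I.exec K ω j) := rfl

@[simp] theorem execs_append (l l' : List ℕ) (I : ICfg Q g) :
    execs K ω (l ++ l') I = execs K ω l' (execs K ω l I) := List.foldl_append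

theorem command_cnt (j : ℕ) (s : Ctl Q g) (a x y : ZMod Q) :
    (command K j s a x y).ctl.cnt = s.cnt := by
  unfold command
  split <;> (try split) <;> (try split) <;> rfl

theorem exec_cnt (I : ICfg Q g) (j : ℕ) : (I.exec K ω j).ctl.cnt = I.ctl.cnt := by
  unfold exec
  by_cases h1 : j = 7
  · rw [if_pos h1]
    by_cases h2 : 0 < (I.ctl.quota : ℕ)
    · rw [if_pos h2]
    · rw [if_neg h2]
      by_cases h3 : I.tok = 0
      · rw [if_pos h3]
      · rw [if_neg h3]
  · rw [if_neg h1]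
    exact command_cnt K _ _ _ _ _

theorem foldl_bstep_replicate (I : ICfg Q g) (j : ℕ) :
    (List.replicate j true).foldl (bstep K ω) I =
      { I with ctl := { I.ctl with cnt := I.ctl.cnt + (Fin.ofNat 32 j) } } := by
  induction j generalizing I with
  | zero => simp
  | succ j ih =>
    rw [List.replicate_succ, List.foldl_cons, ih]
    simp only [bstep, if_pos]
    congr 2
    ext
    simp [Fin.val_add]
    omega

/-- The unary counter of the control works modulo 32, so command numbers must be smaller. -/
theorem foldl_encodeCommands (l : List ℕ) (hl : ∀ j ∈ l, j < 32) : ∀ I : ICfg Q g,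
    I.ctl.cnt = 0 → (While.encodeCommands l).foldl (bstep K ω) I = execs K ω l I := by
  induction l with
  | nil => exact fun I _ => rfl
  | cons j l ih =>
    intro I hI
    have hj := hl j (by simp)
    have e : (List.replicate j true ++ [false]).foldl (bstep K ω) I = I.exec K ω j := by
      rw [List.foldl_append, foldl_bstep_replicate]
      simp only [List.foldl_cons, List.foldl_nil, bstep, hI]
      have h1 : ((0 + Fin.ofNat 32 j : Fin 32) : ℕ) = j := by
        simp [Nat.mod_eq_of_lt hj]
      rw [if_neg (by simp), h1, ← hI]
    have : While.encodeCommands (j :: l) = (List.replicate j true ++ [false]) ++ While.encodeCommands l := by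
      simp [While.encodeCommands]
    rw [this, List.foldl_append, e, execs_cons]
    exact ih (fun i hi => hl i (List.mem_cons_of_mem _ hi)) _ (by rw [exec_cnt, hI])

theorem execs_flatMap {f : ℕ → List ℕ} {n : ℕ} (P : ℕ → ICfg Q g → Prop)
    (h : ∀ i < n, ∀ I, P i I → P (i + 1) (execs K ω (f i) I)) {I : ICfg Q g} (h0 : P 0 I) :
    P n (execs K ω ((List.range n).flatMap f) I) := by
  induction n with
  | zero => exact h0
  | succ n ih =>
    rw [List.range_succ, List.flatMap_append, execs_append]
    simpa using h n (by omega) _ (ih fun i hi => h i (by omega))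

theorem execs_flatMap_eq {f : ℕ → List ℕ} {n : ℕ} (J : ℕ → ICfg Q g)
    (h : ∀ i < n, execs K ω (f i) (J i) = J (i + 1)) {I : ICfg Q g} (h0 : I = J 0) :
    execs K ω ((List.range n).flatMap f) I = J n :=
  execs_flatMap K ω (fun i I => I = J i) (fun i hi I hI => by rw [hI]; exact h i hi) h0

@[simp] theorem exec_zero (I : ICfg Q g) : I.exec K ω 0 = I := by
  simp [exec, command, Tp.act, Tp.head, shift]

theorem exec_one (I : ICfg Q g) : I.exec K ω 1 = { I with S1 := ⟨I.S1.pos + 1, I.S1.cell⟩ } := by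
  simp [exec, command, Tp.act, Tp.head, shift]

theorem exec_two (I : ICfg Q g) : I.exec K ω 2 = { I with S1 := ⟨I.S1.pos - 1, I.S1.cell⟩ } := by
  simp [exec, command, Tp.act, Tp.head, shift, sub_eq_add_neg]

theorem exec_three (I : ICfg Q g) : I.exec K ω 3 = { I with S2 := ⟨I.S2.pos + 1, I.S2.cell⟩ } := by
  simp [exec, command, Tp.act, Tp.head, shift]

theorem exec_four (I : ICfg Q g) : I.exec K ω 4 = { I with S2 := ⟨I.S2.pos - 1, I.S2.cell⟩ } := by
  simp [exec, command, Tp.act, Tp.head, shift, sub_eq_add_neg]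

theorem exec_five (I : ICfg Q g) : I.exec K ω 5 = { I with G := ⟨I.G.pos + 1, I.G.cell⟩ } := by
  simp [exec, command, Tp.act, Tp.head, shift]

theorem exec_six (I : ICfg Q g) : I.exec K ω 6 = { I with G := ⟨I.G.pos - 1, I.G.cell⟩ } := by
  simp [exec, command, Tp.act, Tp.head, shift, sub_eq_add_neg]

theorem exec_nine (I : ICfg Q g) :
    I.exec K ω 9 = { I with ctl := { I.ctl with mat := true } } := by
  simp [exec, command, Tp.act, Tp.head, shift]

theorem execs_replicate_zero (I : ICfg Q g) (k : ℕ) : execs K ω (List.replicate k 0) I = I := by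
  induction k with
  | zero => rfl
  | succ k ih => rw [List.replicate_succ, execs_cons, exec_zero, ih]

theorem execs_replicate_one (I : ICfg Q g) (k : ℕ) : execs K ω (List.replicate k 1) I =
    { I with S1 := ⟨I.S1.pos + k, I.S1.cell⟩ } := by
  induction k generalizing I with
  | zero => simp
  | succ k ih =>
    rw [List.replicate_succ, execs_cons, exec_one, ih]
    simp only [Nat.cast_succ]; congr 2; ring

theorem execs_replicate_two (I : ICfg Q g) (k : ℕ) : execs K ω (List.replicate k 2) I =
    { I with S1 := ⟨I.S1.pos - k, I.S1.cell⟩ } := by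
  induction k generalizing I with
  | zero => simp
  | succ k ih =>
    rw [List.replicate_succ, execs_cons, exec_two, ih]
    simp only [Nat.cast_succ]; congr 2; ring

theorem execs_replicate_four (I : ICfg Q g) (k : ℕ) : execs K ω (List.replicate k 4) I =
    { I with S2 := ⟨I.S2.pos - k, I.S2.cell⟩ } := by
  induction k generalizing I with
  | zero => simp
  | succ k ih =>
    rw [List.replicate_succ, execs_cons, exec_four, ih]
    simp only [Nat.cast_succ]; congr 2; ring

theorem execs_replicate_six (I : ICfg Q g) (k : ℕ) : execs K ω (List.replicate k 6) I =
    { I with G := ⟨I.G.pos - k, I.G.cell⟩ } := by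
  induction k generalizing I with
  | zero => simp
  | succ k ih =>
    rw [List.replicate_succ, execs_cons, exec_six, ih]
    simp only [Nat.cast_succ]; congr 2; ring

end ICfg

/-- The digit announced by a command. -/
def codeVal (K : ZMod Q) (c : ℕ) : ZMod Q :=
  if c = 11 then 1 else if c = 12 then -1 else if c = 13 then K else 0

/-- A command that announces a digit. -/
def IsCode (c : ℕ) : Prop := c = 10 ∨ c = 11 ∨ c = 12 ∨ c = 13

/-- A tape content given by `n` blocks of `b` cells. -/
def field (b n : ℕ) (f : ℕ → ℕ → ZMod Q) : ℤ → ZMod Q :=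
  ∑ w ∈ Finset.range n, ∑ t ∈ Finset.range b, Pi.single ((w * b + t : ℕ) : ℤ) (f w t)

theorem field_apply {b n : ℕ} (f : ℕ → ℕ → ZMod Q) {w t : ℕ} (hw : w < n) (ht : t < b) :
    field b n f ((w * b + t : ℕ) : ℤ) = f w t := by
  simp only [field, Finset.sum_apply, Pi.single_apply, Nat.cast_inj]
  have key : ∀ w' t', t' < b → (w * b + t = w' * b + t' ↔ w = w' ∧ t = t') := by
    intro w' t' ht'
    constructor
    · intro h
      have h1 : (w * b + t) / b = w := by
        rw [mul_comm, Nat.mul_add_div (by omega), Nat.div_eq_of_lt ht, add_zero]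
      have h2 : (w' * b + t') / b = w' := by
        rw [mul_comm, Nat.mul_add_div (by omega), Nat.div_eq_of_lt ht', add_zero]
      have : w = w' := by rw [← h1, ← h2, h]
      subst this
      exact ⟨rfl, by omega⟩
    · rintro ⟨rfl, rfl⟩; rfl
  rw [Finset.sum_eq_single w, Finset.sum_eq_single t]
  · simp
  · intro t' ht' hne
    rw [if_neg]
    intro h
    exact hne ((key w t' (Finset.mem_range.1 ht')).1 h).2.symm
  · intro h; exact absurd (Finset.mem_range.2 ht) h
  · intro w' _ hne
    refine Finset.sum_eq_zero fun t' ht' => if_neg fun h => ?_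
    exact hne ((key w' t' (Finset.mem_range.1 ht')).1 h).1.symm
  · intro h; exact absurd (Finset.mem_range.2 hw) h

theorem update_add_single (f : ℤ → ZMod Q) (z : ℤ) (a : ZMod Q) :
    Function.update f z (f z + a) = f + Pi.single z a := by
  funext y
  by_cases h : y = z
  · subst h; simp
  · simp [h]

end Interp

/-! ### Passes over a row of the matrix -/

namespace Interp

open OracleTM

variable {Q g : ℕ}

/-- Addition of a row of the matrix given by `code` to the first data tape. -/
def addCmds (n b : ℕ) (code : ℕ → ℕ → ℕ) : List ℕ :=
  ((List.range n).flatMap fun w => 0 :: (List.range b).flatMap fun t => [code w t, 15, 1]) ++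
    List.replicate (n * b) 2

/-- Addition of a vector given by `code` to each block of the second data tape. -/
def initCmds (n b : ℕ) (code : ℕ → ℕ) : List ℕ :=
  ((List.range n).flatMap fun _ => 0 :: (List.range b).flatMap fun t => [code t, 14, 3]) ++
    List.replicate (n * b) 4

/-- A pass of both data tapes along row `v` of the matrix given by `code`. -/
def rowCmds (op n b v : ℕ) (code : ℕ → ℕ → ℕ) : List ℕ :=
  List.replicate (v * b) 1 ++
    (((List.range n).flatMap fun w => ((List.range b).flatMap fun t => [code w t, op, 1, 3]) ++
      17 :: List.replicate b 2) ++
    (List.replicate (v * b) 2 ++ List.replicate (n * b) 4))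

/-- The carry in the sum of the digits `x`. -/
def carry (x : ℕ → ZMod Q) : ℕ → ZMod Q
  | 0 => 0
  | t + 1 => ((carry x t + x t).valMinAbs / 2 : ℤ)

namespace ICfg

variable (K : ZMod Q) (ω : ℕ → Bool)

theorem exec_code (I : ICfg Q g) {c : ℕ} (hc : IsCode c) :
    I.exec K ω c = { I with ctl := { I.ctl with d := codeVal K c } } := by
  rcases hc with rfl | rfl | rfl | rfl <;>
    simp [exec, command, Tp.act, Tp.head, shift, codeVal]

theorem exec_upd (I : ICfg Q g) : I.exec K ω 14 = { I with
    ctl := { I.ctl with d := 0 }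
    S2 := ⟨I.S2.pos, I.S2.cell + Pi.single I.S2.pos
      (if I.ctl.mat then I.ctl.d + I.S1.head else 0)⟩ } := by
  cases h : I.ctl.mat <;>
    simp [exec, command, Tp.act, Tp.head, shift, h, update_add_single]

theorem exec_add (I : ICfg Q g) : I.exec K ω 15 = { I with
    ctl := { I.ctl with d := 0 }
    S1 := ⟨I.S1.pos, I.S1.cell + Pi.single I.S1.pos (if I.ctl.mat then I.ctl.d else 0)⟩ } := by
  cases h : I.ctl.mat <;>
    simp [exec, command, Tp.act, Tp.head, shift, h, update_add_single]

theorem exec_acc (I : ICfg Q g) : I.exec K ω 16 = { I with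
    ctl := { I.ctl with
      d := 0
      car := ((I.ctl.car + I.ctl.d + I.S1.head + I.S2.head).valMinAbs / 2 : ℤ) } } := by
  simp [exec, command, Tp.act, Tp.head, shift]

theorem exec_test (I : ICfg Q g) : I.exec K ω 17 = { I with
    ctl := { I.ctl with car := 0, ans := I.ctl.ans || decide (I.ctl.car.valMinAbs < 0) } } := by
  simp [exec, command, Tp.act, Tp.head, shift]

variable {n b : ℕ}

theorem execs_addCmds {code : ℕ → ℕ → ℕ} (hc : ∀ w t, IsCode (code w t)) {I : ICfg Q g}
    (hd : I.ctl.d = 0) (hp : I.S1.pos = 0) : execs K ω (addCmds n b code) I = { I with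
      S1 := ⟨0, I.S1.cell +
        field b n fun w t => if I.ctl.mat then codeVal K (code w t) else 0⟩ } := by
  have inner : ∀ w, ∀ I : ICfg Q g, I.ctl.d = 0 →
      execs K ω ((List.range b).flatMap fun t => [code w t, 15, 1]) I = { I with
        S1 := ⟨I.S1.pos + b, I.S1.cell + ∑ t ∈ Finset.range b, Pi.single (I.S1.pos + t)
          (if I.ctl.mat then codeVal K (code w t) else 0)⟩ } := by
    intro w I hd
    refine execs_flatMap_eq K ω (fun t => { I with
        S1 := ⟨I.S1.pos + t, I.S1.cell + ∑ t ∈ Finset.range t, Pi.single (I.S1.pos + t)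
          (if I.ctl.mat then codeVal K (code w t) else 0)⟩ }) (fun t _ => ?_) (by simp)
    rw [execs_cons, exec_code K ω _ (hc w t)]
    simp only [execs_cons, execs_nil, exec_add, exec_one, Finset.sum_range_succ, ← hd, Nat.cast_succ,
      add_assoc]
  rw [addCmds, execs_append, execs_flatMap_eq K ω (fun w => { I with
      S1 := ⟨(w * b : ℕ), I.S1.cell + ∑ w ∈ Finset.range w, ∑ t ∈ Finset.range b,
        Pi.single ((w * b + t : ℕ) : ℤ) (if I.ctl.mat then codeVal K (code w t) else 0)⟩ })
      (fun w _ => ?_) (by simp [← hp]), execs_replicate_two]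
  · simp [field]
  · rw [execs_cons, exec_zero, inner w]
    · simp only [Finset.sum_range_succ, add_assoc, Nat.cast_add, add_mul, one_mul]
    · exact hd

/-- The update command 14 also adds the cell scanned on the first data tape, hence the condition
that it be zero. The head of that tape does not move here. -/
theorem execs_initCmds {code : ℕ → ℕ} (hc : ∀ t, IsCode (code t)) {I : ICfg Q g}
    (hd : I.ctl.d = 0) (hm : I.ctl.mat = true) (hp : I.S2.pos = 0) (h1 : I.S1.head = 0) :
    execs K ω (initCmds n b code) I = { I with
      S2 := ⟨0, I.S2.cell + field b n fun _ t => codeVal K (code t)⟩ } := by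
  have inner : ∀ I : ICfg Q g, I.ctl.d = 0 → I.ctl.mat = true → I.S1.head = 0 →
      execs K ω ((List.range b).flatMap fun t => [code t, 14, 3]) I = { I with
        S2 := ⟨I.S2.pos + b, I.S2.cell + ∑ t ∈ Finset.range b, Pi.single (I.S2.pos + t)
          (codeVal K (code t))⟩ } := by
    intro I hd hm h1
    refine execs_flatMap_eq K ω (fun t => { I with
        S2 := ⟨I.S2.pos + t, I.S2.cell + ∑ t ∈ Finset.range t, Pi.single (I.S2.pos + t)
          (codeVal K (code t))⟩ }) (fun t _ => ?_) (by simp)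
    rw [execs_cons, exec_code K ω _ (hc t)]
    simp only [execs_cons, execs_nil, exec_upd, exec_three, Finset.sum_range_succ, ← hd, Nat.cast_succ,
      add_assoc, hm, h1, if_pos]
    simp [hd]
    rw [← hm, ← hd]
  rw [initCmds, execs_append, execs_flatMap_eq K ω (fun w => { I with
      S2 := ⟨(w * b : ℕ), I.S2.cell + ∑ w ∈ Finset.range w, ∑ t ∈ Finset.range b,
        Pi.single ((w * b + t : ℕ) : ℤ) (codeVal K (code t))⟩ })
      (fun w _ => ?_) (by simp [← hp]), execs_replicate_four]
  · simp [field]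
  · rw [execs_cons, exec_zero, inner]
    · simp only [Finset.sum_range_succ, add_assoc, Nat.cast_add, add_mul, one_mul]
    · exact hd
    · exact hm
    · exact h1

/-- While the second head advances through all blocks w, the first one scans block v again and
again; so block v of the first tape is added to every block of the second, together with the matrix
row. This is how the weight from the new vertex to the earlier ones enters all totals. -/
theorem execs_rowCmds_upd {code : ℕ → ℕ → ℕ} (hc : ∀ w t, IsCode (code w t)) {I : ICfg Q g} (v : ℕ)
    (hd : I.ctl.d = 0) (hcar : I.ctl.car = 0) (h1 : I.S1.pos = 0) (h2 : I.S2.pos = 0) :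
    execs K ω (rowCmds 14 n b v code) I = { I with
      S2 := ⟨0, I.S2.cell + field b n fun w t =>
        if I.ctl.mat then codeVal K (code w t) + I.S1.cell ((v * b + t : ℕ) : ℤ) else 0⟩ } := by
  have inner : ∀ w, ∀ I : ICfg Q g, I.ctl.d = 0 →
      execs K ω ((List.range b).flatMap fun t => [code w t, 14, 1, 3]) I = { I with
        S1 := ⟨I.S1.pos + b, I.S1.cell⟩
        S2 := ⟨I.S2.pos + b, I.S2.cell + ∑ t ∈ Finset.range b, Pi.single (I.S2.pos + t)
          (if I.ctl.mat then codeVal K (code w t) + I.S1.cell (I.S1.pos + t) else 0)⟩ } := by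
    intro w I hd
    refine execs_flatMap_eq K ω (fun t => { I with
        S1 := ⟨I.S1.pos + t, I.S1.cell⟩
        S2 := ⟨I.S2.pos + t, I.S2.cell + ∑ t ∈ Finset.range t, Pi.single (I.S2.pos + t)
          (if I.ctl.mat then codeVal K (code w t) + I.S1.cell (I.S1.pos + t) else 0)⟩ })
      (fun t _ => ?_) (by simp)
    rw [execs_cons, exec_code K ω _ (hc w t)]
    simp only [execs_cons, execs_nil, exec_upd, exec_one, exec_three, Finset.sum_range_succ, ← hd,
      Nat.cast_succ, add_assoc, Tp.head]
  -- In an update pass the carry stays 0, so the sign test at the end of a block has no effect.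
  have test : ∀ I : ICfg Q g, I.ctl.car = 0 → I.exec K ω 17 = I := by
    intro I h
    have e : decide (I.ctl.car.valMinAbs < 0) = false := by simp [h]
    rw [exec_test, e, Bool.or_false, ← h]
  rw [rowCmds, execs_append, execs_replicate_one, execs_append, execs_flatMap_eq K ω (fun w => { I with
      S1 := ⟨(v * b : ℕ), I.S1.cell⟩
      S2 := ⟨(w * b : ℕ), I.S2.cell + ∑ w ∈ Finset.range w, ∑ t ∈ Finset.range b,
        Pi.single ((w * b + t : ℕ) : ℤ)
          (if I.ctl.mat then codeVal K (code w t) + I.S1.cell ((v * b + t : ℕ) : ℤ) else 0)⟩ })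
      (fun w _ => ?_) (by simp [h1, ← h2]), execs_append, execs_replicate_two, execs_replicate_four]
  · simp [field, ← h1]
  · rw [execs_append, inner w, execs_cons, test, execs_replicate_two]
    · simp only [Finset.sum_range_succ, add_assoc, Nat.cast_add, add_mul, one_mul,
        add_sub_cancel_right]
    · exact hcar
    · exact hd

/-- The same movement of the heads, now without writing: digit by digit, entry (v, w), block v of
the first tape and block w of the second are summed. Command 17 resets the carry, so the blocks are
independent. -/
theorem execs_rowCmds_acc {code : ℕ → ℕ → ℕ} (hc : ∀ w t, IsCode (code w t)) {I : ICfg Q g} (v : ℕ)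
    (hd : I.ctl.d = 0) (hcar : I.ctl.car = 0) (h1 : I.S1.pos = 0) (h2 : I.S2.pos = 0) :
    execs K ω (rowCmds 16 n b v code) I = { I with
      ctl := { I.ctl with ans := I.ctl.ans || decide (∃ w < n, (carry (fun t =>
        codeVal K (code w t) + I.S1.cell ((v * b + t : ℕ) : ℤ) + I.S2.cell ((w * b + t : ℕ) : ℤ))
        b).valMinAbs < 0) } } := by
  have inner : ∀ w, ∀ I : ICfg Q g, I.ctl.d = 0 → I.ctl.car = 0 →
      execs K ω ((List.range b).flatMap fun t => [code w t, 16, 1, 3]) I = { I with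
        ctl := { I.ctl with car := carry (fun t =>
          codeVal K (code w t) + I.S1.cell (I.S1.pos + t) + I.S2.cell (I.S2.pos + t)) b }
        S1 := ⟨I.S1.pos + b, I.S1.cell⟩
        S2 := ⟨I.S2.pos + b, I.S2.cell⟩ } := by
    intro w I hd hcar
    refine execs_flatMap_eq K ω (fun t => { I with
        ctl := { I.ctl with car := carry (fun t =>
          codeVal K (code w t) + I.S1.cell (I.S1.pos + t) + I.S2.cell (I.S2.pos + t)) t }
        S1 := ⟨I.S1.pos + t, I.S1.cell⟩
        S2 := ⟨I.S2.pos + t, I.S2.cell⟩ })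
      (fun t _ => ?_) (by simp [carry, ← hcar])
    rw [execs_cons, exec_code K ω _ (hc w t)]
    simp only [execs_cons, execs_nil, exec_acc, exec_one, exec_three, ← hd,
      Nat.cast_succ, add_assoc, Tp.head, carry]
  classical
  rw [rowCmds, execs_append, execs_replicate_one, execs_append, execs_flatMap_eq K ω (fun n => { I with
      ctl := { I.ctl with ans := I.ctl.ans || decide (∃ w < n, (carry (fun t =>
        codeVal K (code w t) + I.S1.cell ((v * b + t : ℕ) : ℤ) + I.S2.cell ((w * b + t : ℕ) : ℤ))
        b).valMinAbs < 0) }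
      S1 := ⟨(v * b : ℕ), I.S1.cell⟩
      S2 := ⟨(n * b : ℕ), I.S2.cell⟩ })
      (fun w _ => ?_) (by simp [h1, ← h2]), execs_append, execs_replicate_two, execs_replicate_four]
  · have e1 : I.S1 = ⟨0, I.S1.cell⟩ := Tp.ext h1 rfl
    have e2 : I.S2 = ⟨0, I.S2.cell⟩ := Tp.ext h2 rfl
    simp only [sub_self, ← e1, ← e2]
  · rw [execs_append, inner w, execs_cons, exec_test, execs_replicate_two]
    rotate_left
    · exact hd
    · exact hcar
    simp only [add_assoc, Nat.cast_add, add_mul, one_mul, add_sub_cancel_right, ← hcar,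
      Bool.or_assoc]
    congr 3
    rw [← Bool.decide_or, decide_eq_decide]
    constructor
    · rintro (⟨w', h, h'⟩ | h)
      · exact ⟨w', by omega, h'⟩
      · exact ⟨w, by omega, h⟩
    · rintro ⟨w', h, h'⟩
      rcases Nat.lt_succ_iff_lt_or_eq.1 h with h | rfl
      · exact .inl ⟨w', h, h'⟩
      · exact .inr h'

end ICfg
end Interp

/-! ### The guess of a vertex and the search for its row -/

namespace Interp

open OracleTM

variable {Q g : ℕ}

/-- One iteration of the search for the row with the guessed number: the counter is decremented,
and row `v` is processed. -/
def stepCmds (n b m v : ℕ) (code : ℕ → ℕ → ℕ → ℕ) : List ℕ :=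
  9 :: (((List.range m).flatMap fun _ => [8, 5]) ++
    (List.replicate m 6 ++ (rowCmds 14 n b v (code v) ++ addCmds n b (code v))))

/-- The choice of a vertex. -/
def phaseCmds (n b m : ℕ) (code : ℕ → ℕ → ℕ → ℕ) : List ℕ :=
  ((List.range m).flatMap fun _ => [7, 5]) ++
    (List.replicate m 6 ++ (List.range n).flatMap fun v => stepCmds n b m v code)

/-- The number in the first `m` cells of a tape. -/
def Tp.value (T : Tp Q) (m : ℕ) : ℕ := ∑ i ∈ Finset.range m, if T.cell i = 1 then 2 ^ i else 0

/-- The number given by `m` oracle bits. -/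
def guessed (ω : ℕ → Bool) (i m : ℕ) : ℕ := ∑ j ∈ Finset.range m, if ω (i + j) then 2 ^ j else 0

theorem guessed_lt (ω : ℕ → Bool) (i m : ℕ) : guessed ω i m < 2 ^ m := by
  unfold guessed
  induction m with
  | zero => simp
  | succ m ih =>
    rw [Finset.sum_range_succ, pow_succ]
    split_ifs <;> omega

namespace ICfg

variable (K : ZMod Q) (ω : ℕ → Bool)

theorem exec_guess (I : ICfg Q g) (h : 0 < I.budget) :
    (I.exec K ω 7).ctl.d = I.ctl.d ∧ (I.exec K ω 7).ctl.car = I.ctl.car ∧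
    (I.exec K ω 7).ctl.ans = I.ctl.ans ∧ (I.exec K ω 7).S1 = I.S1 ∧ (I.exec K ω 7).S2 = I.S2 ∧
    (I.exec K ω 7).used = I.used + 1 ∧
    (I.exec K ω 7).G = ⟨I.G.pos, Function.update I.G.cell I.G.pos (bitSym (ω I.used))⟩ := by
  unfold exec
  rw [if_pos rfl]
  by_cases h2 : 0 < (I.ctl.quota : ℕ)
  · rw [if_pos h2]
    simp [Tp.act, shift]
  · rw [if_neg h2]
    have h3 : I.tok ≠ 0 := by
      intro h3
      simp only [budget, h3, mul_zero] at h
      omega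
    rw [if_neg h3]
    simp [Tp.act, shift]

variable [Fact (2 < Q)]

theorem execs_guess (I : ICfg Q g) (m : ℕ) (h : m ≤ I.budget) (hp : I.G.pos = 0) :
    let J := execs K ω ((List.range m).flatMap fun _ => [7, 5]) I
    J.ctl.d = I.ctl.d ∧ J.ctl.car = I.ctl.car ∧ J.ctl.ans = I.ctl.ans ∧ J.S1 = I.S1 ∧
    J.S2 = I.S2 ∧ J.used = I.used + m ∧ J.budget + m = I.budget ∧ J.G.pos = m ∧
    ∀ i < m, J.G.cell (i : ℕ) = bitSym (ω (I.used + i)) := by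
  refine execs_flatMap K ω (fun m J => J.ctl.d = I.ctl.d ∧ J.ctl.car = I.ctl.car ∧
    J.ctl.ans = I.ctl.ans ∧ J.S1 = I.S1 ∧ J.S2 = I.S2 ∧ J.used = I.used + m ∧
    J.budget + m = I.budget ∧ J.G.pos = m ∧
    ∀ i < m, J.G.cell (i : ℕ) = bitSym (ω (I.used + i))) (fun i hi J hJ => ?_) (by simp [hp])
  obtain ⟨a1, a2, a3, a4, a5, a6, a7, a8, a9⟩ := hJ
  obtain ⟨b1, b2, b3, b4, b5, b6, b7⟩ := exec_guess K ω J (by omega)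
  have b8 := (exec_budget K ω J 7).1
  simp only [execs_cons, execs_nil, exec_five]
  refine ⟨b1.trans a1, b2.trans a2, b3.trans a3, b4.trans a4, b5.trans a5, by omega, ?_, ?_, ?_⟩
  · change (J.exec K ω 7).budget + _ = _
    omega
  · rw [b7]; simp [a8]
  · intro i' hi'
    rw [b7]
    dsimp only
    rw [a8]
    rcases Nat.lt_succ_iff_lt_or_eq.1 hi' with h | rfl
    · rw [Function.update_of_ne (by norm_cast; omega)]
      exact a9 _ h
    · rw [Function.update_self, a6]

theorem exec_dec (I : ICfg Q g) : I.exec K ω 8 = if I.ctl.mat then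
      if I.G.head = 1 then { I with
        ctl := { I.ctl with mat := false }
        G := ⟨I.G.pos, Function.update I.G.cell I.G.pos 0⟩ }
      else { I with G := ⟨I.G.pos, Function.update I.G.cell I.G.pos 1⟩ }
    else I := by
  cases h : I.ctl.mat
  · simp [exec, command, Tp.act, shift, h, Tp.head]
  · by_cases h' : I.G.head = 1
    · simp [exec, command, Tp.act, shift, h, h']
      simp [Tp.head]
    · simp [exec, command, Tp.act, shift, h, h']
      simp [Tp.head]

theorem value_congr {T T' : Tp Q} {m : ℕ} (h : ∀ i < m, T.cell (i : ℕ) = T'.cell (i : ℕ)) :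
    T.value m = T'.value m :=
  Finset.sum_congr rfl fun i hi => by rw [h i (Finset.mem_range.1 hi)]

theorem value_succ (T : Tp Q) (m : ℕ) :
    T.value (m + 1) = T.value m + if T.cell m = 1 then 2 ^ m else 0 := Finset.sum_range_succ _ _

/-- Subtraction of 1 modulo 2^m, with the flag `mat`, set beforehand, as incoming borrow. The borrow
survives exactly when all bits were 0. -/
theorem execs_dec (I : ICfg Q g) (m : ℕ) (hp : I.G.pos = 0) (hm : I.ctl.mat = true) :
    ∃ G : Tp Q, G.pos = m ∧ G.value m + 1 = I.G.value m + (if I.G.value m = 0 then 2 ^ m else 0) ∧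
      execs K ω ((List.range m).flatMap fun _ => [8, 5]) I = { I with
        ctl := { I.ctl with mat := decide (I.G.value m = 0) }
        G := G } := by
  -- After i bits either the borrow is alive, the low part was 0 and is now 2^i - 1, or the borrow
  -- is gone and the low part has decreased by 1.
  have key := execs_flatMap K ω (f := fun _ => [8, 5]) (n := m) (fun i J => J.G.pos = i ∧ (∀ z : ℕ, i ≤ z → J.G.cell z = I.G.cell z) ∧
    ((J.ctl.mat = true ∧ I.G.value i = 0 ∧ J.G.value i + 1 = 2 ^ i) ∨
      (J.ctl.mat = false ∧ J.G.value i + 1 = I.G.value i)) ∧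
    J = { I with ctl := { I.ctl with mat := J.ctl.mat }, G := J.G }) (fun i _ J hJ => ?_)
    (I := I) ⟨by simp [hp], fun _ _ => rfl, .inl ⟨hm, by simp [Tp.value], by simp [Tp.value]⟩, rfl⟩
  · obtain ⟨h1, h2, h3, h4⟩ := key
    refine ⟨_, h1, ?_, h4.trans ?_⟩
    · rcases h3 with ⟨-, h3, h5⟩ | ⟨-, h3⟩
      · rw [if_pos h3, h3, h5, zero_add]
      · rw [if_neg (by omega), h3, add_zero]
    · rcases h3 with ⟨h, h3, h5⟩ | ⟨h, h3⟩
      · rw [h, decide_eq_true h3]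
      · rw [h, decide_eq_false (by omega)]
  · obtain ⟨h1, h2, h3, h4⟩ := hJ
    have hcell : J.G.head = I.G.cell i := by rw [Tp.head, h1, h2 i le_rfl]
    have hlow : ∀ (a : ZMod Q) (p : ℤ),
        (⟨p, Function.update J.G.cell J.G.pos a⟩ : Tp Q).value i = J.G.value i := fun a p =>
      value_congr fun i' hi' => by
        dsimp only
        rw [h1, Function.update_of_ne (by norm_cast; omega)]
    have hhigh : ∀ (a : ZMod Q) (z : ℕ), i + 1 ≤ z →
        Function.update J.G.cell J.G.pos a (z : ℤ) = I.G.cell z := fun a z hz => by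
      rw [h1, Function.update_of_ne (by norm_cast; omega), h2 z (by omega)]
    have h01 : (0 : ZMod Q) ≠ 1 := one_ne_zero'.symm
    simp only [execs_cons, execs_nil, exec_five, exec_dec, hcell]
    rcases h3 with ⟨hmat, h5, h6⟩ | ⟨hmat, h5⟩
    · rw [if_pos hmat]
      by_cases hb : I.G.cell i = 1
      · rw [if_pos hb]
        refine ⟨by simp [h1], hhigh 0, .inr ⟨rfl, ?_⟩, ?_⟩
        · rw [value_succ, value_succ, hlow, if_pos hb]
          simp [h1, h01]
          omega
        · dsimp only; rw [h4]
      · rw [if_neg hb]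
        refine ⟨by simp [h1], hhigh 1, .inl ⟨hmat, ?_, ?_⟩, ?_⟩
        · rw [value_succ, if_neg hb, h5]
        · rw [value_succ, hlow]
          simp [h1]
          rw [pow_succ]
          omega
        · dsimp only; rw [h4]
    · rw [if_neg (by simp [hmat])]
      refine ⟨by simp [h1], fun z hz => h2 z (by omega), .inr ⟨hmat, ?_⟩, ?_⟩
      · rw [value_succ, value_succ, h2 i le_rfl, ← h5]
        have : (⟨J.G.pos + 1, J.G.cell⟩ : Tp Q).value i = J.G.value i := rfl
        omega
      · rw [h4]

variable {n b m : ℕ} {code : ℕ → ℕ → ℕ → ℕ}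

/-- The order of the two passes matters: the second tape must see block v of the first tape before
the row of the new vertex is added to it. -/
theorem execs_stepCmds (hc : ∀ v w t, IsCode (code v w t)) (I : ICfg Q g) (v : ℕ)
    (hd : I.ctl.d = 0) (hcar : I.ctl.car = 0) (hG : I.G.pos = 0) (h1 : I.S1.pos = 0)
    (h2 : I.S2.pos = 0) :
    ∃ G : Tp Q, G.pos = 0 ∧ G.value m + 1 = I.G.value m + (if I.G.value m = 0 then 2 ^ m else 0) ∧
      execs K ω (stepCmds n b m v code) I = { I with
        ctl := { I.ctl with mat := decide (I.G.value m = 0) }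
        G := G
        S1 := ⟨0, I.S1.cell + field b n fun w t =>
          if I.G.value m = 0 then codeVal K (code v w t) else 0⟩
        S2 := ⟨0, I.S2.cell + field b n fun w t => if I.G.value m = 0 then
          codeVal K (code v w t) + I.S1.cell ((v * b + t : ℕ) : ℤ) else 0⟩ } := by
  obtain ⟨G, g1, g2, g3⟩ := execs_dec K ω { I with ctl := { I.ctl with mat := true } } m hG rfl
  refine ⟨⟨0, G.cell⟩, rfl, g2, ?_⟩
  rw [stepCmds, execs_cons, exec_nine, execs_append, g3, execs_append, execs_replicate_six,
    execs_append, execs_rowCmds_upd, execs_addCmds]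
  · simp [g1]
  · exact hc v
  · exact hd
  · exact h1
  · exact hc v
  · exact hd
  · exact hcar
  · exact h1
  · exact h2

theorem field_zero : field (Q := Q) b n (fun _ _ => 0) = 0 := by simp [field]

/-- The counter starts at u < 2^m and decreases once per row, so it is 0 at row u; afterwards it
wraps around to 2^m - 1 and does not reach 0 again within the 2^m rows. Hence exactly row u is
added. -/
theorem execs_phaseCmds (hc : ∀ v w t, IsCode (code v w t)) (I : ICfg Q g)
    (hd : I.ctl.d = 0) (hcar : I.ctl.car = 0) (hG : I.G.pos = 0) (h1 : I.S1.pos = 0)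
    (h2 : I.S2.pos = 0) (hb : m ≤ I.budget) :
    let J := execs K ω (phaseCmds (2 ^ m) b m code) I
    let u := guessed ω I.used m
    J.ctl.d = 0 ∧ J.ctl.car = 0 ∧ J.ctl.ans = I.ctl.ans ∧ J.G.pos = 0 ∧ J.used = I.used + m ∧
    J.budget + m = I.budget ∧
    J.S1 = ⟨0, I.S1.cell + field b (2 ^ m) fun w t => codeVal K (code u w t)⟩ ∧
    J.S2 = ⟨0, I.S2.cell + field b (2 ^ m) fun w t =>
      codeVal K (code u w t) + I.S1.cell ((u * b + t : ℕ) : ℤ)⟩ := by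
  intro J u
  have hu : u < 2 ^ m := guessed_lt _ _ _
  obtain ⟨a1, a2, a3, a4, a5, a6, a7, a8, a9⟩ := execs_guess K ω I m hb hG
  set I₁ := execs K ω ((List.range m).flatMap fun _ => [7, 5]) I with hI₁
  have hJ : J = execs K ω ((List.range (2 ^ m)).flatMap fun v => stepCmds (2 ^ m) b m v code)
      { I₁ with G := ⟨I₁.G.pos - m, I₁.G.cell⟩ } := by
    simp only [J, phaseCmds, execs_append, execs_replicate_six, hI₁]
  have key := execs_flatMap K ω (f := fun v => stepCmds (2 ^ m) b m v code) (n := 2 ^ m)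
    (fun v J => J.ctl.d = 0 ∧ J.ctl.car = 0 ∧ J.ctl.ans = I.ctl.ans ∧ J.G.pos = 0 ∧
      J.used = I.used + m ∧ J.budget + m = I.budget ∧
      J.G.value m + v = u + (if u < v then 2 ^ m else 0) ∧
      J.S1 = ⟨0, I.S1.cell + field b (2 ^ m) fun w t => if u < v then codeVal K (code u w t) else 0⟩ ∧
      J.S2 = ⟨0, I.S2.cell + field b (2 ^ m) fun w t => if u < v then
        codeVal K (code u w t) + I.S1.cell ((u * b + t : ℕ) : ℤ) else 0⟩) (fun v hv J hJ => ?_)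
    (I := { I₁ with G := ⟨I₁.G.pos - m, I₁.G.cell⟩ }) ?_
  · obtain ⟨c1, c2, c3, c4, c5, c6, c7, c8, c9⟩ := key
    rw [← hJ] at c1 c2 c3 c4 c5 c6 c7 c8 c9
    simp only [if_pos hu] at c8 c9
    exact ⟨c1, c2, c3, c4, c5, c6, c8, c9⟩
  · obtain ⟨c1, c2, c3, c4, c5, c6, c7, c8, c9⟩ := hJ
    obtain ⟨G, g1, g2, g3⟩ := execs_stepCmds K ω (n := 2 ^ m) (b := b) (m := m) hc J v c1 c2 c4
      (by rw [c8]) (by rw [c9])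
    rw [g3]
    -- By the invariant the counter is u - v for v ≤ u and u + 2^m - v afterwards, which is positive
    -- since v < 2^m.
    have hval : J.G.value m = 0 ↔ u = v := by
      split_ifs at c7 <;> omega
    refine ⟨c1, c2, c3, g1, c5, c6, ?_, ?_, ?_⟩
    · dsimp only
      split_ifs at g2 c7 ⊢ <;> omega
    · dsimp only
      rw [c8]
      simp only [hval]
      rcases lt_trichotomy u v with h | h | h
      · simp [h, h.ne, show u < v + 1 by omega, field_zero]
      · simp [h, field_zero]
      · simp [h.ne', show ¬ u < v by omega, show ¬ u < v + 1 by omega, field_zero]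
    · dsimp only
      rw [c8, c9]
      simp only [hval]
      rcases lt_trichotomy u v with h | h | h
      · simp [h, h.ne, show u < v + 1 by omega, field_zero]
      · simp [h, field_zero]
      · simp [h.ne', show ¬ u < v by omega, show ¬ u < v + 1 by omega, field_zero]
  · refine ⟨a1.trans hd, a2.trans hcar, a3, by simp [a8], a6, a7, ?_, ?_, ?_⟩
    · simp only [Nat.not_lt_zero, if_false, add_zero]
      refine Finset.sum_congr rfl fun i hi => ?_
      dsimp only
      rw [a9 i (Finset.mem_range.1 hi), bitSym]
      cases ω (I.used + i) <;> simp [one_ne_zero'.symm]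
    · dsimp only
      rw [a4]
      simp [field_zero, ← h1]
    · dsimp only
      rw [a5]
      simp [field_zero, ← h2]

end ICfg
end Interp

/-! ### Signs of digit sums and the complete command stream -/

namespace Interp

open OracleTM

variable {Q g : ℕ}

/-- The digit announced by a command, as an integer. -/
def codeInt (K : ℤ) (c : ℕ) : ℤ :=
  if c = 11 then 1 else if c = 12 then -1 else if c = 13 then K else 0

theorem codeVal_intCast (K : ℤ) (c : ℕ) : codeVal (K : ZMod Q) c = (codeInt K c : ℤ) := by
  unfold codeVal codeInt
  split_ifs <;> simp

theorem abs_codeInt_le {K : ℤ} (hK : 1 ≤ K) (c : ℕ) : |codeInt K c| ≤ K := by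
  unfold codeInt
  split_ifs <;> simp [abs_le] <;> omega

theorem valMinAbs_intCast [NeZero Q] {z : ℤ} (h : 2 * |z| < Q) : (z : ZMod Q).valMinAbs = z := by
  have := abs_lt.1 (show |2 * z| < Q by rw [abs_mul]; simpa using h)
  exact (ZMod.valMinAbs_spec _ z).2 ⟨rfl, by omega, by omega⟩

/-- Nested floors collapse, so the carry after t digits is the floor of the partial sum divided by
2^t. It remains bounded by B, hence carry plus digit is at most 2B in absolute value and is
recovered exactly from its residue modulo Q > 4B. -/
theorem carry_eq [NeZero Q] {X : ℕ → ℤ} {B : ℤ} (hX : ∀ t, |X t| ≤ B) (hQ : 4 * B < Q) (t : ℕ) :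
    carry (fun t => (X t : ZMod Q)) t = (((∑ s ∈ Finset.range t, X s * 2 ^ s) / 2 ^ t : ℤ) : ZMod Q) ∧
      |(∑ s ∈ Finset.range t, X s * 2 ^ s) / 2 ^ t| ≤ B := by
  induction t with
  | zero => simpa [carry] using (abs_nonneg _).trans (hX 0)
  | succ t ih =>
    obtain ⟨h1, h2⟩ := ih
    have e : (∑ s ∈ Finset.range (t + 1), X s * 2 ^ s) / 2 ^ (t + 1) =
        ((∑ s ∈ Finset.range t, X s * 2 ^ s) / 2 ^ t + X t) / 2 := by
      rw [Finset.sum_range_succ, pow_succ, ← Int.ediv_ediv_of_nonneg (by positivity),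
        Int.add_mul_ediv_right _ _ (by positivity)]
    have h3 := abs_le.1 h2
    have h4 := abs_le.1 (hX t)
    refine ⟨?_, ?_⟩
    · rw [e, carry, h1, ← Int.cast_add, valMinAbs_intCast]
      have := abs_le.2 (show -(2 * B) ≤ (∑ s ∈ Finset.range t, X s * 2 ^ s) / 2 ^ t + X t ∧ 
        (∑ s ∈ Finset.range t, X s * 2 ^ s) / 2 ^ t + X t ≤ 2 * B from ⟨by linarith, by linarith⟩)
      linarith
    · rw [e, abs_le]
      omega

/-- Rounding down preserves negativity: ⌊z / 2^b⌋ < 0 iff z < 0. A bounded carry therefore decides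
the sign of an arbitrarily long sum of redundant digits. -/
theorem carry_neg_iff [NeZero Q] {X : ℕ → ℤ} {B : ℤ} (hX : ∀ t, |X t| ≤ B) (hQ : 4 * B < Q)
    (b : ℕ) : (carry (fun t => (X t : ZMod Q)) b).valMinAbs < 0 ↔
      ∑ t ∈ Finset.range b, X t * 2 ^ t < 0 := by
  obtain ⟨h1, h2⟩ := carry_eq hX hQ b
  rw [h1, valMinAbs_intCast (by have := abs_nonneg (X 0); have := hX 0; linarith),
    Int.ediv_lt_iff_lt_mul (by positivity), zero_mul]

theorem carry_congr {x y : ℕ → ZMod Q} {b : ℕ} (h : ∀ t < b, x t = y t) : carry x b = carry y b := by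
  induction b with
  | zero => rfl
  | succ b ih => rw [carry, carry, ih fun t ht => h t (by omega), h b (by omega)]

/-- The command stream for a matrix given by `code` and a vector given by `dcode`. -/
def streamCmds (F n b m L : ℕ) (code : ℕ → ℕ → ℕ → ℕ) (dcode : ℕ → ℕ) : List ℕ :=
  List.replicate F 0 ++ (9 :: (initCmds n b dcode ++
    (((List.range L).flatMap fun _ => 0 :: phaseCmds n b m code) ++
      (List.range n).flatMap fun v => 0 :: rowCmds 16 n b v (code v))))

/-- A digit of the weight of the clique `u 0, …, u (L-1), v, w`, diminished by the threshold. -/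
def totalDigit (L : ℕ) (E : ℕ → ℕ → ℕ → ℤ) (D : ℕ → ℤ) (u : ℕ → ℕ) (v w t : ℕ) : ℤ :=
  E v w t + ∑ r ∈ Finset.range L, E (u r) v t +
    (D t + ∑ r ∈ Finset.range L, (E (u r) w t + ∑ r' ∈ Finset.range r, E (u r') (u r) t))

theorem abs_sum_range_le {f : ℕ → ℤ} {C : ℤ} {n : ℕ} (h : ∀ i < n, |f i| ≤ C) :
    |∑ i ∈ Finset.range n, f i| ≤ n * C := by
  refine (Finset.abs_sum_le_sum_abs _ _).trans ?_
  refine (Finset.sum_le_card_nsmul _ _ C fun i hi => h i (Finset.mem_range.1 hi)).trans ?_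
  simp

/-- At most 1 + L + 1 + L(1 + L) ≤ (L + 2)² terms occur, whatever the graph is; so a constant
modulus Q, and thus a finite alphabet, suffices. -/
theorem abs_totalDigit_le (L : ℕ) {E : ℕ → ℕ → ℕ → ℤ} {D : ℕ → ℤ} {K : ℤ}
    (hE : ∀ v w t, |E v w t| ≤ K) (hD : ∀ t, |D t| ≤ K) (u : ℕ → ℕ) (v w t : ℕ) :
    |totalDigit L E D u v w t| ≤ K * (L + 2) ^ 2 := by
  have hK : 0 ≤ K := (abs_nonneg _).trans (hD 0)
  have h1 : |∑ r ∈ Finset.range L, E (u r) v t| ≤ L * K := abs_sum_range_le fun i _ => hE _ _ _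
  have h2 : |∑ r ∈ Finset.range L, (E (u r) w t + ∑ r' ∈ Finset.range r, E (u r') (u r) t)| ≤
      L * (K + L * K) := abs_sum_range_le fun i hi => by
    refine (abs_add_le _ _).trans (add_le_add (hE _ _ _) ?_)
    refine (abs_sum_range_le (fun i _ => hE _ _ _)).trans ?_
    have : (i : ℤ) ≤ L := by exact_mod_cast hi.le
    gcongr
  have h3 := hE v w t
  have h4 := hD t
  have h5 := abs_add_le (E v w t + ∑ r ∈ Finset.range L, E (u r) v t)
    (D t + ∑ r ∈ Finset.range L, (E (u r) w t + ∑ r' ∈ Finset.range r, E (u r') (u r) t))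
  have h6 := abs_add_le (E v w t) (∑ r ∈ Finset.range L, E (u r) v t)
  have h7 := abs_add_le (D t)
    (∑ r ∈ Finset.range L, (E (u r) w t + ∑ r' ∈ Finset.range r, E (u r') (u r) t))
  unfold totalDigit
  have h8 : (0 : ℤ) ≤ L := by positivity
  nlinarith [mul_nonneg h8 hK]

namespace ICfg

variable [Fact (2 < Q)] [NeZero g] (ω : ℕ → Bool) {b m : ℕ} {code : ℕ → ℕ → ℕ → ℕ} {dcode : ℕ → ℕ}

/-- The invariant after r phases: block w of the first tape is the sum of the rows of the guessed
vertices at w; block w of the second is this sum plus the negated threshold plus all weights among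
the guessed vertices. The condition L m ≤ g j guarantees that every request for a bit is served. -/
theorem execs_streamCmds {K : ℤ} (hK : 1 ≤ K) (hc : ∀ v w t, IsCode (code v w t))
    (hd : ∀ t, IsCode (dcode t)) (F L j : ℕ) (hj : L * m ≤ g * j) (hQ : 4 * (K * (L + 2) ^ 2) < Q) :
    (execs (K : ZMod Q) ω (streamCmds F (2 ^ m) b m L code dcode) (initial Q g j)).ctl.ans = true ↔
      ∃ v < 2 ^ m, ∃ w < 2 ^ m, ∑ t ∈ Finset.range b,
        totalDigit L (fun v w t => codeInt K (code v w t)) (fun t => codeInt K (dcode t))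
          (fun r => guessed ω (r * m) m) v w t * 2 ^ t < 0 := by
  set u : ℕ → ℕ := fun r => guessed ω (r * m) m with hu
  have hul : ∀ r, u r < 2 ^ m := fun r => guessed_lt _ _ _
  set I₀ := execs (K : ZMod Q) ω (initCmds (2 ^ m) b dcode)
    { initial Q g j with ctl := { (initial Q g j).ctl with mat := true } } with hI₀
  rw [execs_initCmds (K : ZMod Q) ω hd rfl rfl rfl rfl] at hI₀
  have key := execs_flatMap (K : ZMod Q) ω (f := fun _ => 0 :: phaseCmds (2 ^ m) b m code) (n := L)
    (fun r J => r ≤ L → J.ctl.d = 0 ∧ J.ctl.car = 0 ∧ J.ctl.ans = false ∧ J.G.pos = 0 ∧ J.S1.pos = 0 ∧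
      J.S2.pos = 0 ∧ J.used = r * m ∧ J.budget + r * m = g * j ∧
      (∀ w < 2 ^ m, ∀ t < b, J.S1.cell ((w * b + t : ℕ) : ℤ) =
        ∑ r ∈ Finset.range r, codeVal K (code (u r) w t)) ∧
      (∀ w < 2 ^ m, ∀ t < b, J.S2.cell ((w * b + t : ℕ) : ℤ) = codeVal K (dcode t) +
        ∑ r ∈ Finset.range r, (codeVal K (code (u r) w t) +
          ∑ r' ∈ Finset.range r, codeVal K (code (u r') (u r) t)))) (fun r hr J hJ _ => ?_)
    (I := I₀) (fun _ => ?_)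
  · obtain ⟨a1, a2, a3, a4, a5, a6, a7, a8, a9, a10⟩ := key le_rfl
    set J := execs (K : ZMod Q) ω ((List.range L).flatMap fun _ => 0 :: phaseCmds (2 ^ m) b m code) I₀
      with hJ
    have hall : execs (K : ZMod Q) ω (streamCmds F (2 ^ m) b m L code dcode) (initial Q g j) =
        execs (K : ZMod Q) ω ((List.range (2 ^ m)).flatMap fun v => 0 :: rowCmds 16 (2 ^ m) b v (code v)) J := by
      rw [streamCmds, execs_append, execs_replicate_zero, execs_cons, exec_nine, execs_append,
        execs_append, hJ, hI₀, execs_initCmds (K : ZMod Q) ω hd rfl rfl rfl rfl]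
    have hcarry : ∀ v < 2 ^ m, ∀ w < 2 ^ m, ((carry (fun t => codeVal (K : ZMod Q) (code v w t) +
        J.S1.cell ((v * b + t : ℕ) : ℤ) + J.S2.cell ((w * b + t : ℕ) : ℤ)) b).valMinAbs < 0 ↔
        ∑ t ∈ Finset.range b,
        totalDigit L (fun v w t => codeInt K (code v w t)) (fun t => codeInt K (dcode t)) u v w t
          * 2 ^ t < 0) := by
      intro v hv w hw
      rw [← carry_neg_iff (Q := Q) (fun t => abs_totalDigit_le L
        (fun v w t => abs_codeInt_le hK (code v w t)) (fun t => abs_codeInt_le hK (dcode t)) u v w t)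
        (by exact_mod_cast hQ)]
      rw [carry_congr fun t ht => ?_]
      rw [a9 v hv t ht, a10 w hw t ht]
      simp only [totalDigit, codeVal_intCast]
      push_cast
      ring
    have hfin := execs_flatMap (K : ZMod Q) ω (f := fun v => 0 :: rowCmds 16 (2 ^ m) b v (code v)) (n := 2 ^ m)
      (fun v I => v ≤ 2 ^ m → I.ctl.d = 0 ∧ I.ctl.car = 0 ∧ I.S1 = J.S1 ∧ I.S2 = J.S2 ∧
        (I.ctl.ans = true ↔ ∃ v' < v, ∃ w < 2 ^ m, ∑ t ∈ Finset.range b,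
        totalDigit L (fun v w t => codeInt K (code v w t)) (fun t => codeInt K (dcode t)) u v' w t
          * 2 ^ t < 0)) (fun v hv I hI _ => ?_) (I := J) (fun _ => ?_)
    · rw [hall]
      exact (hfin le_rfl).2.2.2.2
    · obtain ⟨c1, c2, c3, c4, c5⟩ := hI (by omega)
      rw [execs_cons, exec_zero, execs_rowCmds_acc (K : ZMod Q) ω (hc v) v c1 c2 (by rw [c3, a5]) (by rw [c4, a6])]
      refine ⟨c1, c2, c3, c4, ?_⟩
      dsimp only
      rw [Bool.or_eq_true, c5, decide_eq_true_eq, c3, c4]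
      constructor
      · rintro (⟨v', h, h'⟩ | ⟨w, hw, h'⟩)
        · exact ⟨v', by omega, h'⟩
        · exact ⟨v, by omega, w, hw, (hcarry v hv w hw).1 h'⟩
      · rintro ⟨v', h, w, hw, h'⟩
        rcases Nat.lt_succ_iff_lt_or_eq.1 h with h | rfl
        · exact .inl ⟨v', h, w, hw, h'⟩
        · exact .inr ⟨w, hw, (hcarry _ hv w hw).2 h'⟩
    · exact ⟨a1, a2, rfl, rfl, by simp [a3]⟩
  · obtain ⟨a1, a2, a3, a4, a5, a6, a7, a8, a9, a10⟩ := hJ hr.le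
    have hb : m ≤ J.budget := by
      have : (r + 1) * m ≤ L * m := Nat.mul_le_mul_right _ hr
      rw [add_mul] at this
      omega
    rw [execs_cons, exec_zero]
    obtain ⟨c1, c2, c3, c4, c5, c6, c7, c8⟩ := execs_phaseCmds (K : ZMod Q) ω hc J a1 a2 a4 a5 a6 hb
    have hur : guessed ω J.used m = u r := by rw [a7]
    rw [hur] at c7 c8
    refine ⟨c1, c2, c3.trans a3, c4, by rw [c7], by rw [c8], by rw [c5, a7]; ring,
      by rw [add_mul]; omega, fun w hw t ht => ?_, fun w hw t ht => ?_⟩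
    · rw [c7]
      dsimp only
      rw [Pi.add_apply, field_apply _ hw ht, a9 w hw t ht, Finset.sum_range_succ]
    · rw [c8]
      dsimp only
      rw [Pi.add_apply, field_apply _ hw ht, a10 w hw t ht, Finset.sum_range_succ,
        a9 _ (hul r) t ht]
      ring
  · rw [hI₀]
    refine ⟨rfl, rfl, rfl, rfl, rfl, rfl, by simp [initial], by simp [budget, initial],
      fun w hw t ht => by simp [initial], fun w hw t ht => ?_⟩
    simp only [Pi.add_apply]
    rw [field_apply _ hw ht]
    simp [initial]

end ICfg

/-- The choice of the vertices by the oracle. -/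
theorem exists_guessed (L m : ℕ) (u : ℕ → ℕ) (hu : ∀ r < L, u r < 2 ^ m) :
    ∃ ω : ℕ → Bool, ∀ r < L, guessed ω (r * m) m = u r := by
  have hbits : ∀ x k : ℕ, (∑ i ∈ Finset.range k, if x.testBit i then 2 ^ i else 0) = x % 2 ^ k := by
    intro x k
    induction k with
    | zero => simp [Nat.mod_one]
    | succ k ih =>
      rw [Finset.sum_range_succ, ih, Nat.mod_pow_succ, Nat.testBit_eq_decide_div_mod_eq]
      rcases Nat.mod_two_eq_zero_or_one (x / 2 ^ k) with h | h <;> simp [h]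
  refine ⟨fun i => (u (i / m)).testBit (i % m), fun r hr => ?_⟩
  rw [← Nat.mod_eq_of_lt (hu r hr), ← hbits]
  refine Finset.sum_congr rfl fun i hi => ?_
  have hi := Finset.mem_range.1 hi
  have h1 : (r * m + i) / m = r := by
    rw [mul_comm, Nat.mul_add_div (by omega), Nat.div_eq_of_lt hi, add_zero]
  have h2 : (r * m + i) % m = i := by
    rw [mul_comm, Nat.mul_add_mod, Nat.mod_eq_of_lt hi]
  simp only [h1, h2]

end Interp

/-! ## Cliques as sequences of vertices -/

namespace CliqueInstance

variable {N : ℕ}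

/-- The weight of the pairs in the sequence `u 0, …, u (ℓ - 1)`. -/
def pairSum (W : ℕ → ℕ → ℤ) (u : ℕ → ℕ) (ℓ : ℕ) : ℤ :=
  ∑ r ∈ Finset.range ℓ, ∑ r' ∈ Finset.range r, W (u r') (u r)

theorem totalWeight_insert (I : CliqueInstance N) {s : Finset (Fin N)} {a : Fin N} (ha : a ∉ s) :
    I.totalWeight (insert a s) = I.totalWeight s + ∑ c ∈ s, I.weight s(c, a) := by
  unfold totalWeight
  simp only [Finset.sum_filter, Finset.sum_product, Finset.sum_insert ha, Finset.sum_add_distrib]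
  have : ∑ c ∈ s, I.weight s(c, a) = (∑ c ∈ s, if a < c then I.weight s(a, c) else 0) +
      ∑ c ∈ s, if c < a then I.weight s(c, a) else 0 := by
    rw [← Finset.sum_add_distrib]
    refine Finset.sum_congr rfl fun c hc => ?_
    have hne : c ≠ a := fun h => ha (h ▸ hc)
    rcases lt_or_gt_of_ne hne with h | h
    · rw [if_pos h, if_neg h.asymm, zero_add]
    · rw [if_pos h, if_neg h.asymm, add_zero, Sym2.eq_swap]
  rw [this, if_neg (lt_irrefl a)]
  ring

theorem totalWeight_image (I : CliqueInstance N) (f : ℕ → Fin N) {ℓ : ℕ}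
    (hf : ∀ r < ℓ, ∀ r' < r, f r' ≠ f r) :
    ((Finset.range ℓ).image f).card = ℓ ∧ I.totalWeight ((Finset.range ℓ).image f) =
      ∑ r ∈ Finset.range ℓ, ∑ r' ∈ Finset.range r, I.weight s(f r', f r) := by
  have hinj : ∀ ℓ' ≤ ℓ, Set.InjOn f (Finset.range ℓ') := by
    intro ℓ' hℓ r hr r' hr' h
    rw [Finset.mem_coe, Finset.mem_range] at hr hr'
    rcases lt_trichotomy r r' with h' | h' | h'
    · exact absurd h (hf r' (by omega) r h')
    · exact h'
    · exact absurd h.symm (hf r (by omega) r' h')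
  refine ⟨by rw [Finset.card_image_of_injOn (hinj ℓ le_rfl), Finset.card_range], ?_⟩
  induction ℓ with
  | zero => simp [totalWeight]
  | succ ℓ ih =>
    rw [Finset.range_add_one, Finset.image_insert, totalWeight_insert, Finset.sum_insert (by simp),
      ih (fun r hr => hf r (by omega)) (fun ℓ' h => hinj ℓ' (by omega)),
      Finset.sum_image (hinj ℓ (by omega)), add_comm]
    rw [Finset.mem_image]
    rintro ⟨r, hr, h⟩
    exact hf ℓ (by omega) r (Finset.mem_range.1 hr) h

open Classical in
/-- The weight of a pair of vertices, where a missing edge is so heavy that no clique of weight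
less than the threshold can use it. -/
def paddedWeight (I : CliqueInstance N) (K : ℤ) (b a c : ℕ) : ℤ :=
  if I.AdjN a c then I.weightN a c else K * (2 ^ b - 1)

theorem abs_le_of_size_le {z : ℤ} {b : ℕ} (h : z.natAbs.size ≤ b) : |z| ≤ 2 ^ b - 1 := by
  have h1 : z.natAbs < 2 ^ b := Nat.size_le.1 h
  have : ((z.natAbs : ℕ) : ℤ) < ((2 ^ b : ℕ) : ℤ) := by exact_mod_cast h1
  push_cast at this
  linarith

/-- Arbitrary sequences, with repetitions and with numbers beyond N, may be tested. Put M = 2^b - 1: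
all weights and the threshold are at most M in absolute value, fewer than ℓ² pairs occur, and one
missing edge of weight K M pushes the sum to at least (K - ℓ²) M ≥ M, which is not below the
threshold. -/
theorem isYes_iff (I : CliqueInstance N) {ℓ b n : ℕ} {K : ℤ} (hℓ : 2 ≤ ℓ) (hn : N ≤ n) (hK : (ℓ : ℤ) ^ 2 + 1 ≤ K)
    (hw : ∀ a c, I.AdjN a c → (I.weightN a c).natAbs.size ≤ b) (hd : I.bound.natAbs.size ≤ b) :
    I.IsYes ℓ ↔ ∃ u : ℕ → ℕ, (∀ r < ℓ, u r < n) ∧ pairSum (I.paddedWeight K b) u ℓ < I.bound := by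
  constructor
  · rintro ⟨s, hs, hlt⟩
    set e := s.orderEmbOfFin hs.card_eq with he
    set u : ℕ → ℕ := fun r => if h : r < ℓ then (e ⟨r, h⟩ : ℕ) else 0 with hu
    have hmem : ∀ r : Fin ℓ, e r ∈ s := fun r => Finset.orderEmbOfFin_mem _ _ _
    have huN : ∀ r < ℓ, u r < N := fun r hr => by simp only [hu, dif_pos hr]; exact (e ⟨r, hr⟩).2
    refine ⟨u, fun r hr => (huN r hr).trans_le hn, lt_of_eq_of_lt ?_ hlt⟩
    have h0 : 0 < ℓ := by omega
    set f : ℕ → Fin N := fun r => if h : r < ℓ then e ⟨r, h⟩ else e ⟨0, h0⟩ with hf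
    have hne : ∀ r < ℓ, ∀ r' < r, f r' ≠ f r := by
      intro r hr r' hr' h
      simp only [hf, dif_pos hr, dif_pos (hr'.trans hr)] at h
      have := e.injective h
      simp at this
      omega
    have himg : (Finset.range ℓ).image f = s := by
      refine Finset.eq_of_subset_of_card_le ?_ ?_
      · intro x hx
        obtain ⟨r, hr, rfl⟩ := Finset.mem_image.1 hx
        simp only [hf, dif_pos (Finset.mem_range.1 hr)]
        exact hmem _
      · rw [(I.totalWeight_image f hne).1, hs.card_eq]
    rw [← himg, (I.totalWeight_image f hne).2]
    refine Finset.sum_congr rfl fun r hr => Finset.sum_congr rfl fun r' hr' => ?_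
    have hr := Finset.mem_range.1 hr
    have hr' := Finset.mem_range.1 hr'
    have hfu : ∀ r < ℓ, u r = f r := fun r hr => by simp only [hu, hf, dif_pos hr]
    have hfs : ∀ r < ℓ, f r ∈ s := fun r hr => by simp only [hf, dif_pos hr]; exact hmem _
    have hadj : I.AdjN (u r') (u r) := by
      rw [hfu r hr, hfu r' (hr'.trans hr)]
      exact ⟨(f r').2, (f r).2, hs.isClique (hfs r' (hr'.trans hr)) (hfs r hr) (hne r hr r' hr')⟩
    rw [paddedWeight, if_pos hadj, hfu r hr, hfu r' (hr'.trans hr)]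
    simp [weightN]
  · rintro ⟨u, hu, hlt⟩
    have hM : (0 : ℤ) ≤ 2 ^ b - 1 := by
      have : (1 : ℤ) ≤ 2 ^ b := one_le_pow₀ (by norm_num)
      linarith
    have hadj : ∀ r < ℓ, ∀ r' < r, I.AdjN (u r') (u r) := by
      intro r₀ hr₀ r₁ hr₁
      by_contra hna
      have hbound : ∀ a c, -(2 ^ b - 1 : ℤ) ≤ I.paddedWeight K b a c := by
        intro a c
        unfold paddedWeight
        split_ifs with h
        · exact (abs_le.1 (abs_le_of_size_le (hw a c h))).1
        · nlinarith [sq_nonneg (ℓ : ℤ)]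
      have hinner : ∀ r, r < ℓ → -(ℓ * (2 ^ b - 1 : ℤ)) ≤
          ∑ r' ∈ Finset.range r, I.paddedWeight K b (u r') (u r) := by
        intro r hr
        have := Finset.card_nsmul_le_sum (Finset.range r)
          (fun r' => I.paddedWeight K b (u r') (u r)) _ fun r' _ => hbound _ _
        rw [Finset.card_range, nsmul_eq_mul] at this
        have : (r : ℤ) ≤ ℓ := by exact_mod_cast hr.le
        nlinarith
      have hinner₀ : K * (2 ^ b - 1 : ℤ) - ℓ * (2 ^ b - 1 : ℤ) ≤
          ∑ r' ∈ Finset.range r₀, I.paddedWeight K b (u r') (u r₀) := by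
        rw [← Finset.add_sum_erase _ _ (Finset.mem_range.2 hr₁)]
        have := Finset.card_nsmul_le_sum ((Finset.range r₀).erase r₁)
          (fun r' => I.paddedWeight K b (u r') (u r₀)) _ fun r' _ => hbound _ _
        rw [nsmul_eq_mul] at this
        have hc : ((((Finset.range r₀).erase r₁).card : ℕ) : ℤ) ≤ ℓ := by
          have := Finset.card_erase_le (s := Finset.range r₀) (a := r₁)
          rw [Finset.card_range] at this
          exact_mod_cast this.trans hr₀.le
        have e : I.paddedWeight K b (u r₁) (u r₀) = K * (2 ^ b - 1) := by
          rw [paddedWeight, if_neg hna]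
        rw [e]
        nlinarith
      have htot : K * (2 ^ b - 1 : ℤ) - ℓ * (ℓ * (2 ^ b - 1 : ℤ)) ≤
          pairSum (I.paddedWeight K b) u ℓ := by
        unfold pairSum
        rw [← Finset.add_sum_erase _ _ (Finset.mem_range.2 hr₀)]
        have := Finset.card_nsmul_le_sum ((Finset.range ℓ).erase r₀)
          (fun r => ∑ r' ∈ Finset.range r, I.paddedWeight K b (u r') (u r))
          (-(ℓ * (2 ^ b - 1 : ℤ))) fun r hr =>
          hinner r (Finset.mem_range.1 (Finset.mem_of_mem_erase hr))
        rw [nsmul_eq_mul, Finset.card_erase_of_mem (Finset.mem_range.2 hr₀), Finset.card_range,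
          Nat.cast_sub (by omega)] at this
        push_cast at this
        nlinarith
      have := (abs_le.1 (abs_le_of_size_le hd)).2
      nlinarith
    -- As ℓ ≥ 2, every member of the sequence belongs to some pair, and adjacency forces it to be a
    -- vertex.
    have huN : ∀ r < ℓ, u r < N := by
      intro r hr
      rcases Nat.eq_zero_or_pos r with h | h
      · subst h
        exact (hadj 1 (by omega) 0 (by omega)).1
      · exact (hadj r hr 0 h).2.1
    set f : ℕ → Fin N := fun r => if h : r < ℓ then ⟨u r, huN r h⟩ else ⟨u 0, huN 0 (by omega)⟩ with hf
    have hfu : ∀ r < ℓ, (f r : ℕ) = u r := fun r hr => by simp only [hf, dif_pos hr]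
    have hfadj : ∀ r < ℓ, ∀ r' < r, I.graph.Adj (f r') (f r) := by
      intro r hr r' hr'
      obtain ⟨h1, h2, h3⟩ := hadj r hr r' hr'
      simpa only [hf, dif_pos hr, dif_pos (hr'.trans hr)] using h3
    obtain ⟨hcard, htot⟩ := I.totalWeight_image f (ℓ := ℓ) fun r hr r' hr' => (hfadj r hr r' hr').ne
    refine ⟨(Finset.range ℓ).image f, ⟨?_, hcard⟩, ?_⟩
    · intro x hx y hy hxy
      obtain ⟨r, hr, rfl⟩ := Finset.mem_image.1 (Finset.mem_coe.1 hx)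
      obtain ⟨r', hr', rfl⟩ := Finset.mem_image.1 (Finset.mem_coe.1 hy)
      rw [Finset.mem_range] at hr hr'
      rcases lt_trichotomy r r' with h | h | h
      · exact hfadj r' hr' r h
      · exact absurd (by rw [h]) hxy
      · exact (hfadj r hr r' h).symm
    · rw [htot]
      refine lt_of_eq_of_lt ?_ hlt
      refine Finset.sum_congr rfl fun r hr => Finset.sum_congr rfl fun r' hr' => ?_
      have hr := Finset.mem_range.1 hr
      have hr' := Finset.mem_range.1 hr'
      rw [paddedWeight, if_pos (hadj r hr r' hr'), ← hfu r hr, ← hfu r' (hr'.trans hr)]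
      simp [weightN]

end CliqueInstance

/-! ### Correctness of the stream of an instance -/

namespace Interp

open OracleTM CliqueInstance

/-- The command that announces a digit. -/
def signCode (z : ℤ) : ℕ := if 0 < z then 11 else if z < 0 then 12 else 10

theorem isCode_signCode (z : ℤ) : IsCode (signCode z) := by
  unfold signCode IsCode
  split_ifs <;> simp

theorem codeInt_signCode (K : ℤ) {z : ℤ} (hz : |z| ≤ 1) : codeInt K (signCode z) = z := by
  have := abs_le.1 hz
  unfold signCode codeInt
  split_ifs <;> omega

variable {N : ℕ} (I : CliqueInstance N)

open Classical in
/-- The commands for the digits of the weights. -/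
def weightCode (v w t : ℕ) : ℕ := if I.AdjN v w then signCode (While.digit (I.weightN v w) t) else 13

/-- The commands for the digits of the negated threshold. -/
def boundCode (t : ℕ) : ℕ := signCode (-While.digit I.bound t)

theorem isCode_weightCode (v w t : ℕ) : IsCode (weightCode I v w t) := by
  unfold weightCode
  split_ifs
  · exact isCode_signCode _
  · simp [IsCode]

theorem isCode_boundCode (t : ℕ) : IsCode (boundCode I t) := isCode_signCode _

/-- For a missing edge all b digits equal K, and K(1 + 2 + … + 2^(b-1)) = K(2^b - 1). -/
theorem sum_weightCode {K : ℤ} {b v w : ℕ} (h : I.AdjN v w → (I.weightN v w).natAbs.size ≤ b) :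
    ∑ t ∈ Finset.range b, codeInt K (weightCode I v w t) * 2 ^ t = I.paddedWeight K b v w := by
  unfold weightCode paddedWeight
  split_ifs with hadj
  · simp only [codeInt_signCode K (While.digit_abs _ _)]
    exact While.sum_digit _ _ (h hadj)
  · simp only [show codeInt K 13 = K from rfl, ← Finset.mul_sum]
    congr 1
    have := mul_geom_sum (2 : ℤ) b
    linarith

theorem sum_boundCode {K : ℤ} {b : ℕ} (h : I.bound.natAbs.size ≤ b) :
    ∑ t ∈ Finset.range b, codeInt K (boundCode I t) * 2 ^ t = -I.bound := by
  unfold boundCode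
  have h1 : ∀ t, codeInt K (signCode (-While.digit I.bound t)) = -While.digit I.bound t := fun t =>
    codeInt_signCode K (by rw [abs_neg]; exact While.digit_abs _ _)
  simp only [h1, neg_mul, Finset.sum_neg_distrib]
  rw [While.sum_digit _ _ h]

/-- The digits held on the tapes are those of the clique weight minus the threshold, for the
sequence of the L guessed vertices followed by v and w. -/
theorem sum_totalDigit (L b : ℕ) (E : ℕ → ℕ → ℕ → ℤ) (D : ℕ → ℤ) (u : ℕ → ℕ) (v w : ℕ)
    (W : ℕ → ℕ → ℤ) (d : ℤ) (hW : ∀ v w, ∑ t ∈ Finset.range b, E v w t * 2 ^ t = W v w)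
    (hd : ∑ t ∈ Finset.range b, D t * 2 ^ t = -d) (u' : ℕ → ℕ) (hu : ∀ r < L, u' r = u r)
    (hv : u' L = v) (hw : u' (L + 1) = w) :
    ∑ t ∈ Finset.range b, totalDigit L E D u v w t * 2 ^ t = pairSum W u' (L + 2) - d := by
  have h1 : ∀ f : ℕ → ℕ → ℤ, ∀ n, ∑ t ∈ Finset.range b, (∑ r ∈ Finset.range n, f r t) * 2 ^ t =
      ∑ r ∈ Finset.range n, ∑ t ∈ Finset.range b, f r t * 2 ^ t := by
    intro f n
    rw [Finset.sum_comm]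
    simp only [Finset.sum_mul]
  have h2 : ∑ r ∈ Finset.range L, W (u' r) v = ∑ r ∈ Finset.range L, W (u r) v :=
    Finset.sum_congr rfl fun r hr => by rw [hu r (Finset.mem_range.1 hr)]
  have h3 : ∑ r ∈ Finset.range L, W (u' r) w = ∑ r ∈ Finset.range L, W (u r) w :=
    Finset.sum_congr rfl fun r hr => by rw [hu r (Finset.mem_range.1 hr)]
  have h4 : ∑ r ∈ Finset.range L, ∑ r' ∈ Finset.range r, W (u' r') (u' r) =
      ∑ r ∈ Finset.range L, ∑ r' ∈ Finset.range r, W (u r') (u r) :=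
    Finset.sum_congr rfl fun r hr => Finset.sum_congr rfl fun r' hr' => by
      have hr := Finset.mem_range.1 hr
      rw [hu r hr, hu r' ((Finset.mem_range.1 hr').trans hr)]
  unfold totalDigit pairSum
  simp only [add_mul, Finset.sum_add_distrib, h1, hW, hd]
  simp only [Finset.sum_range_succ, hv, hw, h2, h3, h4]
  ring

theorem lt_of_mem_streamCmds {F n b m L : ℕ} {code : ℕ → ℕ → ℕ → ℕ} {dcode : ℕ → ℕ}
    (hc : ∀ v w t, IsCode (code v w t)) (hd : ∀ t, IsCode (dcode t)) :
    ∀ j ∈ streamCmds F n b m L code dcode, j < 32 := by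
  have h1 : ∀ v w t, code v w t < 32 := fun v w t => by have := hc v w t; unfold IsCode at this; omega
  have h2 : ∀ t, dcode t < 32 := fun t => by have := hd t; unfold IsCode at this; omega
  intro j hj
  simp only [streamCmds, initCmds, phaseCmds, stepCmds, rowCmds, addCmds, List.mem_append,
    List.mem_cons, List.mem_replicate, List.mem_flatMap, List.not_mem_nil, or_false] at hj
  have h3 : ∀ v w t, j = code v w t → j < 32 := fun v w t h => h ▸ h1 v w t
  have h4 : ∀ t, j = dcode t → j < 32 := fun t h => h ▸ h2 t
  aesop (config := { maxRuleApplications := 2000 })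

/-- The interpreter solves the clique problem on the command stream. -/
theorem run_stream_iff {Q R g : ℕ} [Fact (2 < Q)] [NeZero R] [NeZero g] {K : ℤ} {L b m F j₀ : ℕ}
    (hN : N ≤ 2 ^ m) (hK : ((L + 2 : ℕ) : ℤ) ^ 2 + 1 ≤ K) (hQ : 4 * (K * (L + 2) ^ 2) < Q)
    (hw : ∀ a c, I.AdjN a c → (I.weightN a c).natAbs.size ≤ b) (hd : I.bound.natAbs.size ≤ b)
    (hF : padTime R j₀ ≤ F) (hj₀ : L * m ≤ g * j₀) :
    (∃ bs t, Run ((machine Q R g (K : ZMod Q)).init (While.encodeCommands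
      (streamCmds F (2 ^ m) b m L (weightCode I) (boundCode I)))) bs t true) ↔ I.IsYes (L + 2) := by
  -- The unary code of command 0 is the single bit `false`, so the idle commands at the beginning
  -- are the padding.
  have hx : While.encodeCommands (streamCmds F (2 ^ m) b m L (weightCode I) (boundCode I)) =
      List.replicate F false ++ While.encodeCommands (9 :: (initCmds (2 ^ m) b (boundCode I) ++
        (((List.range L).flatMap fun _ => 0 :: phaseCmds (2 ^ m) b m (weightCode I)) ++
          (List.range (2 ^ m)).flatMap fun v => 0 :: rowCmds 16 (2 ^ m) b v (weightCode I v)))) := by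
    rw [streamCmds, While.encodeCommands_append, List.append_left_inj]
    clear hF
    induction F with
    | zero => rfl
    | succ F ih =>
      rw [List.replicate_succ, List.replicate_succ, ← ih]
      rfl
  refine (exists_run_iff hx hF (fun ω => ∃ v < 2 ^ m, ∃ w < 2 ^ m, ∑ t ∈ Finset.range b,
    totalDigit L (fun v w t => codeInt K (weightCode I v w t)) (fun t => codeInt K (boundCode I t))
      (fun r => guessed ω (r * m) m) v w t * 2 ^ t < 0) fun ω j hj => ?_).trans ?_
  rotate_left
  · rw [isYes_iff I (by omega) hN hK hw hd]
    have hsum := fun u v w u' => sum_totalDigit L b (fun v w t => codeInt K (weightCode I v w t))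
      (fun t => codeInt K (boundCode I t)) u v w (I.paddedWeight K b) I.bound
      (fun v w => sum_weightCode I (hw v w)) (sum_boundCode I hd) u'
    constructor
    · rintro ⟨ω, v, hv, w, hw', hlt⟩
      refine ⟨fun r => if r < L then guessed ω (r * m) m else if r = L then v else w,
        fun r _ => ?_, ?_⟩
      · dsimp only
        split_ifs
        · exact guessed_lt _ _ _
        · exact hv
        · exact hw'
      · rw [hsum _ v w (fun r => if r < L then guessed ω (r * m) m else if r = L then v else w)
          (fun r hr => if_pos hr) (by simp) (by simp)] at hlt
        linarith
    · rintro ⟨u, hu, hlt⟩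
      obtain ⟨ω, hω⟩ := exists_guessed L m u fun r hr => hu r (by omega)
      refine ⟨ω, u L, hu _ (by omega), u (L + 1), hu _ (by omega), ?_⟩
      rw [hsum _ _ _ u (fun r hr => (hω r hr).symm) rfl rfl]
      linarith
  · rw [ICfg.foldl_encodeCommands (K : ZMod Q) ω _
      (lt_of_mem_streamCmds (isCode_weightCode I) (isCode_boundCode I)) _ rfl]
    refine ICfg.execs_streamCmds ω ?_ (isCode_weightCode I) (isCode_boundCode I) F L j
      (hj₀.trans (Nat.mul_le_mul_left _ hj)) hQ
    nlinarith [sq_nonneg ((L + 2 : ℕ) : ℤ)]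

end Interp

/-! ## Generation of the command stream -/

namespace While

/-- Some statement generates the commands `f σ`. -/
def Generable (sym : Bool → ℤ) (d : ℕ) (f : St → List ℕ) : Prop := ∃ p, Generates sym d p f

variable {sym : Bool → ℤ} {d : ℕ}

theorem generable_singleton (j : ℕ) : Generable sym d fun _ => [j] := ⟨_, generates_emit d j⟩

theorem Generable.append {f g : St → List ℕ} (hf : Generable sym d f) (hg : Generable sym d g) :
    Generable sym d fun σ => f σ ++ g σ :=
  ⟨_, hf.choose_spec.seq hg.choose_spec⟩

theorem Generable.cons {f : St → List ℕ} (j : ℕ) (hf : Generable sym d f) :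
    Generable sym d fun σ => j :: f σ := (generable_singleton j).append hf

theorem Generable.ite {e : Expr} {f g : St → List ℕ} (he : Indep d e) (hf : Generable sym d f)
    (hg : Generable sym d g) : Generable sym d fun σ => if 0 < e.eval σ then f σ else g σ :=
  ⟨_, .ite he hf.choose_spec hg.choose_spec⟩

/-- The loop index is made an explicit argument of F, and `hF` says that F does not consult variable
d otherwise. This brings the output to the form of the command lists, free of state changes. -/
theorem Generable.loop {e : Expr} {F : St → ℤ → List ℕ} (hd : 0 < d) (he : Indep d e)
    (hF : ∀ σ i k, F (σ.setv d i) k = F σ k) (hne : ∀ σ k, F σ k ≠ [])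
    (h : Generable sym (d + 1) fun σ => F σ (σ.v d)) :
    Generable sym d fun σ => (List.range (e.eval σ).toNat).flatMap fun i : ℕ => F σ i := by
  obtain ⟨p, hp⟩ := h
  have := Generates.forLoop hd he hp fun σ => hne _ _
  simp only [hF, St.v_setv, if_pos] at this
  exact ⟨_, this⟩

theorem generable_replicate {e : Expr} (hd : 0 < d) (he : Indep d e) (j : ℕ) :
    Generable sym d fun σ => List.replicate (e.eval σ).toNat j := ⟨_, generates_emitMany hd he j⟩

theorem indep_lit (z : ℤ) : Indep d (.lit z) := fun _ _ _ => rfl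

theorem indep_var {x : ℕ} (h0 : 0 < x) (h : x < d) : Indep d (.var x) := fun _ _ hA => hA.1 x h0 h

theorem Indep.sub {a b : Expr} (ha : Indep d a) (hb : Indep d b) : Indep d (.sub a b) :=
  fun σ τ h => by simp only [Expr.eval_sub, ha σ τ h, hb σ τ h]

theorem Indep.mul {a b : Expr} (ha : Indep d a) (hb : Indep d b) : Indep d (.mul a b) :=
  fun σ τ h => by simp only [Expr.eval_mul, ha σ τ h, hb σ τ h]

theorem Indep.pair {a b : Expr} (ha : Indep d a) (hb : Indep d b) : Indep d (.pair a b) :=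
  fun σ τ h => by simp only [Expr.eval_pair, ha σ τ h, hb σ τ h]

theorem Indep.bank {k : ℕ} {a : Expr} (hk : 0 < k) (ha : Indep d a) : Indep d (.bank k a) :=
  fun σ τ h => by simp only [Expr.eval_bank, ha σ τ h, h.2 k hk]

/-- The command that announces a digit of a matrix entry. -/
def weightGen (k : ℕ) (σ : St) (v w t : ℤ) : ℕ :=
  if 0 < σ.bank (k + 2) (pairing v w) then Interp.signCode (σ.bank (k + 1) (pairing (pairing v w) t))
  else 13

/-- The command that announces a digit of the negated threshold. -/
def boundGen (k : ℕ) (σ : St) (t : ℤ) : ℕ :=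
  Interp.signCode (-σ.bank (k + 3) (pairing (pairing 0 0) t))

theorem generable_signCode {e : Expr} (he : Indep d e) :
    Generable sym d fun σ => [Interp.signCode (e.eval σ)] := by
  have h := Generable.ite (sym := sym) he (generable_singleton 11)
    (.ite (e := .sub (.lit 0) e) ((indep_lit 0).sub he) (generable_singleton 12)
      (generable_singleton 10))
  refine cast ?_ h
  congr 1
  funext σ
  simp only [Interp.signCode, Expr.eval_sub, Expr.eval_lit, zero_sub, Left.neg_pos_iff]
  rcases lt_trichotomy 0 (e.eval σ) with h | h | h
  · simp [h]
  · simp [← h]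
  · simp [h, not_lt.2 h.le]

theorem generable_weightGen (k : ℕ) {v w t : ℕ} (hv : 0 < v) (hw : 0 < w) (ht : 0 < t) (hvd : v < d)
    (hwd : w < d) (htd : t < d) :
    Generable sym d fun σ => [weightGen k σ (σ.v v) (σ.v w) (σ.v t)] := by
  have hp := (indep_var hv hvd).pair (indep_var hw hwd)
  have h := Generable.ite (sym := sym) (hp.bank (k := k + 2) (by omega))
    (generable_signCode ((hp.pair (indep_var ht htd)).bank (k := k + 1) (by omega)))
    (generable_singleton 13)
  refine cast ?_ h
  congr 1
  funext σ
  simp only [weightGen, Expr.eval_bank, Expr.eval_pair, Expr.eval_var]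
  split_ifs <;> rfl

theorem generable_boundGen (k : ℕ) {t : ℕ} (ht : 0 < t) (htd : t < d) :
    Generable sym d fun σ => [boundGen k σ (σ.v t)] := by
  have h := generable_signCode (sym := sym) (d := d) ((indep_lit 0).sub
    ((((indep_lit 0).pair (indep_lit 0)).pair (indep_var ht htd)).bank (k := k + 3) (by omega)))
  refine cast ?_ h
  congr 1
  funext σ
  simp [boundGen]

/-- This list and the following ones mirror the command lists of the interpreter, with parameters
taken from the state: variable 7 is the number b of digits, 10 the number 2^(pm) of rows, 11 the
padding unit 2^(sm), and 12 the number pm of bits of a vertex. -/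
def rowGen (k op : ℕ) (σ : St) (v : ℤ) : List ℕ :=
  List.replicate (v * σ.v 7).toNat 1 ++
    (((List.range (σ.v 10).toNat).flatMap fun w : ℕ =>
      ((List.range (σ.v 7).toNat).flatMap fun t : ℕ => [weightGen k σ v w t, op, 1, 3]) ++
      17 :: List.replicate (σ.v 7).toNat 2) ++
    (List.replicate (v * σ.v 7).toNat 2 ++ List.replicate (σ.v 10 * σ.v 7).toNat 4))

def addGen (k : ℕ) (σ : St) (v : ℤ) : List ℕ :=
  ((List.range (σ.v 10).toNat).flatMap fun w : ℕ => 0 :: (List.range (σ.v 7).toNat).flatMap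
    fun t : ℕ => [weightGen k σ v w t, 15, 1]) ++ List.replicate (σ.v 10 * σ.v 7).toNat 2

def initGen (k : ℕ) (σ : St) : List ℕ :=
  ((List.range (σ.v 10).toNat).flatMap fun _ => 0 :: (List.range (σ.v 7).toNat).flatMap
    fun t : ℕ => [boundGen k σ t, 14, 3]) ++ List.replicate (σ.v 10 * σ.v 7).toNat 4

def stepGen (k : ℕ) (σ : St) (v : ℤ) : List ℕ :=
  9 :: (((List.range (σ.v 12).toNat).flatMap fun _ => [8, 5]) ++
    (List.replicate (σ.v 12).toNat 6 ++ (rowGen k 14 σ v ++ addGen k σ v)))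

def phaseGen (k : ℕ) (σ : St) : List ℕ :=
  ((List.range (σ.v 12).toNat).flatMap fun _ => [7, 5]) ++
    (List.replicate (σ.v 12).toNat 6 ++ (List.range (σ.v 10).toNat).flatMap fun v : ℕ => stepGen k σ v)

def streamGen (k L : ℕ) (σ : St) : List ℕ :=
  List.replicate (3 * σ.v 11).toNat 0 ++ (9 :: (initGen k σ ++
    (((List.range L).flatMap fun _ => 0 :: phaseGen k σ) ++
      (List.range (σ.v 10).toNat).flatMap fun v : ℕ => 0 :: rowGen k 16 σ v)))

theorem weightGen_setv (k : ℕ) (σ : St) (x : ℕ) (i v w t : ℤ) :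
    weightGen k (σ.setv x i) v w t = weightGen k σ v w t := rfl

theorem boundGen_setv (k : ℕ) (σ : St) (x : ℕ) (i t : ℤ) :
    boundGen k (σ.setv x i) t = boundGen k σ t := rfl

theorem generable_rowGen (k op : ℕ) {v : ℕ} (hv : 0 < v) (hvd : v < d) (hd : 13 ≤ d) :
    Generable sym d fun σ => rowGen k op σ (σ.v v) := by
  have h7 : ∀ d, 13 ≤ d → Indep d (.var 7) := fun d h => indep_var (by omega) (by omega)
  have h10 : ∀ d, 13 ≤ d → Indep d (.var 10) := fun d h => indep_var (by omega) (by omega)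
  have hvv := (indep_var hv hvd).mul (h7 d hd)
  refine .append (generable_replicate (by omega) hvv 1) (.append ?_
    (.append (generable_replicate (by omega) hvv 2)
      (generable_replicate (e := .mul (.var 10) (.var 7)) (by omega) ((h10 d hd).mul (h7 d hd)) 4)))
  refine Generable.loop (e := .var 10) (F := fun σ w => ((List.range (σ.v 7).toNat).flatMap
    fun t : ℕ => [weightGen k σ (σ.v v) w t, op, 1, 3]) ++ 17 :: List.replicate (σ.v 7).toNat 2)
    (by omega) (h10 d hd) (fun σ i w => ?_) (by simp) (.append ?_ (.cons 17 ?_))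
  · simp only [weightGen_setv, St.v_setv, if_neg (show (7 : ℕ) ≠ d by omega), if_neg hvd.ne]
  · refine Generable.loop (e := .var 7) (F := fun σ t => [weightGen k σ (σ.v v) (σ.v d) t, op, 1, 3])
      (by omega) (h7 _ (by omega)) (fun σ i t => ?_) (by simp) ?_
    · simp only [weightGen_setv, St.v_setv, if_neg (show d ≠ d + 1 by omega),
        if_neg (show v ≠ d + 1 by omega)]
    · exact (generable_weightGen k hv (by omega) (by omega) (by omega) (by omega) (by omega)).append
        (.cons op (.cons 1 (generable_singleton 3)))
  · exact generable_replicate (e := .var 7) (by omega) (h7 _ (by omega)) 2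

theorem generable_addGen (k : ℕ) {v : ℕ} (hv : 0 < v) (hvd : v < d) (hd : 13 ≤ d) :
    Generable sym d fun σ => addGen k σ (σ.v v) := by
  have h7 : ∀ d, 13 ≤ d → Indep d (.var 7) := fun d h => indep_var (by omega) (by omega)
  have h10 : ∀ d, 13 ≤ d → Indep d (.var 10) := fun d h => indep_var (by omega) (by omega)
  refine .append ?_
    (generable_replicate (e := .mul (.var 10) (.var 7)) (by omega) ((h10 d hd).mul (h7 d hd)) 2)
  refine Generable.loop (e := .var 10) (F := fun σ w => 0 :: ((List.range (σ.v 7).toNat).flatMap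
    fun t : ℕ => [weightGen k σ (σ.v v) w t, 15, 1]))
    (by omega) (h10 d hd) (fun σ i w => ?_) (by simp) (.cons 0 ?_)
  · simp only [weightGen_setv, St.v_setv, if_neg (show (7 : ℕ) ≠ d by omega), if_neg hvd.ne]
  · refine Generable.loop (e := .var 7) (F := fun σ t => [weightGen k σ (σ.v v) (σ.v d) t, 15, 1])
      (by omega) (h7 _ (by omega)) (fun σ i t => ?_) (by simp) ?_
    · simp only [weightGen_setv, St.v_setv, if_neg (show d ≠ d + 1 by omega),
        if_neg (show v ≠ d + 1 by omega)]
    · exact (generable_weightGen k hv (by omega) (by omega) (by omega) (by omega) (by omega)).append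
        (.cons 15 (generable_singleton 1))

theorem generable_initGen (k : ℕ) (hd : 13 ≤ d) : Generable sym d fun σ => initGen k σ := by
  have h7 : ∀ d, 13 ≤ d → Indep d (.var 7) := fun d h => indep_var (by omega) (by omega)
  have h10 : ∀ d, 13 ≤ d → Indep d (.var 10) := fun d h => indep_var (by omega) (by omega)
  refine .append ?_
    (generable_replicate (e := .mul (.var 10) (.var 7)) (by omega) ((h10 d hd).mul (h7 d hd)) 4)
  refine Generable.loop (e := .var 10) (F := fun σ _ => 0 :: ((List.range (σ.v 7).toNat).flatMap
    fun t : ℕ => [boundGen k σ t, 14, 3]))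
    (by omega) (h10 d hd) (fun σ i w => ?_) (by simp) (.cons 0 ?_)
  · simp only [boundGen_setv, St.v_setv, if_neg (show (7 : ℕ) ≠ d by omega)]
  · refine Generable.loop (e := .var 7) (F := fun σ t => [boundGen k σ t, 14, 3])
      (by omega) (h7 _ (by omega)) (fun σ i t => rfl) (by simp) ?_
    exact (generable_boundGen k (by omega) (by omega)).append (.cons 14 (generable_singleton 3))

theorem generable_stepGen (k : ℕ) {v : ℕ} (hv : 0 < v) (hvd : v < d) (hd : 13 ≤ d) :
    Generable sym d fun σ => stepGen k σ (σ.v v) := by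
  have h12 : Indep d (.var 12) := indep_var (by omega) (by omega)
  exact .cons 9 (.append (.loop (e := .var 12) (F := fun _ _ => [8, 5]) (by omega) h12
    (fun _ _ _ => rfl) (by simp) (.cons 8 (generable_singleton 5)))
    (.append (generable_replicate (e := .var 12) (by omega) h12 6)
      (.append (generable_rowGen k 14 hv hvd hd) (generable_addGen k hv hvd hd))))

theorem generable_phaseGen (k : ℕ) (hd : 13 ≤ d) : Generable sym d fun σ => phaseGen k σ := by
  have h12 : Indep d (.var 12) := indep_var (by omega) (by omega)
  refine .append (.loop (e := .var 12) (F := fun _ _ => [7, 5]) (by omega) h12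
    (fun _ _ _ => rfl) (by simp) (.cons 7 (generable_singleton 5)))
    (.append (generable_replicate (e := .var 12) (by omega) h12 6) ?_)
  refine .loop (e := .var 10) (F := fun σ v => stepGen k σ v) (by omega)
    (indep_var (by omega) (by omega)) (fun σ i v => ?_) (by simp [stepGen])
    (generable_stepGen k (by omega) (by omega) (by omega))
  simp only [stepGen, rowGen, addGen, weightGen_setv, St.v_setv, if_neg (show (7 : ℕ) ≠ d by omega),
    if_neg (show (10 : ℕ) ≠ d by omega), if_neg (show (12 : ℕ) ≠ d by omega)]

/-- Variables from 13 on are free for loop counters, since the parameters are in variables up to 12.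
The number L of phases is a constant of the program. -/
theorem generable_streamGen (k L : ℕ) : Generable sym 13 fun σ => streamGen k L σ := by
  refine .append (generable_replicate (e := .mul (.lit 3) (.var 11)) (by omega)
    ((indep_lit 3).mul (indep_var (by omega) (by omega))) 0) (.cons 9 (.append
    (generable_initGen k le_rfl) (.append ?_ ?_)))
  · refine .loop (e := .lit L) (F := fun σ _ => 0 :: phaseGen k σ) (by omega) (indep_lit _)
      (fun σ i v => ?_) (by simp) (.cons 0 (generable_phaseGen k (by omega)))
    simp only [phaseGen, stepGen, rowGen, addGen, weightGen_setv, St.v_setv,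
      if_neg (show (7 : ℕ) ≠ 13 by omega),
      if_neg (show (10 : ℕ) ≠ 13 by omega), if_neg (show (12 : ℕ) ≠ 13 by omega)]
  · refine .loop (e := .var 10) (F := fun σ v => 0 :: rowGen k 16 σ v) (by omega)
      (indep_var (by omega) (by omega)) (fun σ i v => ?_) (by simp)
      (.cons 0 (generable_rowGen k 16 (by omega) (by omega) (by omega)))
    simp only [rowGen, weightGen_setv, St.v_setv, if_neg (show (7 : ℕ) ≠ 13 by omega),
      if_neg (show (10 : ℕ) ≠ 13 by omega)]

theorem streamGen_eq {k L b n m F : ℕ} {σ : St} {code : ℕ → ℕ → ℕ → ℕ} {dcode : ℕ → ℕ}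
    (h7 : σ.v 7 = b) (h10 : σ.v 10 = n) (h11 : σ.v 11 = F) (h12 : σ.v 12 = m)
    (hc : ∀ v w t : ℕ, weightGen k σ v w t = code v w t) (hd : ∀ t : ℕ, boundGen k σ t = dcode t) :
    streamGen k L σ = Interp.streamCmds (3 * F) n b m L code dcode := by
  have e1 : ∀ a c : ℕ, ((a : ℤ) * c).toNat = a * c := fun a c => by
    rw [← Nat.cast_mul, Int.toNat_natCast]
  have e2 : ((3 : ℤ) * F).toNat = 3 * F := e1 3 F
  simp only [streamGen, Interp.streamCmds, initGen, Interp.initCmds, phaseGen, Interp.phaseCmds,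
    stepGen, Interp.stepCmds, rowGen, Interp.rowCmds, addGen, Interp.addCmds, h7, h10, h11, h12, hc,
    hd, e1, e2, Int.toNat_natCast]

end While

/-! ### Length of the command stream -/

namespace Interp

theorem length_flatMap_range_le {α : Type*} {f : ℕ → List α} {n c : ℕ}
    (h : ∀ i < n, (f i).length ≤ c) : ((List.range n).flatMap f).length ≤ n * c := by
  induction n with
  | zero => simp
  | succ n ih =>
    rw [List.range_succ, List.flatMap_append, List.length_append, add_mul, one_mul]
    exact add_le_add (ih fun i hi => h i (by omega)) (by simpa using h n (by omega))

variable {n b m : ℕ}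

theorem length_rowCmds_le (op : ℕ) {v : ℕ} (hv : v ≤ n) (code : ℕ → ℕ → ℕ) :
    (rowCmds op n b v code).length ≤ 8 * (n * (b + 1)) := by
  have h1 : ((List.range n).flatMap fun w => ((List.range b).flatMap fun t => [code w t, op, 1, 3]) ++
      17 :: List.replicate b 2).length ≤ n * (5 * b + 1) := by
    refine length_flatMap_range_le fun w _ => ?_
    have := length_flatMap_range_le (f := fun t => [code w t, op, 1, 3]) (n := b) (c := 4)
      fun _ _ => by simp
    simp only [List.length_append, List.length_cons, List.length_replicate]
    omega
  have h2 : v * b ≤ n * b := Nat.mul_le_mul_right _ hv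
  simp only [rowCmds, List.length_append, List.length_replicate]
  nlinarith

theorem length_addCmds_le (code : ℕ → ℕ → ℕ) : (addCmds n b code).length ≤ 4 * (n * (b + 1)) := by
  have h1 : ((List.range n).flatMap fun w => 0 :: (List.range b).flatMap
      fun t => [code w t, 15, 1]).length ≤ n * (3 * b + 1) := by
    refine length_flatMap_range_le fun w _ => ?_
    have := length_flatMap_range_le (f := fun t => [code w t, 15, 1]) (n := b) (c := 3)
      fun _ _ => by simp
    simp only [List.length_cons]
    omega
  simp only [addCmds, List.length_append, List.length_replicate]
  nlinarith

theorem length_initCmds_le (code : ℕ → ℕ) : (initCmds n b code).length ≤ 4 * (n * (b + 1)) := by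
  have h1 : ((List.range n).flatMap fun _ => 0 :: (List.range b).flatMap
      fun t => [code t, 14, 3]).length ≤ n * (3 * b + 1) := by
    refine length_flatMap_range_le fun w _ => ?_
    have := length_flatMap_range_le (f := fun t => [code t, 14, 3]) (n := b) (c := 3)
      fun _ _ => by simp
    simp only [List.length_cons]
    omega
  simp only [initCmds, List.length_append, List.length_replicate]
  nlinarith

theorem length_phaseCmds_le (hm : m ≤ n) (hn : 1 ≤ n) (code : ℕ → ℕ → ℕ → ℕ) :
    (phaseCmds n b m code).length ≤ 19 * (n ^ 2 * (b + 1)) := by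
  have hpair : ∀ x y : ℕ, ((List.range m).flatMap fun _ => [x, y]).length ≤ m * 2 := fun x y =>
    length_flatMap_range_le fun _ _ => by simp
  have h1 : ((List.range n).flatMap fun v => stepCmds n b m v code).length ≤
      n * (16 * (n * (b + 1))) := by
    refine length_flatMap_range_le fun v hv => ?_
    have e1 := length_rowCmds_le (b := b) 14 hv.le (code v)
    have e2 := length_addCmds_le (n := n) (b := b) (code v)
    have e3 := hpair 8 5
    simp only [stepCmds, List.length_append, List.length_cons, List.length_replicate]
    nlinarith
  have e3 := hpair 7 5
  simp only [phaseCmds, List.length_append, List.length_replicate]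
  have : n ≤ n ^ 2 * (b + 1) := by nlinarith [Nat.le_mul_of_pos_left n hn, Nat.zero_le (n ^ 2 * b)]
  nlinarith

/-- Processing a row takes O(n(b + 1)) commands including the return of the heads, and there are (L
+ 1)n rows in all. This linear size in the matrix is what makes the exponent 2 + k possible. -/
theorem length_streamCmds_le (F L : ℕ) (hm : m ≤ n) (hn : 1 ≤ n) (code : ℕ → ℕ → ℕ → ℕ)
    (dcode : ℕ → ℕ) :
    (streamCmds F n b m L code dcode).length ≤ F + (20 * L + 14) * (n ^ 2 * (b + 1)) := by
  have h1 : ((List.range L).flatMap fun _ => 0 :: phaseCmds n b m code).length ≤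
      L * (20 * (n ^ 2 * (b + 1))) := by
    refine length_flatMap_range_le fun _ _ => ?_
    have := length_phaseCmds_le (b := b) hm hn code
    have : 1 ≤ n ^ 2 * (b + 1) := Nat.mul_pos (by positivity) (by omega)
    simp only [List.length_cons]
    omega
  have h2 : ((List.range n).flatMap fun v => 0 :: rowCmds 16 n b v (code v)).length ≤
      n * (9 * (n * (b + 1))) := by
    refine length_flatMap_range_le fun v hv => ?_
    have := length_rowCmds_le (b := b) 16 hv.le (code v)
    have : 1 ≤ n * (b + 1) := Nat.mul_pos hn (by omega)
    simp only [List.length_cons]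
    omega
  have h3 := length_initCmds_le (n := n) (b := b) dcode
  have h4 : n * (b + 1) ≤ n ^ 2 * (b + 1) := Nat.mul_le_mul_right _ (by nlinarith)
  have h5 : 1 ≤ n ^ 2 * (b + 1) := Nat.mul_pos (by positivity) (by omega)
  simp only [streamCmds, List.length_append, List.length_cons, List.length_replicate]
  nlinarith

theorem length_encodeCommands_le (l : List ℕ) (h : ∀ j ∈ l, j < 32) :
    (While.encodeCommands l).length ≤ 32 * l.length := by
  induction l with
  | nil => simp
  | cons j l ih =>
    have h1 := ih fun i hi => h i (List.mem_cons_of_mem _ hi)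
    have h2 := h j (by simp)
    simp only [While.encodeCommands, List.flatMap_cons, List.length_append, List.length_replicate,
      List.length_cons, List.length_nil] at h1 ⊢
    omega

end Interp

/-! ### The program for the clique problem -/

namespace While

open Interp OracleTM

theorem Parsed.weightGen_eq {w N W : ℕ} {I : CliqueInstance N} {σ : St}
    (h : Parsed w I W (fun _ _ => True) σ) (a c t : ℕ) :
    weightGen w σ a c t = weightCode I a c t := by
  unfold weightGen weightCode
  by_cases hadj : I.AdjN a c
  · rw [if_pos hadj, (h.adj a c).1 ⟨trivial, hadj⟩, if_pos (by norm_num),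
      (h.digits a c t).1 ⟨trivial, hadj⟩]
  · rw [if_neg hadj, (h.adj a c).2 fun h => hadj h.2, if_neg (by norm_num)]

theorem total_time_le {t₁ t₂ t₃ t₄ t l A p C₁ C₂ X Y E Z U : ℕ} (h₁ : t₁ ≤ 60 * E)
    (h₂ : t₂ ≤ (2 * p + 20) * Z) (h₃ : t₃ ≤ C₂ * (l + 1)) (h₄ : t₄ ≤ C₁ * (t + 1)) (hl : l ≤ A * X)
    (hX : X = Z + E) (hY : Y = U + X) (hX1 : 1 ≤ X) (ht : t ≤ U) :
    t₁ + (t₂ + (t₃ + t₄)) + 2 ≤ (60 + (2 * p + 20) + C₂ * (A + 1) + C₁ + C₁ + 32 * A + 2) * Y := by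
  have a1 : t₁ ≤ 60 * Y := h₁.trans (by omega)
  have a2 : t₂ ≤ (2 * p + 20) * Y := h₂.trans (Nat.mul_le_mul_left _ (by omega))
  have a3 : t₃ ≤ C₂ * (A + 1) * Y := by
    refine h₃.trans ?_
    rw [mul_assoc]
    refine Nat.mul_le_mul_left _ ?_
    have : A * X ≤ A * Y := Nat.mul_le_mul_left _ (by omega)
    rw [add_mul]
    omega
  have a4 : t₄ ≤ C₁ * Y + C₁ * Y := by
    refine h₄.trans ?_
    rw [← mul_add]
    exact Nat.mul_le_mul_left _ (by omega)
  have e : (60 + (2 * p + 20) + C₂ * (A + 1) + C₁ + C₁ + 32 * A + 2) * Y =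
      60 * Y + (2 * p + 20) * Y + C₂ * (A + 1) * Y + C₁ * Y + C₁ * Y + 32 * A * Y + 2 * Y := by ring
  rw [e]
  have := Nat.zero_le (32 * A * Y)
  omega

/-- A deterministic machine for the language of the interpreter yields a program for the minimum
weight clique problem. -/
theorem exists_program {Q p s g : ℕ} [Fact (2 < Q)] [NeZero g] {K : ℤ} {L : ℕ} (hp : 0 < p)
    (hps : p ≤ s) (hg : L * p ≤ g) (hK : ((L + 2 : ℕ) : ℤ) ^ 2 + 1 ≤ K)
    (hQ : 4 * (K * (L + 2) ^ 2) < Q) (M : OracleTM) (T : ℕ → ℕ) (hT : Monotone T)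
    (hrun : ∀ x : List Bool, ∃ t ≤ T x.length, ∃ b, Run (M.init x) [] t b)
    (hacc : ∀ x : List Bool, (∃ bs t, Run ((machine Q (2 ^ s) g (K : ZMod Q)).init x) bs t true) ↔
      ∃ bs t, Run (M.init x) bs t true) :
    ∃ (P : List RAM.Instr) (D : ℕ), ∀ (N : ℕ) (I : CliqueInstance N) (W : ℕ),
      (∀ a c, I.AdjN a c → (I.weightN a c).natAbs.size ≤ W) → I.bound.natAbs.size ≤ W →
      ∃ m X, N ≤ 2 ^ (p * m) ∧ 2 ^ (p * m) ≤ 2 ^ p * (N + 1) ∧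
        X = 2 ^ (s * m) + (N + 1) ^ 2 * (W + 1) ∧
        RAM.DecidesWithin P I.encode (D * (T (D * X) + X) * scale (D * (T (D * X) + X)))
          (I.IsYes (L + 2)) := by
  obtain ⟨sim, sym, C₁, hsim⟩ := exists_simulator M
  obtain ⟨gen, hgen, C₂, hC₂⟩ := generable_streamGen (sym := sym) M.workTapes L
  obtain ⟨P, C₃, hP⟩ := Stmt.decides (readGraph M.workTapes ;; (setup p s ;; (gen ;; sim))) 2
  -- bounds for the length of the stream and the running time
  set A := 9 + (20 * L + 14) * 4 ^ p with hA
  set D₀ := 60 + (2 * p + 20) + C₂ * (A + 1) + C₁ + C₁ + 32 * A + 2 with hD₀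
  refine ⟨P, (C₃ + 1) * D₀, fun N I W hW hW' => ?_⟩
  obtain ⟨t₁, ht₁, σ₁, e₁, hpar⟩ := readGraph_ev M.workTapes I W hW hW'
  obtain ⟨m, t₂, σ₂, hN, hN', ht₂, e₂, h10, h11, h12, hlow, hbank⟩ :=
    setup_ev p s hp hps N σ₁ hpar.size
  refine ⟨m, _, hN, hN', rfl, ?_⟩
  set X := 2 ^ (s * m) + (N + 1) ^ 2 * (W + 1) with hX
  have hX1 : 1 ≤ X := by
    have : 0 < 2 ^ (s * m) := by positivity
    omega
  obtain ⟨b, hb, hbW, hbd, hbw⟩ := hpar.width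
  have hweight : ∀ a c t : ℕ, weightGen M.workTapes σ₂ a c t = weightCode I a c t := fun a c t => by
    rw [← hpar.weightGen_eq]
    simp only [weightGen, hbank]
  have hstream := streamGen_eq (k := M.workTapes) (L := L) (σ := σ₂) (code := weightCode I)
    (dcode := boundCode I) ((hlow 7 (by norm_num)).trans hb) h10 h11 h12 hweight
    fun t => by simp only [boundGen, boundCode, hbank, hpar.bound t]
  set l := streamCmds (3 * 2 ^ (s * m)) (2 ^ (p * m)) b (p * m) L (weightCode I) (boundCode I) with hl
  have hlen : l.length ≤ A * X := by
    have h1 := length_streamCmds_le (b := b) (3 * 2 ^ (s * m)) L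
      (Nat.lt_two_pow_self (n := p * m)).le Nat.one_le_two_pow (weightCode I) (boundCode I)
    rw [← hl] at h1
    have h2 : (2 ^ (p * m)) ^ 2 * (b + 1) ≤ 4 ^ p * ((N + 1) ^ 2 * (W + 1)) := by
      calc (2 ^ (p * m)) ^ 2 * (b + 1) ≤ (2 ^ p * (N + 1)) ^ 2 * (W + 1) := by gcongr
        _ = (2 ^ 2) ^ p * ((N + 1) ^ 2 * (W + 1)) := by rw [← pow_mul, mul_comm 2 p, pow_mul]; ring
        _ = _ := by norm_num
    have h3 := Nat.mul_le_mul_left (20 * L + 14) h2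
    rw [hA, hX]
    nlinarith [Nat.zero_le (2 ^ (s * m)), Nat.zero_le ((20 * L + 14) * 4 ^ p * 2 ^ (s * m))]
  -- The stream is written into bank 0, which is the input tape of the simulated machine; the banks
  -- of the work tapes are still blank.
  obtain ⟨t₃, ht₃, σ₃, e₃, hout, hagree⟩ := hC₂ σ₂ []
    ⟨by rw [hlow 0 (by norm_num), hpar.out]; rfl, fun z => by
      rw [hbank, hpar.low 0 (Nat.zero_le _)]; simp⟩
  simp only [hstream] at ht₃ hout
  set x := encodeCommands l with hx
  have hxlen : x.length ≤ 32 * (A * X) :=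
    (length_encodeCommands_le l (lt_of_mem_streamCmds (isCode_weightCode I)
      (isCode_boundCode I))).trans (Nat.mul_le_mul_left _ hlen)
  obtain ⟨t, ht, a, hr⟩ := hrun x
  obtain ⟨t₄, ht₄, σ₄, e₄, hans⟩ := hsim x t a hr σ₃ (by simpa using hout.2) fun i z hi hiw => by
    rw [hagree.2 i hi, hbank, hpar.low i hiw]
  -- The answer of M is identified with acceptance by the interpreter. Uniqueness of runs excludes
  -- that M also accepts in another way.
  have hyes : a = true ↔ I.IsYes (L + 2) := by
    rw [← run_stream_iff (Q := Q) (R := 2 ^ s) (g := g) (K := K) (b := b) (m := p * m)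
      (F := 3 * 2 ^ (s * m)) (j₀ := m) I hN hK hQ (fun a c h => hbw a c trivial h) hbd ?_ ?_, hacc]
    · constructor
      · rintro rfl
        exact ⟨_, _, hr⟩
      · rintro ⟨bs, t', h⟩
        exact (run_init_iff.1 hr).unique (run_init_iff.1 h) (List.nil_prefix) List.prefix_rfl
    -- The 3·2^(sm) zeros give at least m tokens, worth g m ≥ L p m bits: enough for L vertices of p
    -- m bits each.
    · have := padTime_le (2 ^ s) m (by
        calc 2 = 2 ^ 1 := rfl
          _ ≤ 2 ^ s := Nat.pow_le_pow_right (by norm_num) (by omega))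
      rw [← pow_mul] at this
      omega
    · rw [← mul_assoc]
      exact Nat.mul_le_mul_right _ hg
  have hdec := hP I.encode _ σ₄ (I.IsYes (L + 2)) (.seq e₁ (.seq e₂ (.seq e₃ e₄)))
    (by rw [hans, ← hyes]; cases a <;> simp)
  obtain ⟨s', hs', rest⟩ := hdec
  refine ⟨s', hs'.trans ?_, rest⟩
  set Y := T ((C₃ + 1) * D₀ * X) + X with hY
  have hTle : T x.length ≤ T ((C₃ + 1) * D₀ * X) := by
    refine hT (hxlen.trans ?_)
    have : 32 * A ≤ (C₃ + 1) * D₀ :=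
      le_trans (by rw [hD₀]; omega) (Nat.le_mul_of_pos_left D₀ (Nat.succ_pos C₃))
    calc 32 * (A * X) = 32 * A * X := by ring
      _ ≤ _ := Nat.mul_le_mul_right _ this
  have hfinal : t₁ + (t₂ + (t₃ + t₄)) + 2 ≤ D₀ * Y :=
    total_time_le ht₁ ht₂ ht₃ ht₄ hlen hX hY hX1 (ht.trans hTle)
  have hD : D₀ * Y ≤ (C₃ + 1) * D₀ * Y := by
    rw [mul_assoc]; exact Nat.le_mul_of_pos_left _ (Nat.succ_pos C₃)
  refine Nat.mul_le_mul ?_ (scale_mono (hfinal.trans hD))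
  rw [mul_assoc (C₃ + 1)]
  exact Nat.mul_le_mul (Nat.le_succ C₃) ((Nat.le_succ _).trans hfinal)

end While

/-! ## Estimates -/

/-- Rounding a p up to an integer s costs less than 1, and 1 ≤ δ p once p is large. The ratio s/p
approximates 2 + k from above because the bound on oracle bits must hold exactly, while the length
of the padding may be slightly larger. -/
theorem exists_ratio {a δ : ℝ} (ha : 1 ≤ a) (hδ : 0 < δ) :
    ∃ p s : ℕ, 0 < p ∧ p ≤ s ∧ a * p ≤ s ∧ (s : ℝ) ≤ (a + δ) * p := by
  obtain ⟨p, hp⟩ := exists_nat_gt (1 / δ)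
  have hp0 : (0 : ℝ) < p := lt_trans (by positivity) hp
  have h1 : 1 ≤ δ * p := by
    rw [div_lt_iff₀ hδ] at hp
    linarith
  have h2 := Nat.le_ceil (a * p)
  have h3 := Nat.ceil_lt_add_one (show 0 ≤ a * p by positivity)
  refine ⟨p, ⌈a * p⌉₊, by exact_mod_cast hp0, ?_, h2, by nlinarith⟩
  have : (p : ℝ) ≤ (⌈a * p⌉₊ : ℝ) := le_trans (by nlinarith) h2
  exact_mod_cast this

theorem While.scale_le_rpow {τ : ℝ} (hτ : 0 < τ) : ∃ C : ℝ, ∀ B : ℕ,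
    (While.scale B : ℝ) ≤ C * ((B : ℝ) + 2) ^ τ := by
  refine ⟨1 / (τ * Real.log 2) + 1, fun B => ?_⟩
  have h2 : (0 : ℝ) < Real.log 2 := Real.log_pos (by norm_num)
  have hB : (1 : ℝ) ≤ (B : ℝ) + 2 := by have : (0 : ℝ) ≤ B := by positivity
                                        linarith
  have h1 : ((Nat.log 2 (B + 2) : ℕ) : ℝ) ≤ Real.logb 2 ((B : ℝ) + 2) := by
    have := Real.natLog_le_logb (B + 2) 2
    push_cast at this
    exact this
  have h3 := Real.log_le_rpow_div (show (0 : ℝ) ≤ (B : ℝ) + 2 by linarith) hτ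
  have h4 : (1 : ℝ) ≤ ((B : ℝ) + 2) ^ τ := Real.one_le_rpow hB hτ.le
  have h5 : Real.logb 2 ((B : ℝ) + 2) ≤ 1 / (τ * Real.log 2) * ((B : ℝ) + 2) ^ τ := by
    rw [Real.logb, div_le_iff₀ h2]
    refine h3.trans (le_of_eq ?_)
    field_simp
  unfold While.scale
  push_cast
  nlinarith

theorem isBigO_natCast_rpow {β : ℝ} (hβ : 0 ≤ β) :
    (fun _ : ℕ => (1 : ℝ)) =O[atTop] fun N : ℕ => (N : ℝ) ^ β := by
  refine IsBigO.of_bound 1 ?_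
  filter_upwards [eventually_ge_atTop 1] with N hN
  have : (1 : ℝ) ≤ N := by exact_mod_cast hN
  have h1 := Real.one_le_rpow this hβ
  rw [norm_one, one_mul, Real.norm_of_nonneg (by positivity)]
  exact h1

theorem isBigO_rpow_rpow {β γ : ℝ} (h : β ≤ γ) :
    (fun N : ℕ => (N : ℝ) ^ β) =O[atTop] fun N : ℕ => (N : ℝ) ^ γ := by
  refine IsBigO.of_bound 1 ?_
  filter_upwards [eventually_ge_atTop 1] with N hN
  have : (1 : ℝ) ≤ N := by exact_mod_cast hN
  rw [Real.norm_of_nonneg (by positivity), Real.norm_of_nonneg (by positivity), one_mul]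
  exact Real.rpow_le_rpow_of_exponent_le this h

/-- A bound for the size of the command stream of a graph on `N` vertices. -/
def streamBound (p s : ℕ) (B : ℕ → ℝ) (N : ℕ) : ℕ :=
  ⌊((2 : ℝ) ^ p * (N + 1)) ^ ((s : ℝ) / p)⌋₊ + (N + 1) ^ 2 * (⌊B N⌋₊ + 1 + 1)

theorem isBigO_succ : (fun N : ℕ => (N : ℝ) + 1) =O[atTop] fun N : ℕ => (N : ℝ) := by
  refine IsBigO.of_bound 2 ?_
  filter_upwards [eventually_ge_atTop 1] with N hN
  have : (1 : ℝ) ≤ N := by exact_mod_cast hN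
  rw [Real.norm_of_nonneg (by positivity), Real.norm_of_nonneg (by positivity)]
  linarith

/-- The padding contributes exponent s/p, the matrix exponent 2 + k + h(N); both are eventually at
most 2 + k + δ. -/
theorem isBigO_streamBound {p s : ℕ} {k δ : ℝ} {h : ℕ → ℝ} (hk : 0 ≤ k) (hδ : 0 < δ)
    (hh : Tendsto h atTop (𝓝 0)) (hs : (s : ℝ) / p ≤ 2 + k + δ) :
    (fun N => (streamBound p s (fun N => (N : ℝ) ^ (k + h N)) N : ℝ)) =O[atTop]
      fun N : ℕ => (N : ℝ) ^ (2 + k + δ) := by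
  have h1 : (fun N : ℕ => ((2 : ℝ) ^ p * ((N : ℝ) + 1)) ^ ((s : ℝ) / p)) =O[atTop]
      fun N : ℕ => (N : ℝ) ^ (2 + k + δ) := by
    refine IsBigO.trans ?_ (isBigO_rpow_rpow hs)
    exact (isBigO_succ.const_mul_left _).rpow (by positivity) (Eventually.of_forall fun N => by positivity)
  have h2 : (fun N : ℕ => (N : ℝ) ^ (k + h N)) =O[atTop] fun N : ℕ => (N : ℝ) ^ (k + δ) := by
    refine IsBigO.of_bound 1 ?_
    filter_upwards [eventually_ge_atTop 1, hh.eventually (gt_mem_nhds hδ)] with N hN hlt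
    have : (1 : ℝ) ≤ N := by exact_mod_cast hN
    rw [Real.norm_of_nonneg (by positivity), Real.norm_of_nonneg (by positivity), one_mul]
    exact Real.rpow_le_rpow_of_exponent_le this (by linarith)
  have h3 : (fun N : ℕ => (N : ℝ) ^ (k + h N) + 2) =O[atTop] fun N : ℕ => (N : ℝ) ^ (k + δ) := by
    refine h2.add ?_
    simpa using (isBigO_natCast_rpow (show 0 ≤ k + δ by linarith)).const_mul_left 2
  have h4 : (fun N : ℕ => ((N : ℝ) + 1) ^ 2 * ((N : ℝ) ^ (k + h N) + 2)) =O[atTop]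
      fun N : ℕ => (N : ℝ) ^ (2 + k + δ) := by
    refine ((isBigO_succ.pow 2).mul h3).congr' EventuallyEq.rfl ?_
    filter_upwards [eventually_ge_atTop 1] with N hN
    have : (0 : ℝ) < N := by exact_mod_cast hN
    rw [← Real.rpow_natCast, ← Real.rpow_add this]
    congr 1
    push_cast; ring
  refine IsBigO.trans (IsBigO.of_bound 1 (Eventually.of_forall fun N => ?_)) (h1.add h4)
  have f1 := Nat.floor_le (show (0 : ℝ) ≤ ((2 : ℝ) ^ p * ((N : ℝ) + 1)) ^ ((s : ℝ) / p) by positivity)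
  have f2 := Nat.floor_le (show (0 : ℝ) ≤ (N : ℝ) ^ (k + h N) by positivity)
  rw [Real.norm_of_nonneg (by positivity), Real.norm_of_nonneg (by positivity), one_mul]
  unfold streamBound
  push_cast
  have : ((N : ℝ) + 1) ^ 2 * (↑⌊(N : ℝ) ^ (k + h N)⌋₊ + 1 + 1) ≤
      ((N : ℝ) + 1) ^ 2 * ((N : ℝ) ^ (k + h N) + 2) := by
    refine mul_le_mul_of_nonneg_left ?_ (by positivity)
    linarith
  linarith

/-- The running time of the program, in terms of the length of the command stream. -/
def timeBound (D : ℕ) (T : ℕ → ℕ) (X : ℕ) : ℕ :=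
  D * (T (D * X) + X) * While.scale (D * (T (D * X) + X))

theorem timeBound_mono (D : ℕ) {T : ℕ → ℕ} (hT : Monotone T) : Monotone (timeBound D T) := by
  intro X Y h
  have h1 : D * (T (D * X) + X) ≤ D * (T (D * Y) + Y) :=
    Nat.mul_le_mul_left _ (add_le_add (hT (Nat.mul_le_mul_left _ h)) h)
  exact Nat.mul_le_mul h1 (While.scale_mono h1)

/-- The simulated time is X^e, and e ≥ 1 makes it dominate the generation of the stream. The
logarithmic cost factor is smaller than any power, which accounts for 1 + τ. -/
theorem isBigO_timeBound (D : ℕ) {T X : ℕ → ℕ} {c e β τ : ℝ} (he : 1 ≤ e) (hβ : 0 ≤ β)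
    (hτ : 0 < τ) (hT : ∀ n, (T n : ℝ) ≤ c * ((n : ℝ) + 1) ^ e)
    (hX : (fun N => (X N : ℝ)) =O[atTop] fun N : ℕ => (N : ℝ) ^ β) :
    (fun N => (timeBound D T (X N) : ℝ)) =O[atTop] fun N : ℕ => (N : ℝ) ^ (β * e * (1 + τ)) := by
  have hpos : ∀ γ : ℝ, 0 ≤ᶠ[atTop] fun N : ℕ => (N : ℝ) ^ γ :=
    fun γ => Eventually.of_forall fun N => by positivity
  have h1 : (fun N => ((D : ℝ) * X N + 1) ^ e) =O[atTop] fun N : ℕ => (N : ℝ) ^ (β * e) := by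
    have := ((hX.const_mul_left D).add (isBigO_natCast_rpow hβ)).rpow (by linarith : (0 : ℝ) ≤ e)
      (hpos β)
    refine this.congr_right fun N => ?_
    rw [← Real.rpow_mul (by positivity)]
  have h2 : (fun N => (T (D * X N) : ℝ)) =O[atTop] fun N : ℕ => (N : ℝ) ^ (β * e) := by
    refine IsBigO.trans (IsBigO.of_bound c (Eventually.of_forall fun N => ?_)) h1
    rw [Real.norm_of_nonneg (by positivity), Real.norm_of_nonneg (by positivity)]
    have := hT (D * X N)
    push_cast at this
    exact this
  have h3 : (fun N => (D : ℝ) * (T (D * X N) + X N) + 2) =O[atTop]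
      fun N : ℕ => (N : ℝ) ^ (β * e) := by
    have h4 := hX.trans (isBigO_rpow_rpow (show β ≤ β * e by nlinarith))
    refine ((h2.add h4).const_mul_left _).add ?_
    simpa using (isBigO_natCast_rpow (show 0 ≤ β * e by positivity)).const_mul_left 2
  have h5 := h3.rpow (show (0 : ℝ) ≤ 1 + τ by linarith) (hpos _)
  obtain ⟨C, hC⟩ := While.scale_le_rpow hτ
  refine IsBigO.trans (IsBigO.of_bound C (Eventually.of_forall fun N => ?_))
    (h5.congr_right fun N => (Real.rpow_mul (by positivity) _ _).symm)
  rw [Real.norm_of_nonneg (by positivity), Real.norm_of_nonneg (by positivity)]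
  have h6 := hC (D * (T (D * X N) + X N))
  unfold timeBound
  push_cast at h6 ⊢
  set y : ℝ := (D : ℝ) * (T (D * X N) + X N) with hy
  have hy0 : 0 ≤ y := by positivity
  have h7 : (0 : ℝ) ≤ While.scale (D * (T (D * X N) + X N)) := by positivity
  rw [Real.rpow_add (by linarith), Real.rpow_one]
  calc y * (While.scale (D * (T (D * X N) + X N)) : ℝ)
      ≤ (y + 2) * (While.scale (D * (T (D * X N) + X N)) : ℝ) := by gcongr; linarith
    _ ≤ (y + 2) * (C * (y + 2) ^ τ) := by gcongr
    _ = _ := by ring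

theorem size_le_of_abs_le {z : ℤ} {y : ℝ} (h : |(z : ℝ)| ≤ 2 ^ y) :
    z.natAbs.size ≤ ⌊y⌋₊ + 1 := by
  rw [Nat.size_le]
  have h1 : (2 : ℝ) ^ y < 2 ^ ((⌊y⌋₊ + 1 : ℕ) : ℝ) :=
    Real.rpow_lt_rpow_of_exponent_lt (by norm_num) (by push_cast; exact Nat.lt_floor_add_one y)
  rw [Real.rpow_natCast] at h1
  have h2 : ((z.natAbs : ℕ) : ℝ) = |(z : ℝ)| := by
    rw [Nat.cast_natAbs, Int.cast_abs]
  have h3 : ((z.natAbs : ℕ) : ℝ) < ((2 ^ (⌊y⌋₊ + 1) : ℕ) : ℝ) := by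
    rw [h2]; push_cast; linarith
  exact_mod_cast h3

/-- Having j > 0 tokens requires 2^(sj) ≤ n, so s j ≤ log₂ n and p j ≤ log₂ n / (2 + k). The case j
= 0 is separate because n may be 0. -/
theorem guesses_le {L p s n j : ℕ} {k : ℝ} (hk : 0 ≤ k) (hs : (2 + k) * p ≤ s)
    (h : Interp.padTime (2 ^ s) j ≤ n) :
    L * p * j ≤ L * ⌈1 / (2 + k) * Real.logb 2 (n : ℝ)⌉₊ := by
  rw [mul_assoc]
  refine Nat.mul_le_mul_left _ ?_
  rcases Nat.eq_zero_or_pos j with rfl | hj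
  · simp
  have h1 := (Interp.pow_le_padTime (2 ^ s) j hj).trans h
  rw [← pow_mul] at h1
  have h2 : (2 : ℝ) ^ ((s * j : ℕ) : ℝ) ≤ n := by
    rw [Real.rpow_natCast]
    exact_mod_cast h1
  have hn : (0 : ℝ) < n := lt_of_lt_of_le (by positivity) h2
  have h3 : ((s * j : ℕ) : ℝ) ≤ Real.logb 2 n := (Real.le_logb_iff_rpow_le (by norm_num) hn).2 h2
  have h4 : ((p * j : ℕ) : ℝ) ≤ 1 / (2 + k) * Real.logb 2 n := by
    rw [one_div, ← div_eq_inv_mul, le_div_iff₀ (by linarith)]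
    refine le_trans ?_ h3
    push_cast
    have : (0 : ℝ) ≤ j := by positivity
    nlinarith
  exact_mod_cast h4.trans (Nat.le_ceil _)

theorem RAM.DecidesWithin.mono {P : List RAM.Instr} {x : List Bool} {t t' : ℕ} {p : Prop}
    (h : RAM.DecidesWithin P x t p) (ht : t ≤ t') : RAM.DecidesWithin P x t' p := by
  obtain ⟨s, hs, rest⟩ := h
  exact ⟨s, hs.trans ht, rest⟩

namespace CliqueInstance

variable {N : ℕ} {I : CliqueInstance N} {y : ℝ}

theorem InRange.size_bound_le (h : I.InRange (2 ^ y)) : I.bound.natAbs.size ≤ ⌊y⌋₊ + 1 :=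
  size_le_of_abs_le h.2

theorem InRange.size_weightN_le (h : I.InRange (2 ^ y)) {a c : ℕ} (hac : I.AdjN a c) :
    (I.weightN a c).natAbs.size ≤ ⌊y⌋₊ + 1 := by
  obtain ⟨ha, hc, hadj⟩ := hac
  refine size_le_of_abs_le ?_
  have := h.1 s(⟨a, ha⟩, ⟨c, hc⟩) hadj
  simpa [weightN, ha, hc] using this

end CliqueInstance

/-- The padding length 2^(sm) is the power s/p of 2^(pm), which is at most 2^p (N + 1). -/
theorem le_streamBound {p s m N : ℕ} {B : ℕ → ℝ} (hp : 0 < p)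
    (hm : 2 ^ (p * m) ≤ 2 ^ p * (N + 1)) :
    2 ^ (s * m) + (N + 1) ^ 2 * (⌊B N⌋₊ + 1 + 1) ≤ streamBound p s B N := by
  refine Nat.add_le_add_right (Nat.le_floor ?_) _
  have hp' : (p : ℝ) ≠ 0 := by exact_mod_cast hp.ne'
  have h1 : (2 : ℝ) ^ (p * m) ≤ 2 ^ p * (N + 1) := by exact_mod_cast hm
  have h2 : ((2 : ℝ) ^ (p * m)) ^ ((s : ℝ) / p) = 2 ^ (s * m) := by
    rw [← Real.rpow_natCast, ← Real.rpow_mul (by norm_num), ← Real.rpow_natCast]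
    congr 1
    push_cast
    field_simp
  push_cast
  rw [← h2]
  exact Real.rpow_le_rpow (by positivity) h1 (by positivity)

/-- A polynomial bound at infinity on a running time extends to a monotone bound everywhere. -/
theorem exists_monotone_bound {T : ℕ → ℕ} {a e : ℝ} (hae : a ≤ e) (he : 0 ≤ e)
    (hT : (fun n => (T n : ℝ)) =O[atTop] fun n : ℕ => (n : ℝ) ^ a) :
    ∃ (T' : ℕ → ℕ) (c : ℝ), Monotone T' ∧ (∀ n, T n ≤ T' n) ∧
      ∀ n, (T' n : ℝ) ≤ c * ((n : ℝ) + 1) ^ e := by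
  have h1 : (fun n => (T n : ℝ)) =O[atTop] fun n : ℕ => ((n : ℝ) + 1) ^ e := by
    refine (hT.trans (isBigO_rpow_rpow hae)).trans (IsBigO.of_bound 1 (Eventually.of_forall ?_))
    intro n
    rw [Real.norm_of_nonneg (by positivity), Real.norm_of_nonneg (by positivity), one_mul]
    exact Real.rpow_le_rpow (by positivity) (by linarith) he
  obtain ⟨c, hc, hb⟩ := bound_of_isBigO_nat_atTop h1
  have hle : ∀ n, (T n : ℝ) ≤ c * ((n : ℝ) + 1) ^ e := fun n => by
    have := hb (show ((n : ℝ) + 1) ^ e ≠ 0 by positivity)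
    rwa [Real.norm_of_nonneg (by positivity), Real.norm_of_nonneg (by positivity)] at this
  refine ⟨fun n => ⌈c * ((n : ℝ) + 1) ^ e⌉₊, c + 1, fun m n hmn => Nat.ceil_mono ?_,
    fun n => by exact_mod_cast (hle n).trans (Nat.le_ceil _), fun n => ?_⟩
  · have : (m : ℝ) ≤ n := by exact_mod_cast hmn
    gcongr
  · have h2 := Nat.ceil_lt_add_one (show 0 ≤ c * ((n : ℝ) + 1) ^ e by positivity)
    have h3 : (1 : ℝ) ≤ ((n : ℝ) + 1) ^ e :=
      Real.one_le_rpow (by have : (0 : ℝ) ≤ n := by positivity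
                           linarith) he
    push_cast
    nlinarith

/-- If some deterministic machine simulates the oracle machines fast, minimum weight cliques can
be detected fast. -/
theorem minWeightCliqueSolvable_of_subset {k δ e b : ℝ} (hk : 0 ≤ k) (hδ : 0 < δ) (he : 1 ≤ e)
    (hbe : b ≤ e) {L : ℕ} (hL : 0 < L) {h : ℕ → ℝ} (hh : Tendsto h atTop (𝓝 0))
    (hsub : NDTIME (fun n => L * ⌈1 / (2 + k) * Real.logb 2 (n : ℝ)⌉₊) (fun n => (n : ℝ)) ⊆
      DTIME fun n => (n : ℝ) ^ b) :
    MinWeightCliqueSolvable (L + 2) (fun N => (2 : ℝ) ^ ((N : ℝ) ^ (k + h N)))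
      (fun N => (N : ℝ) ^ ((2 + k + δ) * e * (1 + δ))) := by
  obtain ⟨p, s, hp, hps, hs, hs'⟩ := exists_ratio (show (1 : ℝ) ≤ 2 + k by linarith) hδ
  -- The smallest K allowed by `isYes_iff` for ℓ = L + 2; Q then exceeds four times the digit bound
  -- K (L + 2)², and also 2.
  set K : ℕ := (L + 2) ^ 2 + 1 with hK
  set Q : ℕ := 4 * (K * (L + 2) ^ 2) + 3 with hQ
  have : Fact (2 < Q) := ⟨by omega⟩
  have : NeZero (L * p) := ⟨(Nat.mul_pos hL hp).ne'⟩
  obtain ⟨M, T₀, hT₀, hM⟩ := hsub (Interp.language_mem_NDTIME (Q := Q) (R := 2 ^ s) (g := L * p)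
    (K := ((K : ℤ) : ZMod Q)) _ fun n j hj => guesses_le hk hs hj)
  obtain ⟨T, c, hTm, hT₀T, hTc⟩ := exists_monotone_bound hbe (by linarith) hT₀
  obtain ⟨P, D, hPD⟩ := While.exists_program (Q := Q) (p := p) (s := s) (g := L * p) (K := (K : ℤ))
    (L := L) hp hps le_rfl (by rw [hK]; push_cast; exact le_rfl)
    (by rw [hQ]; push_cast; linarith) M T hTm
    (fun x => by
      -- With zero oracle bits the run can only use the empty oracle string.
      obtain ⟨bs, hbs, t, ht, a, hr⟩ := (hM x).1 [] rfl
      obtain rfl := List.prefix_nil.1 hbs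
      exact ⟨t, ht.trans (hT₀T _), a, hr⟩)
    fun x => (hM x).2
  refine ⟨P, fun N => timeBound D T (streamBound p s (fun N => (N : ℝ) ^ (k + h N)) N),
    isBigO_timeBound D he (by linarith) hδ hTc (isBigO_streamBound hk hδ hh ?_),
    fun N I hI => ?_⟩
  · rw [div_le_iff₀ (by exact_mod_cast hp)]
    exact hs'
  · obtain ⟨m, X, -, hm, rfl, hdec⟩ := hPD N I (⌊(N : ℝ) ^ (k + h N)⌋₊ + 1)
      (fun a c => hI.size_weightN_le) hI.size_bound_le
    exact hdec.mono (timeBound_mono D hTm (le_streamBound (B := fun N => (N : ℝ) ^ (k + h N)) hp hm))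

end

/-! ### Choice of the exponents and conclusion -/

theorem mainTheorem3 (k : ℝ) (hk : 0 ≤ k) (ℓ : ℕ) (hℓ : 3 ≤ ℓ)
    (h : ℕ → ℝ) (hh : Tendsto h atTop (𝓝 0))
    (hard : ∀ ε : ℝ, 0 < ε → ¬ ∃ η : ℕ → ℝ, Tendsto η atTop (𝓝 0) ∧
      MinWeightCliqueSolvable ℓ (fun N => (2 : ℝ) ^ ((N : ℝ) ^ (k + h N)))
        (fun N => (N : ℝ) ^ ((ℓ : ℝ) - ε + k + η N))) :
    ∀ ε' : ℝ, 0 < ε' →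
      ¬ NDTIME (fun n => (ℓ - 2) * ⌈1 / (2 + k) * Real.logb 2 (n : ℝ)⌉₊) (fun n => (n : ℝ)) ⊆
        DTIME (fun n => (n : ℝ) ^ (1 + ((ℓ : ℝ) - 2) / (2 + k) - ε')) := by
  intro ε' hε' hsub
  obtain ⟨L, rfl⟩ : ∃ L, ℓ = L + 2 := ⟨ℓ - 2, by omega⟩
  have hL : 0 < L := by omega
  have hL' : (0 : ℝ) < L := by exact_mod_cast hL
  rw [Nat.add_sub_cancel] at hsub
  have ha : 0 < 2 + k := by linarith
  -- A large ε' is replaced by a smaller saving γ, so that the exponent e is at least 1 and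
  -- generating the stream is not the bottleneck.
  set γ : ℝ := min ε' (L / (2 + k)) with hγ
  have hγ0 : 0 < γ := lt_min hε' (by positivity)
  set e : ℝ := 1 + L / (2 + k) - γ with he
  have he1 : 1 ≤ e := by
    have := min_le_right ε' (L / (2 + k))
    linarith
  -- Chosen so that the loss e δ (2 + k + 1 + δ) in the exponent is at most half of the saving (2 +
  -- k) γ.
  set δ : ℝ := min 1 ((2 + k) * γ / (2 * e * (2 + k + 2))) with hδ
  have hδ0 : 0 < δ := lt_min one_pos (by positivity)
  have hδ1 : δ ≤ 1 := min_le_left _ _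
  have hδ2 : δ * (2 * e * (2 + k + 2)) ≤ (2 + k) * γ := by
    rw [← le_div_iff₀ (by positivity)]
    exact min_le_right _ _
  have hsolv := minWeightCliqueSolvable_of_subset hk hδ0 he1
    (b := 1 + (((L + 2 : ℕ) : ℝ) - 2) / (2 + k) - ε')
    (by
      have := min_le_left ε' (L / (2 + k))
      push_cast
      rw [add_sub_cancel_right]
      linarith) hL hh hsub
  obtain ⟨P, T, hT, hP⟩ := hsolv
  -- The other half of the saving contradicts hardness, with the zero function for η.
  refine hard ((2 + k) * γ / 2) (by positivity)
    ⟨fun _ => 0, tendsto_const_nhds, P, T, hT.trans (isBigO_rpow_rpow ?_), hP⟩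
  have hae : (2 + k) * e = 2 + k + L - (2 + k) * γ := by
    rw [he]
    field_simp
  have h1 : (2 + k + δ) * e * (1 + δ) = (2 + k) * e + e * δ * (2 + k + 1 + δ) := by ring
  have h2 : e * δ * (2 + k + 1 + δ) ≤ e * δ * (2 + k + 2) := by
    have : 0 ≤ e * δ := by positivity
    exact mul_le_mul_of_nonneg_left (by linarith) this
  push_cast
  rw [h1, hae]
  linarith
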